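/- Fix $D,\chi,T>0$ and $\lambda\in\mathbb R$. Write $\langle u,v\rangle=\int_{\mathbb R}uv\,dx$, $\mathcal E(u)=\langle u',u'\rangle$ and $i_\epsilon(x)=\epsilon^{-1}\mathbf 1_{(x,x+\epsilon]}$. A white noise of variance $\chi$ is a random $W\in\mathcal S'(\mathbb R)$ with $W(u)\sim N(0,\chi\langle u,u\rangle)$ for all $u\in\mathcal S(\mathbb R)$; $W(f)$ is then defined for every $f\in L^2(\mathbb R)$ by approximation in $L^2$. A process $(\mathcal Y_t)_{t\in[0,T]}$ with continuous trajectories in $\mathcal S'(\mathbb R)$ is a *stationary energy solution* of the stochastic Burgers equation $d\mathcal Y_t=D\Delta \mathcal Y_t\,dt+\lambda\nabla \mathcal Y_t^2\,dt+\sqrt{2\chi D}\,\nabla d\mathcal B_t$ if: $\mathcal Y_t$ is a white noise of variance $\chi$ for each $t\in[0,T]$; with $\mathcal A^\epsilon_{s,t}(u)=\int_s^t\int_{\mathbb R}\mathcal Y_r(i_\epsilon(x))^2u'(x)\,dx\,dr$ there is $\kappa>0$ such that, for all $u\in\mathcal S(\mathbb R)$, $0\le s<t\le T$ and $0<\delta<\epsilon<1$,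 $$\mathbb E\Big[\Big(\int_s^t\mathcal Y_r(u'')\,dr\Big)^2\Big]\le\kappa(t-s)\mathcal E(u),\qquad \mathbb E\big[(\mathcal A^\epsilon_{s,t}(u)-\mathcal A^\delta_{s,t}(u))^2\big]\le\kappa(t-s)\epsilon\,\mathcal E(u);$$ and for each $u\in\mathcal S(\mathbb R)$ the process $\mathcal Y_t(u)-\mathcal Y_0(u)-D\int_0^t\mathcal Y_s(u'')\,ds-\lambda\mathcal A_t(u)$ is (up to modification) a continuous martingale of quadratic variation $2\chi D\,\mathcal E(u)\,t$, where $\mathcal A_t(u)=\lim_{\epsilon\to0}\mathcal A^\epsilon_{0,t}(u)$ in $L^2$. A real-valued process $h(t,x)$, $t\in[0,T]$, $x\in\mathbb R$, is an *almost stationary energy solution* of the KPZ equation $dh_t=D\Delta h_t\,dt+\lambda(\nabla h_t)^2dt+\sqrt{2\chi D}\,d\mathcal B_t$ if: for each $t$, $x\mapsto h(t,x)$ is a two-sided Brownian motion of variance $\chi$, up to its value at $x=0$; with $\tilde{\mathcal A}^\epsilon_{s,t}(u)=\int_s^t\int_{\mathbb R}\big\{\big(\tfrac{h(r,x+\epsilon)-h(r,x)}{\epsilon}\big)^2-\tfrac{\chi}{\epsilon}\big\}u(x)\,dx\,dr$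 there is $\kappa>0$ such that, for all $0\le s<t\le T$, $$\mathbb E\Big[\Big(\int_s^t\langle h_r,u''\rangle\,dr\Big)^2\Big]\le\kappa\langle u,u\rangle(t-s)\ \text{ for all } u\in\mathcal S(\mathbb R),$$ $$\mathbb E\big[(\tilde{\mathcal A}^\epsilon_{s,t}(u)-\tilde{\mathcal A}^\delta_{s,t}(u))^2\big]\le\kappa\,\epsilon\,\langle u,u\rangle(t-s)\ \text{ for all } \epsilon>\delta>0 \text{ and } u\in\mathcal S(\mathbb R) \text{ with } \textstyle\int u=0;$$ and for each $u\in\mathcal S(\mathbb R)$ the $L^2$-limit $\tilde{\mathcal A}_{0,t}(u)=\lim_{\epsilon\to0}\tilde{\mathcal A}^\epsilon_{0,t}(u)$ exists for every $t$, and $\langle h_t,u\rangle-\langle h_0,u\rangle-D\int_0^t\langle h_s,u''\rangle\,ds-\lambda\tilde{\mathcal A}_{0,t}(u)$ is (up to modification) a continuous martingale of quadratic variation $2\chi D\langle u,u\rangle t$. Let $F(x)=(1+e^{-x})^{-1}$, let $\theta(x)=\int_x^\infty e^{-1/(y(1-y))}\mathbf 1_{0<y<1}\,dy\,\big/\int_0^1e^{-1/(y(1-y))}\,dy$,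 and let $F_M(x)=F(x)\,\theta(x/M)$ for integers $M\ge1$. For $u\in\mathcal S(\mathbb R)$ let $U(x)=\int_{-\infty}^xu(y)\,dy$ and $\bar u=\int_{\mathbb R}u$. **Theorem.** Let $(\mathcal Y_t)_{t\in[0,T]}$ be a stationary energy solution of the stochastic Burgers equation. As $M\to\infty$, the processes $(\mathcal Y_t(F_M)-\mathcal Y_0(F_M))_{t\in[0,T]}$ converge in distribution, with respect to the uniform topology of $C([0,T];\mathbb R)$, to a continuous process, denoted $(\mathcal Y^*_t(F)-\mathcal Y^*_0(F))_{t\in[0,T]}$, which is defined on the same probability space and is such that, for each $t\in[0,T]$, $\mathcal Y_t(F_M)-\mathcal Y_0(F_M)\to\mathcal Y^*_t(F)-\mathcal Y^*_0(F)$ in $L^2$. Moreover, there is a process $h(t,x)$, $t\in[0,T]$, $x\in\mathbb R$, given by $$h_0(x)=-\mathcal Y_0(\mathbf 1_{(0,x]})\quad(\text{with }\mathbf 1_{(0,x]}:=-\mathbf 1_{(x,0]}\text{ for }x<0),$$ $$\langle h_t,u\rangle=\mathcal Y_t(U-\bar uF)-\mathcal Y_0(U-\bar uF)+\bar u\,\big(\mathcal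 Y_t^*(F)-\mathcal Y_0^*(F)\big)+\langle h_0,u\rangle$$ almost surely, for each $t\in[0,T]$, $x\in\mathbb R$ and $u\in\mathcal S(\mathbb R)$, and $h$ is an almost stationary energy solution of the KPZ equation. -/

import Mathlib

open MeasureTheory ProbabilityTheory Filter Topology Set
open scoped SchwartzMap ENNReal NNReal

noncomputable section

namespace KPZEnergy

/-! ### Test functions -/

/-- The derivative `∇u` of a test function, as a test function. -/
def grad (u : 𝓢(ℝ, ℝ)) : 𝓢(ℝ, ℝ) := SchwartzMap.derivCLM ℝ ℝ u

/-- The second derivative `Δu` of a test function, as a test function. -/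
def lap (u : 𝓢(ℝ, ℝ)) : 𝓢(ℝ, ℝ) := grad (grad u)

/-- The squared `L²` norm `⟨u, u⟩`. -/
def sqNorm (u : 𝓢(ℝ, ℝ)) : ℝ := ∫ x, u x ^ 2

/-- The energy `⟨∇u, ∇u⟩`. -/
def energy (u : 𝓢(ℝ, ℝ)) : ℝ := sqNorm (grad u)

/-- The total integral `ū = ∫ u`. -/
def mean (u : 𝓢(ℝ, ℝ)) : ℝ := ∫ x, u x

/-- The second moment `E[X²]`, as an extended nonnegative number. -/
def secondMoment {Ω : Type*} [MeasurableSpace Ω] (μ : Measure Ω) (X : Ω → ℝ) : ℝ≥0∞ :=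
  ∫⁻ ω, ENNReal.ofReal (X ω ^ 2) ∂μ

/-! ### The logistic function and its cutoffs -/

section

open scoped ContDiff

/-- The unnormalised bump `e^{-1/(y(1-y))} 1_{0<y<1}`. -/
def bump (y : ℝ) : ℝ := if 0 < y ∧ y < 1 then Real.exp (-(1 / (y * (1 - y)))) else 0

/-- The smooth step `θ`, equal to `1` on `(-∞, 0]` and to `0` on `[1, ∞)`. -/
def theta (x : ℝ) : ℝ :=
  (∫ y in Ioi x, bump y) / ∫ y in (0 : ℝ)..1, Real.exp (-(1 / (y * (1 - y))))

/-- The logistic function `F`. -/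
def logistic (x : ℝ) : ℝ := (1 + Real.exp (-x))⁻¹

/-- A function with a Schwartz derivative which vanishes at both infinities is Schwartz. -/
theorem exists_schwartz_of_hasDerivAt (u : 𝓢(ℝ, ℝ)) (g : ℝ → ℝ)
    (hg : ∀ x, HasDerivAt g (u x) x) (htop : Tendsto g atTop (𝓝 0))
    (hbot : Tendsto g atBot (𝓝 0)) : ∃ f : 𝓢(ℝ, ℝ), ∀ x, f x = g x := by
  have hd : deriv g = u := funext fun x => (hg x).deriv
  have hsm : ContDiff ℝ ∞ g := by
    rw [contDiff_infty_iff_deriv]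
    exact ⟨fun x => (hg x).differentiableAt, by rw [hd]; exact u.smooth ⊤⟩
  refine ⟨⟨g, hsm, fun k n => ?_⟩, fun x => rfl⟩
  cases n with
  | succ n =>
    obtain ⟨C, hC⟩ := u.decay' k n
    refine ⟨C, fun x => ?_⟩
    rw [norm_iteratedFDeriv_eq_norm_iteratedDeriv, iteratedDeriv_succ', hd,
      ← norm_iteratedFDeriv_eq_norm_iteratedDeriv]
    exact hC x
  | zero =>
    have hint : Integrable (fun y => ‖y‖ ^ k * ‖u y‖) := u.integrable_pow_mul volume k
    have hpos : ∀ y, 0 ≤ ‖y‖ ^ k * ‖u y‖ := fun y => by positivity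
    refine ⟨∫ y, ‖y‖ ^ k * ‖u y‖, fun x => ?_⟩
    simp only [norm_iteratedFDeriv_zero]
    rcases le_total 0 x with hx | hx
    · have h1 := integral_Ioi_of_hasDerivAt_of_tendsto' (a := x) (fun y _ => hg y)
        u.integrable.integrableOn htop
      have h2 : ‖g x‖ ≤ ∫ y in Ioi x, ‖u y‖ := by
        have : g x = -∫ y in Ioi x, u y := by rw [h1]; ring
        rw [this, norm_neg]
        exact norm_integral_le_integral_norm _
      calc ‖x‖ ^ k * ‖g x‖ ≤ ‖x‖ ^ k * ∫ y in Ioi x, ‖u y‖ := by gcongr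
        _ = ∫ y in Ioi x, ‖x‖ ^ k * ‖u y‖ := (integral_const_mul _ _).symm
        _ ≤ ∫ y in Ioi x, ‖y‖ ^ k * ‖u y‖ := by
          refine setIntegral_mono_on (u.integrable.norm.const_mul _).integrableOn
            hint.integrableOn measurableSet_Ioi fun y hy => ?_
          have : ‖x‖ ≤ ‖y‖ := by
            rw [Real.norm_of_nonneg hx, Real.norm_of_nonneg (hx.trans hy.le)]; exact hy.le
          gcongr
        _ ≤ _ := setIntegral_le_integral hint (ae_of_all _ hpos)
    · have h1 := integral_Iic_of_hasDerivAt_of_tendsto' (a := x) (fun y _ => hg y)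
        u.integrable.integrableOn hbot
      have h2 : ‖g x‖ ≤ ∫ y in Iic x, ‖u y‖ := by
        have : g x = ∫ y in Iic x, u y := by rw [h1]; ring
        rw [this]
        exact norm_integral_le_integral_norm _
      calc ‖x‖ ^ k * ‖g x‖ ≤ ‖x‖ ^ k * ∫ y in Iic x, ‖u y‖ := by gcongr
        _ = ∫ y in Iic x, ‖x‖ ^ k * ‖u y‖ := (integral_const_mul _ _).symm
        _ ≤ ∫ y in Iic x, ‖y‖ ^ k * ‖u y‖ := by
          refine setIntegral_mono_on (u.integrable.norm.const_mul _).integrableOn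
            hint.integrableOn measurableSet_Iic fun y hy => ?_
          have hy' : y ≤ x := hy
          have : ‖x‖ ≤ ‖y‖ := by
            rw [Real.norm_of_nonpos hx, Real.norm_of_nonpos (hy'.trans hx)]; linarith
          gcongr
        _ ≤ _ := setIntegral_le_integral hint (ae_of_all _ hpos)

theorem logistic_eq_sigmoid : logistic = Real.sigmoid := rfl

theorem iteratedDeriv_dlogistic (n : ℕ) : ∃ P : Polynomial ℝ,
    iteratedDeriv n (fun x => Real.sigmoid x * (1 - Real.sigmoid x)) =
      fun x => P.eval (Real.sigmoid x) * (Real.sigmoid x * (1 - Real.sigmoid x)) := by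
  induction n with
  | zero => exact ⟨1, by simp⟩
  | succ n ih =>
    obtain ⟨P, hP⟩ := ih
    refine ⟨P.derivative * (Polynomial.X * (1 - Polynomial.X)) + P * (1 - 2 * Polynomial.X), ?_⟩
    rw [iteratedDeriv_succ, hP]
    funext x
    have hs := Real.hasDerivAt_sigmoid x
    have h1 := (P.hasDerivAt (Real.sigmoid x)).comp x hs
    have h2 := h1.mul (hs.mul (hs.const_sub 1))
    refine (HasDerivAt.deriv (f := fun x => P.eval (Real.sigmoid x) *
      (Real.sigmoid x * (1 - Real.sigmoid x))) h2).trans ?_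
    simp only [Function.comp, Polynomial.eval_add, Polynomial.eval_mul, Polynomial.eval_sub,
      Polynomial.eval_X, Polynomial.eval_one, Polynomial.eval_ofNat, Pi.mul_apply]
    ring

theorem dlogistic_le (x : ℝ) :
    Real.sigmoid x * (1 - Real.sigmoid x) ≤ Real.exp (-|x|) := by
  have h0 := Real.sigmoid_pos x
  have h1 := Real.sigmoid_lt_one x
  rcases le_total 0 x with hx | hx
  · rw [abs_of_nonneg hx, ← Real.sigmoid_neg, ← Real.sigmoid_mul_rexp_neg]
    have := Real.exp_pos (-x)
    nlinarith [mul_pos h0 this, mul_pos (sub_pos.2 h1) (mul_pos h0 this),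
      mul_pos (sub_pos.2 h1) this]
  · rw [abs_of_nonpos hx, neg_neg]
    have h2 := Real.sigmoid_mul_rexp_neg (-x)
    rw [neg_neg, Real.sigmoid_neg] at h2
    have := Real.exp_pos x
    nlinarith [mul_pos (sub_pos.2 h1) this, mul_pos h0 this]

/-- The derivative `F (1 - F)` of the logistic function, as a Schwartz function. -/
def dlogistic : 𝓢(ℝ, ℝ) where
  toFun x := Real.sigmoid x * (1 - Real.sigmoid x)
  smooth' := by
    have h : ContDiff ℝ ∞ Real.sigmoid := contDiff_sigmoid.of_le (by simp)
    exact h.mul (contDiff_const.sub h)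
  decay' k n := by
    obtain ⟨P, hP⟩ := iteratedDeriv_dlogistic n
    obtain ⟨B, hB⟩ := isCompact_Icc.exists_bound_of_continuousOn
      (s := Icc (0 : ℝ) 1) (f := fun y => P.eval y) P.continuous.continuousOn
    refine ⟨B * k.factorial, fun x => ?_⟩
    rw [norm_iteratedFDeriv_eq_norm_iteratedDeriv, hP, norm_mul]
    have hb := hB (Real.sigmoid x) ⟨Real.sigmoid_nonneg x, Real.sigmoid_le_one x⟩
    have hn : 0 ≤ Real.sigmoid x * (1 - Real.sigmoid x) :=
      mul_nonneg (Real.sigmoid_nonneg x) (sub_nonneg.2 (Real.sigmoid_le_one x))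
    rw [Real.norm_of_nonneg hn, Real.norm_eq_abs x]
    have hk : |x| ^ k * Real.exp (-|x|) ≤ k.factorial := by
      have h1 := Real.pow_div_factorial_le_exp |x| (abs_nonneg x) k
      rw [div_le_iff₀ (by positivity)] at h1
      rw [Real.exp_neg, ← div_eq_mul_inv, div_le_iff₀ (Real.exp_pos _)]
      linarith
    calc |x| ^ k * (‖P.eval (Real.sigmoid x)‖ * (Real.sigmoid x * (1 - Real.sigmoid x)))
        ≤ |x| ^ k * (B * Real.exp (-|x|)) := by
          have hB0 : 0 ≤ B := (norm_nonneg _).trans hb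
          have := dlogistic_le x
          gcongr
      _ = B * (|x| ^ k * Real.exp (-|x|)) := by ring
      _ ≤ B * k.factorial := by
          have hB0 : 0 ≤ B := (norm_nonneg _).trans hb
          gcongr

theorem bump_eq (y : ℝ) : bump y = expNegInvGlue y * expNegInvGlue (1 - y) := by
  unfold bump
  split_ifs with h
  · have h1 : ¬ y ≤ 0 := not_le.2 h.1
    have h2 : ¬ 1 - y ≤ 0 := by linarith [h.2]
    have h3 : y ≠ 0 := h.1.ne'
    have h4 : 1 - y ≠ 0 := by linarith [h.2]
    simp only [expNegInvGlue, h1, h2, if_false]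
    rw [← Real.exp_add]
    congr 1
    field_simp
    ring
  · rcases not_and_or.1 h with h | h
    · rw [expNegInvGlue.zero_of_nonpos (not_lt.1 h), zero_mul]
    · rw [expNegInvGlue.zero_of_nonpos (x := 1 - y) (by linarith [not_lt.1 h]), mul_zero]

theorem bump_contDiff : ContDiff ℝ ∞ bump := by
  have : bump = fun y => expNegInvGlue y * expNegInvGlue (1 - y) := funext bump_eq
  rw [this]
  exact (expNegInvGlue.contDiff (n := ⊤)).mul
    ((expNegInvGlue.contDiff (n := ⊤)).comp (contDiff_const.sub contDiff_id))

theorem bump_support : Function.support bump ⊆ Icc 0 1 := by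
  intro y hy
  by_contra h
  apply hy
  unfold bump
  rw [if_neg]
  rintro ⟨h1, h2⟩
  exact h ⟨h1.le, h2.le⟩

theorem bump_compact : HasCompactSupport bump :=
  HasCompactSupport.of_support_subset_isCompact isCompact_Icc bump_support

theorem bump_integrable : Integrable bump :=
  bump_contDiff.continuous.integrable_of_hasCompactSupport bump_compact

theorem hasDerivAt_theta (x : ℝ) : HasDerivAt theta
    (-bump x / ∫ y in (0 : ℝ)..1, Real.exp (-(1 / (y * (1 - y))))) x := by
  have h1 : ∀ x, ∫ y in Ioi x, bump y = (∫ y in Ioi 0, bump y) - ∫ y in (0 : ℝ)..x, bump y := by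
    intro x
    rw [← intervalIntegral.integral_Iic_sub_Iic bump_integrable.integrableOn
      bump_integrable.integrableOn]
    have e1 := intervalIntegral.integral_Iic_add_Ioi (b := x) bump_integrable.integrableOn
      bump_integrable.integrableOn
    have e2 := intervalIntegral.integral_Iic_add_Ioi (b := 0) bump_integrable.integrableOn
      bump_integrable.integrableOn
    linarith
  have h2 : theta = fun x => ((∫ y in Ioi 0, bump y) - ∫ y in (0 : ℝ)..x, bump y) /
      ∫ y in (0 : ℝ)..1, Real.exp (-(1 / (y * (1 - y)))) := by
    funext x; unfold theta; rw [h1]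
  rw [h2]
  have h3 : HasDerivAt (fun x => ∫ y in (0 : ℝ)..x, bump y) (bump x) x :=
    bump_contDiff.continuous.integral_hasStrictDerivAt 0 x |>.hasDerivAt
  exact (h3.const_sub _).div_const _

theorem theta_eq_zero {x : ℝ} (hx : 1 ≤ x) : theta x = 0 := by
  unfold theta
  rw [setIntegral_eq_zero_of_forall_eq_zero, zero_div]
  intro y hy
  unfold bump
  rw [if_neg]
  rintro ⟨_, h2⟩
  exact absurd (hx.trans_lt hy) (not_lt.2 h2.le)

/-- Sanity check of the normalisation. -/
theorem theta_eq_one {x : ℝ} (hx : x ≤ 0) : theta x = 1 := by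
  have h1 : ∀ {x : ℝ}, x ≤ 0 → ∫ y in Ioi x, bump y = ∫ y in (0 : ℝ)..1, bump y := by
    intro x hx
    rw [intervalIntegral.integral_of_le zero_le_one]
    refine setIntegral_eq_of_subset_of_forall_sdiff_eq_zero measurableSet_Ioi
      (fun y hy => lt_of_le_of_lt hx hy.1) fun y hy => ?_
    unfold bump
    rw [if_neg]
    rintro ⟨h, h'⟩
    exact hy.2 ⟨h, h'.le⟩
  have h2 : ∫ y in (0 : ℝ)..1, bump y = ∫ y in (0 : ℝ)..1, Real.exp (-(1 / (y * (1 - y)))) := by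
    rw [intervalIntegral.integral_of_le zero_le_one, intervalIntegral.integral_of_le zero_le_one,
      integral_Ioc_eq_integral_Ioo, integral_Ioc_eq_integral_Ioo]
    refine setIntegral_congr_fun measurableSet_Ioo fun y hy => ?_
    unfold bump
    exact if_pos hy
  have h3 : 0 < ∫ y in (0 : ℝ)..1, bump y := by
    refine intervalIntegral.intervalIntegral_pos_of_pos_on
      (bump_integrable.intervalIntegrable) (fun y hy => ?_) zero_lt_one
    unfold bump
    rw [if_pos ⟨hy.1, hy.2⟩]
    exact Real.exp_pos _
  unfold theta
  rw [h1 hx, ← h2]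
  exact div_self h3.ne'

theorem theta_nonneg (x : ℝ) : 0 ≤ theta x := by
  unfold theta
  refine div_nonneg (integral_nonneg fun y => ?_) ?_
  · unfold bump; dsimp only; split_ifs <;> positivity
  · exact intervalIntegral.integral_nonneg zero_le_one fun y _ => by positivity

theorem theta_le_one (x : ℝ) : theta x ≤ 1 := by
  have hanti : Antitone theta := by
    refine antitone_of_deriv_nonpos (fun x => (hasDerivAt_theta x).differentiableAt) fun x => ?_
    rw [(hasDerivAt_theta x).deriv]
    refine div_nonpos_of_nonpos_of_nonneg ?_ ?_
    · rw [neg_nonpos]; unfold bump; split_ifs <;> positivity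
    · exact intervalIntegral.integral_nonneg zero_le_one fun y _ => by positivity
  rw [← theta_eq_one (min_le_right x 0)]
  exact hanti (min_le_left x 0)

theorem theta_contDiff : ContDiff ℝ ∞ theta := by
  rw [contDiff_infty_iff_deriv]
  refine ⟨fun x => (hasDerivAt_theta x).differentiableAt, ?_⟩
  rw [funext fun x => (hasDerivAt_theta x).deriv]
  exact bump_contDiff.neg.div_const _

theorem dtheta_compact : HasCompactSupport (deriv theta) := by
  rw [funext fun x => (hasDerivAt_theta x).deriv]
  refine HasCompactSupport.of_support_subset_isCompact isCompact_Icc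
    (fun y hy => bump_support ?_)
  intro h
  apply hy
  simp [h]

theorem theta_temperate : Function.HasTemperateGrowth theta := by
  refine Function.HasTemperateGrowth.of_fderiv (k := 0) (C := 1) ?_
    (fun x => (hasDerivAt_theta x).differentiableAt) fun x => ?_
  · refine HasCompactSupport.hasTemperateGrowth ?_ ?_
    · have := dtheta_compact
      refine HasCompactSupport.of_support_subset_isCompact this.isCompact fun y hy => ?_
      refine subset_tsupport _ fun h => hy ?_
      ext
      simpa using h
    · exact theta_contDiff.fderiv_right (m := ∞) (by simp)
  · rw [Real.norm_of_nonneg (theta_nonneg x)]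
    simpa using theta_le_one x

theorem exists_logisticCutoff (M : ℕ+) :
    ∃ f : 𝓢(ℝ, ℝ), ∀ x, f x = logistic x * theta (x / (M : ℝ)) := by
  have hM : (0 : ℝ) < M := by exact_mod_cast M.pos
  have hscale : Function.HasTemperateGrowth fun x : ℝ => x / (M : ℝ) := by
    have h := (Function.HasTemperateGrowth.id' (E := ℝ)).mul
      (Function.HasTemperateGrowth.const ((M : ℝ)⁻¹))
    simpa [div_eq_mul_inv, Pi.mul_def] using h
  have ht : Function.HasTemperateGrowth fun x : ℝ => theta (x / (M : ℝ)) :=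
    theta_temperate.comp hscale
  let w : ℝ → ℝ := fun x => logistic x * (deriv theta (x / M) * (1 / M))
  have hw1 : ContDiff ℝ ∞ w := by
    have h : ContDiff ℝ ∞ logistic := contDiff_sigmoid.of_le (by simp)
    refine h.mul (ContDiff.mul ?_ contDiff_const)
    exact ((contDiff_infty_iff_deriv.1 theta_contDiff).2).comp (contDiff_id.div_const _)
  have hw2 : HasCompactSupport w := by
    refine HasCompactSupport.of_support_subset_isCompact
      (isCompact_Icc (a := (0 : ℝ)) (b := M)) fun x hx => ?_
    have hb : bump (x / M) ≠ 0 := by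
      intro h
      apply hx
      simp [w, (hasDerivAt_theta (x / M)).deriv, h]
    have := bump_support hb
    rw [mem_Icc, div_le_one hM] at this
    exact ⟨by have := mul_nonneg this.1 hM.le; rwa [div_mul_cancel₀ _ hM.ne'] at this, this.2⟩
  let u : 𝓢(ℝ, ℝ) := SchwartzMap.smulLeftCLM ℝ (fun x : ℝ => theta (x / (M : ℝ))) dlogistic +
    hw2.toSchwartzMap hw1
  refine exists_schwartz_of_hasDerivAt u _ (fun x => ?_) ?_ ?_
  · have h1 : HasDerivAt logistic (Real.sigmoid x * (1 - Real.sigmoid x)) x :=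
      Real.hasDerivAt_sigmoid x
    have h2 : HasDerivAt (fun x => theta (x / M)) (deriv theta (x / M) * (1 / M)) x :=
      HasDerivAt.comp (h := fun x : ℝ => x / M) x
        (hasDerivAt_theta (x / M)).differentiableAt.hasDerivAt ((hasDerivAt_id' x).div_const _)
    have h3 := h1.mul h2
    have hu : u x = Real.sigmoid x * (1 - Real.sigmoid x) * theta (x / M) +
        logistic x * (deriv theta (x / M) * (1 / M)) := by
      change SchwartzMap.smulLeftCLM ℝ (fun x : ℝ => theta (x / (M : ℝ))) dlogistic x + w x = _
      rw [SchwartzMap.smulLeftCLM_apply_apply ht]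
      simp only [smul_eq_mul, w]
      rw [mul_comm]
      rfl
    rw [hu]
    exact h3
  · refine tendsto_const_nhds.congr' ?_
    filter_upwards [eventually_ge_atTop (M : ℝ)] with x hx
    rw [theta_eq_zero ((one_le_div hM).2 hx), mul_zero]
  · refine squeeze_zero (fun x => mul_nonneg (Real.sigmoid_nonneg x) (theta_nonneg _))
      (fun x => mul_le_of_le_one_right (Real.sigmoid_nonneg x) (theta_le_one _))
      Real.tendsto_sigmoid_atBot

/-- The cutoff `F_M(x) = F(x) θ(x / M)` of the logistic function, as a test function. -/
def logisticCutoff (M : ℕ+) : 𝓢(ℝ, ℝ) where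
  toFun x := logistic x * theta (x / (M : ℝ))
  smooth' := by
    obtain ⟨f, hf⟩ := exists_logisticCutoff M
    rw [← funext hf]; exact f.smooth'
  decay' := by
    obtain ⟨f, hf⟩ := exists_logisticCutoff M
    rw [← funext hf]; exact f.decay'

theorem exists_correctedPrimitive (u : 𝓢(ℝ, ℝ)) :
    ∃ f : 𝓢(ℝ, ℝ), ∀ x, f x = (∫ y in Iic x, u y) - mean u * logistic x := by
  have hs : ∀ x, ∫ y in Iic x, u y = (∫ y in Iic 0, u y) + ∫ y in (0 : ℝ)..x, u y := by
    intro x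
    rw [← intervalIntegral.integral_Iic_sub_Iic u.integrable.integrableOn
      u.integrable.integrableOn]
    ring
  refine exists_schwartz_of_hasDerivAt (u - mean u • dlogistic) _ (fun x => ?_) ?_ ?_
  · have h1 : HasDerivAt (fun x => ∫ y in Iic x, u y) (u x) x := by
      rw [funext hs]
      exact (u.continuous.integral_hasStrictDerivAt 0 x).hasDerivAt.const_add _
    exact h1.sub ((Real.hasDerivAt_sigmoid x).const_mul (mean u))
  · have h1 : Tendsto (fun x => ∫ y in Iic x, u y) atTop (𝓝 (mean u)) := by
      have h := intervalIntegral_tendsto_integral_Ioi (0 : ℝ)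
        (u.integrable (μ := volume)).integrableOn tendsto_id
      have h' := h.const_add (∫ y in Iic 0, u y)
      rw [intervalIntegral.integral_Iic_add_Ioi u.integrable.integrableOn
        u.integrable.integrableOn] at h'
      rw [funext hs]
      exact h'
    have h2 := h1.sub (Real.tendsto_sigmoid_atTop.const_mul (mean u))
    simpa using! h2
  · have h1 : Tendsto (fun x => ∫ y in Iic x, u y) atBot (𝓝 0) := by
      have h := intervalIntegral_tendsto_integral_Iic (0 : ℝ)
        (u.integrable (μ := volume)).integrableOn tendsto_id
      have h' := h.const_sub (∫ y in Iic 0, u y)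
      rw [sub_self] at h'
      refine h'.congr fun x => ?_
      rw [hs x, intervalIntegral.integral_symm]
      simp
    have h2 := h1.sub (Real.tendsto_sigmoid_atBot.const_mul (mean u))
    simpa using! h2

/-- The test function `U - ū F`, where `U(x) = ∫_{-∞}^x u`. -/
def correctedPrimitive (u : 𝓢(ℝ, ℝ)) : 𝓢(ℝ, ℝ) where
  toFun x := (∫ y in Iic x, u y) - mean u * logistic x
  smooth' := by
    obtain ⟨f, hf⟩ := exists_correctedPrimitive u
    rw [← funext hf]; exact f.smooth'
  decay' := by
    obtain ⟨f, hf⟩ := exists_correctedPrimitive u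
    rw [← funext hf]; exact f.decay'

end

/-! ### Probability -/

/-- Tempered distributions, with the strong topology. -/
abbrev Distr : Type := 𝓢(ℝ, ℝ) →L[ℝ] ℝ

instance (T : ℝ) : MeasurableSpace C(Icc (0 : ℝ) T, ℝ) := borel _

instance (T : ℝ) : BorelSpace C(Icc (0 : ℝ) T, ℝ) := ⟨rfl⟩

section

variable {Ω : Type*} [MeasurableSpace Ω]

/-- `W` is a white noise of variance `χ`. -/
structure IsWhiteNoise (μ : Measure Ω) (χ : ℝ) (W : Ω → Distr) : Prop where
  measurable : ∀ u, Measurable fun ω => W ω u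
  law : ∀ u, μ.map (fun ω => W ω u) = gaussianReal 0 (χ * sqNorm u).toNNReal

/-- `X` is (a version of) the random variable `W(f)`, for a function `f ∈ L²(ℝ)` which need not be
a test function: the limit in `L²` of `W(uₙ)` for test functions `uₙ → f` in `L²(ℝ)`. If `W` is a
white noise then `X` exists, and is unique up to null sets. -/
def IsPairing (μ : Measure Ω) (W : Ω → Distr) (f : ℝ → ℝ) (X : Ω → ℝ) : Prop :=
  AEStronglyMeasurable X μ ∧ ∃ u : ℕ → 𝓢(ℝ, ℝ),
    Tendsto (fun n => eLpNorm (fun x => u n x - f x) 2 volume) atTop (𝓝 0) ∧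
    Tendsto (fun n => eLpNorm (fun ω => W ω (u n) - X ω) 2 μ) atTop (𝓝 0)

/-- The function `i_ε(x) = ε⁻¹ 1_{(x, x+ε]}`. -/
def iEps (ε x : ℝ) : ℝ → ℝ := (Ioc x (x + ε)).indicator fun _ => ε⁻¹

/-- `V ε t x` is a version of `Y_t(i_ε(x))`, measurable in `(t, x, ω)`. -/
def IsIncrementField (μ : Measure Ω) (T : ℝ) (Y : ℝ → Ω → Distr)
    (V : ℝ → ℝ → ℝ → Ω → ℝ) : Prop :=
  ∀ ε > 0, (Measurable fun p : Icc (0 : ℝ) T × ℝ × Ω => V ε p.1 p.2.1 p.2.2) ∧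
    ∀ t ∈ Icc (0 : ℝ) T, ∀ x, IsPairing μ (Y t) (iEps ε x) (V ε t x)

/-- The regularised nonlinearity `∫_s^t ∫ Y_r(i_ε(x))² ∇u(x) dx dr` of the Burgers equation. -/
def burgersNonlin (V : ℝ → ℝ → ℝ → Ω → ℝ) (ε s t : ℝ) (u : 𝓢(ℝ, ℝ)) (ω : Ω) : ℝ :=
  ∫ r in s..t, ∫ x, V ε r x ω ^ 2 * grad u x

/-- The renormalised regularised nonlinearity of the KPZ equation. -/
def kpzNonlin (χ : ℝ) (h : ℝ → ℝ → Ω → ℝ) (ε s t : ℝ) (u : 𝓢(ℝ, ℝ)) (ω : Ω) : ℝ :=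
  ∫ r in s..t, ∫ x, (((h r (x + ε) ω - h r x ω) / ε) ^ 2 - χ / ε) * u x

/-- `X` is the limit in `L²` of `A ε` as `ε ↓ 0`. -/
def IsL2Limit (μ : Measure Ω) (A : ℝ → Ω → ℝ) (X : Ω → ℝ) : Prop :=
  MemLp X 2 μ ∧ Tendsto (fun ε => eLpNorm (fun ω => A ε ω - X ω) 2 μ) (𝓝[>] 0) (𝓝 0)

/-- `N` is a continuous martingale on `[0, T]`, with quadratic variation `c t`. -/
structure IsMartingaleWithQV (μ : Measure Ω) {T : ℝ}
    (𝓕 : Filtration (Icc (0 : ℝ) T) ‹MeasurableSpace Ω›) (c : ℝ)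
    (N : Icc (0 : ℝ) T → Ω → ℝ) : Prop where
  continuous : ∀ ω, Continuous fun t => N t ω
  martingale : Martingale N 𝓕 μ
  quadraticVariation : Martingale (fun t ω => N t ω ^ 2 - c * t) 𝓕 μ

/-- Stationary energy solutions on `[0, T]` of the stochastic Burgers equation
`dY = D ΔY dt + λ ∇Y² dt + √(2χD) ∇dB`. The process is indexed by `ℝ`, but only its values at times
in `[0, T]` matter. -/
structure IsStationaryEnergySolution (D χ lam T : ℝ) (μ : Measure Ω)
    (Y : ℝ → Ω → Distr) : Prop where
  continuous_paths : ∀ ω, ContinuousOn (fun t => Y t ω) (Icc 0 T)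
  stationary : ∀ t ∈ Icc 0 T, IsWhiteNoise μ χ (Y t)
  energy_one : ∃ κ > 0, ∀ u s t, 0 ≤ s → s < t → t ≤ T →
    secondMoment μ (fun ω => ∫ r in s..t, Y r ω (lap u)) ≤
      ENNReal.ofReal (κ * (t - s) * energy u)
  nonlinear : ∃ V : ℝ → ℝ → ℝ → Ω → ℝ, IsIncrementField μ T Y V ∧
    (∃ κ > 0, ∀ u s t ε δ, 0 ≤ s → s < t → t ≤ T → 0 < δ → δ < ε → ε < 1 →
      secondMoment μ (fun ω => burgersNonlin V ε s t u ω - burgersNonlin V δ s t u ω) ≤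
        ENNReal.ofReal (κ * (t - s) * ε * energy u)) ∧
    ∃ 𝓕 : Filtration (Icc (0 : ℝ) T) ‹MeasurableSpace Ω›,
      (∀ (t : Icc (0 : ℝ) T) u, Measurable[𝓕 t] fun ω => Y t ω u) ∧
      ∀ u, ∃ A N : Icc (0 : ℝ) T → Ω → ℝ,
        (∀ t : Icc (0 : ℝ) T, IsL2Limit μ (fun ε => burgersNonlin V ε 0 t u) (A t)) ∧
        IsMartingaleWithQV μ 𝓕 (2 * χ * D * energy u) N ∧
        ∀ t : Icc (0 : ℝ) T, ∀ᵐ ω ∂μ, N t ω =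
          Y t ω u - Y 0 ω u - D * (∫ s in (0 : ℝ)..t, Y s ω (lap u)) - lam * A t ω

/-- `B` is a two-sided Brownian motion of variance `χ`, up to the value at the origin. -/
structure IsTwoSidedBM (μ : Measure Ω) (χ : ℝ) (B : ℝ → Ω → ℝ) : Prop where
  continuous_paths : ∀ᵐ ω ∂μ, Continuous fun x => B x ω
  indep_increments : HasIndepIncrements B μ
  law_increments : ∀ x y, x ≤ y →
    μ.map (fun ω => B y ω - B x ω) = gaussianReal 0 (χ * (y - x)).toNNReal

/-- Almost stationary energy solutions on `[0, T]` of the KPZ equation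
`dh = D Δh dt + λ (∇h)² dt + √(2χD) dB`. -/
structure IsAlmostStationaryKPZSolution (D χ lam T : ℝ) (μ : Measure Ω)
    (h : ℝ → ℝ → Ω → ℝ) : Prop where
  measurable : Measurable fun p : Icc (0 : ℝ) T × ℝ × Ω => h p.1 p.2.1 p.2.2
  almost_stationary : ∀ t ∈ Icc 0 T, IsTwoSidedBM μ χ (h t)
  energy_condition : ∃ κ > 0,
    (∀ (u : 𝓢(ℝ, ℝ)) s t, 0 ≤ s → s < t → t ≤ T →
      secondMoment μ (fun ω => ∫ r in s..t, ∫ x, h r x ω * lap u x) ≤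
        ENNReal.ofReal (κ * sqNorm u * (t - s))) ∧
    (∀ (u : 𝓢(ℝ, ℝ)) s t ε δ, mean u = 0 → 0 ≤ s → s < t → t ≤ T → 0 < δ → δ < ε →
      secondMoment μ (fun ω => kpzNonlin χ h ε s t u ω - kpzNonlin χ h δ s t u ω) ≤
        ENNReal.ofReal (κ * ε * sqNorm u * (t - s)))
  solution : ∃ 𝓕 : Filtration (Icc (0 : ℝ) T) ‹MeasurableSpace Ω›,
    (∀ (t : Icc (0 : ℝ) T) x, Measurable[𝓕 t] (h t x)) ∧
    ∀ u : 𝓢(ℝ, ℝ), ∃ A N : Icc (0 : ℝ) T → Ω → ℝ,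
      (∀ t : Icc (0 : ℝ) T, IsL2Limit μ (fun ε => kpzNonlin χ h ε 0 t u) (A t)) ∧
      IsMartingaleWithQV μ 𝓕 (2 * χ * D * sqNorm u) N ∧
      ∀ t : Icc (0 : ℝ) T, ∀ᵐ ω ∂μ, N t ω =
        (∫ x, h t x ω * u x) - (∫ x, h 0 x ω * u x)
          - D * (∫ s in (0 : ℝ)..t, ∫ x, h s x ω * lap u x) - lam * A t ω

/-- The trajectory `t ↦ Y_t(f) - Y_0(f)`, as a random element of `C([0, T])`. -/
def incrementPath {T : ℝ} {Y : ℝ → Ω → Distr}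
    (hY : ∀ ω, ContinuousOn (fun t => Y t ω) (Icc 0 T)) (f : 𝓢(ℝ, ℝ)) (ω : Ω) :
    C(Icc (0 : ℝ) T, ℝ) where
  toFun t := Y t ω f - Y 0 ω f
  continuous_toFun := by
    have h := continuousOn_iff_continuous_domRestrict.1 (hY ω)
    exact ((continuous_eval_const f).comp h).sub continuous_const

/-- The function `1_{(0, x]}`, with the usual orientation `-1_{(x, 0]}` for `x < 0`. -/
def orientedIndicator (x y : ℝ) : ℝ :=
  (Ioc 0 x).indicator (fun _ => (1 : ℝ)) y - (Ioc x 0).indicator (fun _ => (1 : ℝ)) y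

end

end KPZEnergy

end

open MeasureTheory ProbabilityTheory Filter Topology Set
open scoped SchwartzMap ENNReal NNReal

noncomputable section

set_option linter.unusedSectionVars false

/-! The cutoffs `F_M` do not converge in L²(ℝ), so `Y_t(F_M)` has no limit of its own. Its time
increments do, because the equation tests them only against derivatives. By the Burgers equation,
`Y_t(u) - Y_0(u)` is a drift tested against `u''`, plus a martingale of quadratic variation
proportional to `⟨u', u'⟩`, plus `λ` times a nonlinearity tested against `u'`. The supremum in time
of each term is bounded in mean by a multiple of `‖u'‖ + ‖u''‖`.

For the drift this is stationarity, and for the martingale a maximal inequality. For the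
nonlinearity there are two competing bounds on the second moment over a time step `τ`: the energy
estimate allows `A` to be replaced by its regularisation at scale `ε` at cost `τ ε`, while the
Gaussian fourth-moment formula bounds the regularisation by `τ² / ε` (`hasL2Bound_renorm`). Taking
`ε` of order `√τ` gives `τ^(3/2)` (`hasL2Bound_nonlin`), enough for Kolmogorov's chaining argument.
The three bounds are collected in `path_bounds`. Since `F_M' → F'` and `F_M'' → F''` in L²
(`exists_cutoff_rate`), the paths `Y(F_M) - Y_0(F_M)` are Cauchy in L¹(Ω; C[0,T]), and in L² at each
time; the limit is `Z` (`exists_limits`).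

The height is `h_t(x) = -B_t(x) + Z_t + G_t - G_0`, where `B_t(x)` is a continuous version of
`Y_t(1_(0,x])` and `G_t = Y_t(1_(0,∞) - F)`. The term `G` is there because integrating `B_t` against
`u` produces the primitive of `u` corrected by the step function, whereas the theorem corrects it by
`F`; the exchange of integral and noise is `integral_brownian_ae_eq`.

In space `∇h = -Y`, and the square does not see the sign, so the KPZ nonlinearity tested against `u`
is the Burgers one with a general `u` in place of a gradient. Subtracting `χ/ε` changes nothing for
gradients, which have integral zero. All statements about a general `u` are limits of statements
about `v_M = U - ū F + ū F_M`, which is Schwartz and satisfies `v_M' → u`, `v_M'' → u'` in L². At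
fixed `ε` the fourth-moment bound gives continuity in the test function, while the energy estimates
have constants independent of `M`, so they survive the limit (`hasL2Bound_drift`,
`hasL2Bound_quad_diff`, `exists_nonlin_limit`). The martingales converge with their squares
(`isMartingaleWithQV_of_tendsto`). As limits are adapted only up to null sets, the filtration is
completed. -/

namespace KPZEnergy

/-! ### Quantitative L² bounds. -/

section L2Bounds

variable {α : Type*} [MeasurableSpace α] {μ : Measure α}

/-- `X` is square integrable, with `L²` norm at most `c`. -/
structure HasL2Bound (μ : Measure α) (X : α → ℝ) (c : ℝ) : Prop where
  aesm : AEStronglyMeasurable X μ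
  nonneg : 0 ≤ c
  le : eLpNorm X 2 μ ≤ ENNReal.ofReal c

theorem eLpNorm_two_sq (X : α → ℝ) : eLpNorm X 2 μ ^ 2 = ∫⁻ x, ENNReal.ofReal (X x ^ 2) ∂μ := by
  rw [eLpNorm_eq_lintegral_rpow_enorm_toReal (by norm_num) (by norm_num)]
  rw [← ENNReal.rpow_natCast, ← ENNReal.rpow_mul]
  norm_num
  refine lintegral_congr fun x => ?_
  rw [Real.enorm_eq_ofReal_abs, ← ENNReal.ofReal_pow (abs_nonneg _), sq_abs]

theorem eLpNorm_two_le_iff (X : α → ℝ) {c : ℝ} (hc : 0 ≤ c) :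
    eLpNorm X 2 μ ≤ ENNReal.ofReal c ↔
      ∫⁻ x, ENNReal.ofReal (X x ^ 2) ∂μ ≤ ENNReal.ofReal (c ^ 2) := by
  rw [← eLpNorm_two_sq, ENNReal.ofReal_pow hc]
  exact (ENNReal.pow_le_pow_left_iff two_ne_zero).symm

namespace HasL2Bound

variable {X Y : α → ℝ} {a b c : ℝ}

theorem memLp (h : HasL2Bound μ X c) : MemLp X 2 μ :=
  ⟨h.aesm, h.le.trans_lt ENNReal.ofReal_lt_top⟩

theorem mono (h : HasL2Bound μ X a) (hab : a ≤ b) : HasL2Bound μ X b :=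
  ⟨h.aesm, h.nonneg.trans hab, h.le.trans (ENNReal.ofReal_le_ofReal hab)⟩

theorem congr (h : HasL2Bound μ X a) (hXY : X =ᵐ[μ] Y) : HasL2Bound μ Y a :=
  ⟨h.aesm.congr hXY, h.nonneg, (eLpNorm_congr_ae hXY).symm.trans_le h.le⟩

theorem add (hX : HasL2Bound μ X a) (hY : HasL2Bound μ Y b) :
    HasL2Bound μ (fun x => X x + Y x) (a + b) :=
  ⟨hX.aesm.add hY.aesm, add_nonneg hX.nonneg hY.nonneg,
    (eLpNorm_add_le hX.aesm hY.aesm (by norm_num)).trans <| by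
      rw [ENNReal.ofReal_add hX.nonneg hY.nonneg]; exact add_le_add hX.le hY.le⟩

theorem neg (hX : HasL2Bound μ X a) : HasL2Bound μ (fun x => -X x) a :=
  ⟨hX.aesm.neg, hX.nonneg, (eLpNorm_neg X 2 μ).trans_le hX.le⟩

theorem sub (hX : HasL2Bound μ X a) (hY : HasL2Bound μ Y b) :
    HasL2Bound μ (fun x => X x - Y x) (a + b) := by
  simpa [sub_eq_add_neg] using hX.add hY.neg

theorem const_mul (hX : HasL2Bound μ X a) (k : ℝ) :
    HasL2Bound μ (fun x => k * X x) (|k| * a) := by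
  refine ⟨hX.aesm.const_mul k, mul_nonneg (abs_nonneg _) hX.nonneg, ?_⟩
  have := eLpNorm_const_smul (μ := μ) (p := 2) k X
  rw [show (fun x => k * X x) = k • X from rfl, this, ENNReal.ofReal_mul (abs_nonneg _),
    Real.enorm_eq_ofReal_abs]
  gcongr
  exact hX.le

theorem lintegral_le (h : HasL2Bound μ X c) :
    ∫⁻ x, ENNReal.ofReal (X x ^ 2) ∂μ ≤ ENNReal.ofReal (c ^ 2) :=
  (eLpNorm_two_le_iff X h.nonneg).1 h.le

theorem of_lintegral_le (hX : AEStronglyMeasurable X μ)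
    (h : ∫⁻ x, ENNReal.ofReal (X x ^ 2) ∂μ ≤ ENNReal.ofReal c) : HasL2Bound μ X (√c) := by
  refine ⟨hX, Real.sqrt_nonneg _, (eLpNorm_two_le_iff X (Real.sqrt_nonneg _)).2 ?_⟩
  rcases le_total 0 c with hc | hc
  · rwa [Real.sq_sqrt hc]
  · rw [ENNReal.ofReal_of_nonpos hc] at h
    exact h.trans (zero_le)

theorem of_integral_le (hX : MemLp X 2 μ) (h : ∫ x, X x ^ 2 ∂μ ≤ c) : HasL2Bound μ X (√c) := by
  refine of_lintegral_le hX.1 ?_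
  rw [← ofReal_integral_eq_lintegral_ofReal hX.integrable_sq (ae_of_all _ fun x => sq_nonneg _)]
  exact ENNReal.ofReal_le_ofReal h

theorem integral_sq_le (h : HasL2Bound μ X c) : ∫ x, X x ^ 2 ∂μ ≤ c ^ 2 := by
  have := h.lintegral_le
  rw [← ofReal_integral_eq_lintegral_ofReal h.memLp.integrable_sq
    (ae_of_all _ fun x => sq_nonneg _)] at this
  exact (ENNReal.ofReal_le_ofReal_iff (sq_nonneg _)).1 this

/-- Here `X` is fixed and only the bound varies. This is how approximation is used throughout: the
error committed at stage `i` is put into `d i`, and the limit is taken among real numbers. -/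
theorem of_tendsto {ι : Type*} {l : Filter ι} [l.NeBot] {d : ι → ℝ}
    (h : ∀ᶠ i in l, HasL2Bound μ X (d i)) (hd : Tendsto d l (𝓝 c)) : HasL2Bound μ X c := by
  obtain ⟨i, hi⟩ := h.exists
  refine ⟨hi.aesm, ge_of_tendsto hd (h.mono fun i hi => hi.nonneg), ?_⟩
  exact ge_of_tendsto (ENNReal.tendsto_ofReal hd) (h.mono fun i hi => hi.le)

theorem ae_eq_zero (h : HasL2Bound μ X 0) : X =ᵐ[μ] 0 := by
  have := h.le
  rw [ENNReal.ofReal_zero, nonpos_iff_eq_zero, eLpNorm_eq_zero_iff h.aesm (by norm_num)] at this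
  exact this

theorem ae_eq_of_sub (h : HasL2Bound μ (fun x => X x - Y x) 0) : X =ᵐ[μ] Y := by
  filter_upwards [h.ae_eq_zero] with x hx
  simpa [sub_eq_zero] using hx

theorem tendsto_eLpNorm {ι : Type*} {l : Filter ι} {Z : ι → α → ℝ} {d : ι → ℝ}
    (h : ∀ i, HasL2Bound μ (Z i) (d i)) (hd : Tendsto d l (𝓝 0)) :
    Tendsto (fun i => eLpNorm (Z i) 2 μ) l (𝓝 0) := by
  refine tendsto_of_tendsto_of_tendsto_of_le_of_le tendsto_const_nhds ?_ (fun _ => zero_le)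
    (fun i => (h i).le)
  simpa using ENNReal.tendsto_ofReal hd

end HasL2Bound

theorem hasL2Bound_toReal {X : α → ℝ} (h : MemLp X 2 μ) :
    HasL2Bound μ X (eLpNorm X 2 μ).toReal :=
  ⟨h.1, ENNReal.toReal_nonneg, by rw [ENNReal.ofReal_toReal h.2.ne]⟩

theorem exists_hasL2Bound_of_tendsto {ι : Type*} {l : Filter ι} {Z : ι → α → ℝ}
    (hm : ∀ i, MemLp (Z i) 2 μ)
    (h : Tendsto (fun i => eLpNorm (Z i) 2 μ) l (𝓝 0)) :
    ∃ d : ι → ℝ, (∀ i, HasL2Bound μ (Z i) (d i)) ∧ Tendsto d l (𝓝 0) :=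
  ⟨fun i => (eLpNorm (Z i) 2 μ).toReal, fun i => hasL2Bound_toReal (hm i), by
    simpa [Function.comp_def] using (ENNReal.tendsto_toReal ENNReal.zero_ne_top).comp h⟩

end L2Bounds

/-! ### Moments of centred Gaussians. -/

section GaussianMoments

variable {Ω : Type*} [MeasurableSpace Ω] {μ : Measure Ω}

theorem hasDerivAt_gaussian_mgf (v : ℝ) (P Q : ℝ → ℝ)
    (hQ : ∀ t, HasDerivAt P (Q t) t) (t : ℝ) :
    HasDerivAt (fun t => P t * Real.exp (v * t ^ 2 / 2))
      ((Q t + v * t * P t) * Real.exp (v * t ^ 2 / 2)) t := by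
  have h1 : HasDerivAt (fun t : ℝ => v * t ^ 2 / 2) (v * t) t := by
    have := ((hasDerivAt_pow 2 t).const_mul v).div_const 2
    convert! this using 1
    simp; ring
  have := (hQ t).mul h1.exp
  convert! this using 1
  ring

theorem integral_pow_four_gaussianReal (v : ℝ≥0) : ∫ x, x ^ 4 ∂gaussianReal 0 v = 3 * v ^ 2 := by
  have h := iteratedDeriv_mgf_zero (X := id) (μ := gaussianReal 0 v)
    (by rw [integrableExpSet_id_gaussianReal]; simp) 4
  simp only [Pi.pow_apply, id] at h
  rw [← h, mgf_id_gaussianReal]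
  have e : ∀ P Q : ℝ → ℝ, (∀ t, HasDerivAt P (Q t) t) →
      deriv (fun t => P t * Real.exp (v * t ^ 2 / 2)) =
        fun t => (Q t + v * t * P t) * Real.exp (v * t ^ 2 / 2) :=
    fun P Q hQ => funext fun t => (hasDerivAt_gaussian_mgf v P Q hQ t).deriv
  simp only [iteratedDeriv_succ', iteratedDeriv_zero, zero_mul, zero_add]
  have h0 : (fun t : ℝ => Real.exp (v * t ^ 2 / 2)) =
      fun t => (fun _ => (1 : ℝ)) t * Real.exp (v * t ^ 2 / 2) := by simp
  -- The polynomial factors of the successive derivatives are `1`, `vt`, `v + v²t²` and `3v²t +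
  -- v³t³`. The derivative of the last one at `0` is `3v²`.
  rw [h0, e _ (fun _ => 0) fun t => hasDerivAt_const t _]
  rw [e (fun t => 0 + v * t * 1) (fun _ => v) fun t => by
    simpa using (hasDerivAt_id t).const_mul (v : ℝ)]
  rw [e (fun t => v + v * t * (0 + v * t * 1)) (fun t => v * (v * (2 * t))) fun t => by
    have := (((hasDerivAt_pow 2 t).const_mul (v * v : ℝ)).const_add (v : ℝ))
    convert! this using 1
    · ext t; simp; ring
    · simp; ring]
  rw [e (fun t => v * (v * (2 * t)) + v * t * (v + v * t * (0 + v * t * 1)))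
    (fun t => v * v * 3 + v * v * v * (3 * t ^ 2)) fun t => by
    have := (((hasDerivAt_id t).const_mul (v * v * 3 : ℝ)).add
      ((hasDerivAt_pow 3 t).const_mul (v * v * v : ℝ)))
    convert! this using 1
    · ext t; simp; ring
    · simp]
  simp
  ring

theorem memLp_of_map_gaussianReal {X : Ω → ℝ} {v : ℝ≥0} (hX : AEMeasurable X μ)
    (h : μ.map X = gaussianReal 0 v) {p : ℝ≥0∞} (hp : p ≠ ∞) : MemLp X p μ := by
  have := memLp_id_gaussianReal' (μ := 0) (v := v) p hp
  rw [← h] at this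
  exact (memLp_map_measure_iff aestronglyMeasurable_id hX).1 this

theorem integral_sq_of_map_gaussianReal {X : Ω → ℝ} {v : ℝ≥0} (hX : AEMeasurable X μ)
    (h : μ.map X = gaussianReal 0 v) : ∫ ω, X ω ^ 2 ∂μ = v := by
  have h1 := variance_fun_id_gaussianReal (μ := 0) (v := v)
  rw [variance_of_integral_eq_zero measurable_id'.aemeasurable integral_id_gaussianReal, ← h,
    integral_map hX (by fun_prop)] at h1
  simpa using h1

theorem integral_pow_four_of_map_gaussianReal {X : Ω → ℝ} {v : ℝ≥0} (hX : AEMeasurable X μ)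
    (h : μ.map X = gaussianReal 0 v) : ∫ ω, X ω ^ 4 ∂μ = 3 * v ^ 2 := by
  have h1 := integral_pow_four_gaussianReal v
  rw [← h, integral_map hX (by fun_prop)] at h1
  exact h1

end GaussianMoments

/-! ### White noise evaluated on square integrable functions. -/

section Pairing

variable {Ω : Type*} [MeasurableSpace Ω] {μ : Measure Ω} {χ : ℝ} {W : Ω → Distr}

theorem sqNorm_nonneg (u : 𝓢(ℝ, ℝ)) : 0 ≤ sqNorm u := integral_nonneg fun _ => sq_nonneg _

theorem SchwartzMap.hasL2Bound (u : 𝓢(ℝ, ℝ)) : HasL2Bound volume u (√(sqNorm u)) :=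
  .of_integral_le (u.memLp 2) le_rfl

theorem IsWhiteNoise.memLp (hW : IsWhiteNoise μ χ W) (u : 𝓢(ℝ, ℝ)) {p : ℝ≥0∞} (hp : p ≠ ∞) :
    MemLp (fun ω => W ω u) p μ :=
  memLp_of_map_gaussianReal (hW.measurable u).aemeasurable (hW.law u) hp

theorem IsWhiteNoise.hasL2Bound (hW : IsWhiteNoise μ χ W) (hχ : 0 ≤ χ) (u : 𝓢(ℝ, ℝ)) :
    HasL2Bound μ (fun ω => W ω u) (√χ * √(sqNorm u)) := by
  rw [← Real.sqrt_mul hχ]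
  refine .of_integral_le (hW.memLp u (by norm_num)) ?_
  rw [integral_sq_of_map_gaussianReal (hW.measurable u).aemeasurable (hW.law u),
    Real.coe_toNNReal _ (mul_nonneg hχ (sqNorm_nonneg u))]

/-- `X` is a version of `W(f)`, for a square integrable function `f`. -/
structure Pairs (μ : Measure Ω) (W : Ω → Distr) (f : ℝ → ℝ) (X : Ω → ℝ) : Prop where
  memLp : MemLp f 2 volume
  aesm : AEStronglyMeasurable X μ
  approx : ∀ η > 0, ∃ u : 𝓢(ℝ, ℝ), HasL2Bound volume (fun x => u x - f x) η ∧
    HasL2Bound μ (fun ω => W ω u - X ω) η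

namespace Pairs

variable {f g : ℝ → ℝ} {X Y : Ω → ℝ}

theorem of_isPairing (hW : IsWhiteNoise μ χ W) (hf : MemLp f 2 volume)
    (h : IsPairing μ W f X) : Pairs μ W f X := by
  refine ⟨hf, h.1, fun η hη => ?_⟩
  obtain ⟨hX, u, h1, h2⟩ := h
  have hη' : (0 : ℝ≥0∞) < ENNReal.ofReal η := ENNReal.ofReal_pos.2 hη
  obtain ⟨n, hn1, hn2⟩ := ((h1.eventually (gt_mem_nhds hη')).and
    (h2.eventually (gt_mem_nhds hη'))).exists
  exact ⟨u n, ⟨((u n).memLp 2).1.sub hf.1, hη.le, hn1.le⟩,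
    ⟨(hW.measurable _).aestronglyMeasurable.sub hX, hη.le, hn2.le⟩⟩

theorem isPairing (h : Pairs μ W f X) : IsPairing μ W f X := by
  refine ⟨h.aesm, ?_⟩
  choose u hu1 hu2 using fun n : ℕ => h.approx (1 / ((n : ℝ) + 1)) (by positivity)
  exact ⟨u, HasL2Bound.tendsto_eLpNorm hu1 tendsto_one_div_add_atTop_nhds_zero_nat,
    HasL2Bound.tendsto_eLpNorm hu2 tendsto_one_div_add_atTop_nhds_zero_nat⟩

theorem hasL2Bound_zero {α : Type*} [MeasurableSpace α] (ν : Measure α) {X Y : α → ℝ} {η : ℝ}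
    (hη : 0 ≤ η) (h : X =ᵐ[ν] Y) : HasL2Bound ν (fun x => X x - Y x) η := by
  have : HasL2Bound ν (fun _ => (0 : ℝ)) η := ⟨aestronglyMeasurable_const, hη, by simp⟩
  refine this.congr ?_
  filter_upwards [h] with x hx
  simp [hx]

theorem of_schwartz (hW : IsWhiteNoise μ χ W) (u : 𝓢(ℝ, ℝ)) :
    Pairs μ W u (fun ω => W ω u) :=
  ⟨u.memLp 2, (hW.measurable u).aestronglyMeasurable, fun _ hη =>
    ⟨u, hasL2Bound_zero _ hη.le (ae_eq_refl _), hasL2Bound_zero _ hη.le (ae_eq_refl _)⟩⟩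

theorem congr (h : Pairs μ W f X) (hfg : f =ᵐ[volume] g) (hXY : X =ᵐ[μ] Y) :
    Pairs μ W g Y := by
  refine ⟨h.memLp.ae_eq hfg, h.aesm.congr hXY, fun η hη => ?_⟩
  obtain ⟨u, h1, h2⟩ := h.approx η hη
  refine ⟨u, h1.congr ?_, h2.congr ?_⟩
  · filter_upwards [hfg] with x hx; rw [hx]
  · filter_upwards [hXY] with x hx; rw [hx]

theorem add (hf : Pairs μ W f X) (hg : Pairs μ W g Y) :
    Pairs μ W (fun x => f x + g x) (fun ω => X ω + Y ω) := by
  refine ⟨hf.memLp.add hg.memLp, hf.aesm.add hg.aesm, fun η hη => ?_⟩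
  obtain ⟨u, h1, h2⟩ := hf.approx (η / 2) (by positivity)
  obtain ⟨v, h3, h4⟩ := hg.approx (η / 2) (by positivity)
  refine ⟨u + v, ?_, ?_⟩
  · have := h1.add h3
    rw [add_halves] at this
    refine this.congr (ae_of_all _ fun x => ?_)
    simp only [add_apply]; ring
  · have := h2.add h4
    rw [add_halves] at this
    refine this.congr (ae_of_all _ fun x => ?_)
    simp only [map_add]; ring

theorem const_mul (hf : Pairs μ W f X) (k : ℝ) :
    Pairs μ W (fun x => k * f x) (fun ω => k * X ω) := by
  refine ⟨hf.memLp.const_mul k, hf.aesm.const_mul k, fun η hη => ?_⟩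
  obtain ⟨u, h1, h2⟩ := hf.approx (η / (|k| + 1)) (by positivity)
  have hle : |k| * (η / (|k| + 1)) ≤ η := by
    rw [mul_div_assoc', div_le_iff₀ (by positivity)]
    nlinarith [abs_nonneg k]
  refine ⟨k • u, ?_, ?_⟩
  · refine ((h1.const_mul k).mono hle).congr (ae_of_all _ fun x => ?_)
    simp only [smul_apply, smul_eq_mul]; ring
  · refine ((h2.const_mul k).mono hle).congr (ae_of_all _ fun x => ?_)
    simp only [map_smul, smul_eq_mul]; ring

theorem neg (hf : Pairs μ W f X) : Pairs μ W (fun x => -f x) (fun ω => -X ω) := by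
  simpa using hf.const_mul (-1)

theorem sub (hf : Pairs μ W f X) (hg : Pairs μ W g Y) :
    Pairs μ W (fun x => f x - g x) (fun ω => X ω - Y ω) := by
  simpa [sub_eq_add_neg] using hf.add hg.neg

theorem finsetSum (hW : IsWhiteNoise μ χ W) {ι : Type*} (s : Finset ι) {f : ι → ℝ → ℝ}
    {X : ι → Ω → ℝ} (h : ∀ i, Pairs μ W (f i) (X i)) :
    Pairs μ W (fun x => ∑ i ∈ s, f i x) (fun ω => ∑ i ∈ s, X i ω) := by
  classical
  induction s using Finset.induction_on with
  | empty => simpa [Pi.zero_def] using of_schwartz hW 0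
  | insert a s ha ih => simpa [Finset.sum_insert ha] using (h a).add ih

theorem integral_sq_eq {α : Type*} [MeasurableSpace α] {ν : Measure α} {X : α → ℝ}
    (h : MemLp X 2 ν) : ∫ x, X x ^ 2 ∂ν = (eLpNorm X 2 ν).toReal ^ 2 := by
  rw [← ENNReal.toReal_pow, eLpNorm_two_sq, ← ofReal_integral_eq_lintegral_ofReal h.integrable_sq
    (ae_of_all _ fun x => sq_nonneg _), ENNReal.toReal_ofReal (integral_nonneg fun _ => sq_nonneg _)]

theorem tendsto_integral_sq {α : Type*} [MeasurableSpace α] {ν : Measure α} {X : α → ℝ}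
    {Z : ℕ → α → ℝ} (hX : MemLp X 2 ν) (hZ : ∀ i, MemLp (Z i) 2 ν) {c : ℕ → ℝ}
    (hF : ∀ i, HasL2Bound ν (fun x => Z i x - X x) (c i)) (hc : Tendsto c atTop (𝓝 0)) :
    Tendsto (fun i => ∫ x, Z i x ^ 2 ∂ν) atTop (𝓝 (∫ x, X x ^ 2 ∂ν)) := by
  have h1 : Tendsto (fun i => (hZ i).toLp (Z i)) atTop (𝓝 (hX.toLp X)) := by
    rw [Lp.tendsto_Lp_iff_tendsto_eLpNorm'']
    exact HasL2Bound.tendsto_eLpNorm hF hc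
  have h2 := (h1.norm).pow 2
  simp only [Lp.norm_toLp] at h2
  rw [integral_sq_eq hX]
  refine h2.congr fun i => ?_
  rw [integral_sq_eq (hZ i)]

/-- L² convergence of `W(uₙ)` to `X` implies convergence in law, hence of characteristic functions.
Those of `W(uₙ)` are explicit, and their variances converge because `uₙ → f` in L²(ℝ). -/
theorem law [IsProbabilityMeasure μ] (hW : IsWhiteNoise μ χ W) (h : Pairs μ W f X) :
    μ.map X = gaussianReal 0 (χ * ∫ x, f x ^ 2).toNNReal := by
  choose u hu1 hu2 using fun n : ℕ => h.approx (1 / ((n : ℝ) + 1)) (by positivity)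
  have hlim := tendsto_one_div_add_atTop_nhds_zero_nat (𝕜 := ℝ)
  have h1 : Tendsto (fun n => sqNorm (u n)) atTop (𝓝 (∫ x, f x ^ 2)) :=
    tendsto_integral_sq h.memLp (fun n => (u n).memLp 2) hu1 hlim
  have hX := h.aesm.aemeasurable
  have h2 : TendstoInDistribution (fun n ω => W ω (u n)) atTop X (fun _ => μ) μ := by
    refine TendstoInMeasure.tendstoInDistribution ?_ fun n => (hW.measurable _).aemeasurable
    refine tendstoInMeasure_of_tendsto_eLpNorm (p := 2) (by norm_num)
      (fun n => (hW.measurable _).aestronglyMeasurable) h.aesm ?_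
    exact HasL2Bound.tendsto_eLpNorm hu2 hlim
  have h3 := ProbabilityMeasure.tendsto_iff_tendsto_charFun.1 h2.tendsto
  have : IsProbabilityMeasure (μ.map X) := Measure.isProbabilityMeasure_map hX
  refine Measure.ext_of_charFun (funext fun t => ?_)
  refine tendsto_nhds_unique (h3 t) ?_
  simp only [ProbabilityMeasure.coe_mk, hW.law, charFun_gaussianReal]
  have h4 : Tendsto (fun n => (χ * sqNorm (u n)).toNNReal) atTop
      (𝓝 (χ * ∫ x, f x ^ 2).toNNReal) :=
    (continuous_real_toNNReal.tendsto _).comp (h1.const_mul χ)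
  have h5 : Continuous fun v : ℝ≥0 => Complex.exp (t * (0 : ℝ) * Complex.I - v * t ^ 2 / 2) := by
    fun_prop
  exact (h5.tendsto _).comp h4

variable [IsProbabilityMeasure μ]

theorem memLp_prob (hW : IsWhiteNoise μ χ W) (h : Pairs μ W f X) {p : ℝ≥0∞} (hp : p ≠ ∞) :
    MemLp X p μ :=
  memLp_of_map_gaussianReal h.aesm.aemeasurable (h.law hW) hp

theorem integral_sq (hW : IsWhiteNoise μ χ W) (hχ : 0 ≤ χ) (h : Pairs μ W f X) :
    ∫ ω, X ω ^ 2 ∂μ = χ * ∫ x, f x ^ 2 := by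
  rw [integral_sq_of_map_gaussianReal h.aesm.aemeasurable (h.law hW), Real.coe_toNNReal]
  exact mul_nonneg hχ (integral_nonneg fun _ => sq_nonneg _)

theorem integral_pow_four (hW : IsWhiteNoise μ χ W) (hχ : 0 ≤ χ) (h : Pairs μ W f X) :
    ∫ ω, X ω ^ 4 ∂μ = 3 * (χ * ∫ x, f x ^ 2) ^ 2 := by
  rw [integral_pow_four_of_map_gaussianReal h.aesm.aemeasurable (h.law hW), Real.coe_toNNReal]
  exact mul_nonneg hχ (integral_nonneg fun _ => sq_nonneg _)

theorem hasL2Bound (hW : IsWhiteNoise μ χ W) (hχ : 0 ≤ χ) (h : Pairs μ W f X) {c : ℝ}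
    (hc : ∫ x, f x ^ 2 ≤ c) : HasL2Bound μ X (√(χ * c)) := by
  refine .of_integral_le (h.memLp_prob hW (by norm_num)) ?_
  rw [h.integral_sq hW hχ]
  gcongr

theorem hasL2Bound' (hW : IsWhiteNoise μ χ W) (hχ : 0 ≤ χ) (h : Pairs μ W f X) {c : ℝ}
    (hc : HasL2Bound volume f c) : HasL2Bound μ X (√χ * c) := by
  have := h.hasL2Bound hW hχ hc.integral_sq_le
  rwa [Real.sqrt_mul hχ, Real.sqrt_sq hc.nonneg] at this

/-- The difference is a pairing with the zero function, so its variance is zero. -/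
theorem ae_eq (hW : IsWhiteNoise μ χ W) (hχ : 0 ≤ χ) (hX : Pairs μ W f X) (hY : Pairs μ W f Y) :
    X =ᵐ[μ] Y := by
  have h := hX.sub hY
  have := h.hasL2Bound hW hχ (c := 0) (by simp)
  rw [mul_zero, Real.sqrt_zero] at this
  exact this.ae_eq_of_sub

theorem integral_lin4 {α : Type*} [MeasurableSpace α] {ν : Measure α} {F G H K : α → ℝ}
    (hF : Integrable F ν) (hG : Integrable G ν) (hH : Integrable H ν) (hK : Integrable K ν)
    (a b c d : ℝ) : ∫ x, (a * F x + b * G x + (c * H x + d * K x)) ∂ν =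
      a * (∫ x, F x ∂ν) + b * (∫ x, G x ∂ν) + (c * (∫ x, H x ∂ν) + d * ∫ x, K x ∂ν) := by
  have h1 : Integrable (fun x => a * F x + b * G x) ν := (hF.const_mul a).add (hG.const_mul b)
  have h2 : Integrable (fun x => c * H x + d * K x) ν := (hH.const_mul c).add (hK.const_mul d)
  rw [integral_add h1 h2, integral_add (hF.const_mul a) (hG.const_mul b),
    integral_add (hH.const_mul c) (hK.const_mul d)]
  simp only [integral_const_mul]

theorem integral_add_mul_sq {α : Type*} [MeasurableSpace α] {ν : Measure α} {X Y : α → ℝ}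
    (hX : MemLp X 2 ν) (hY : MemLp Y 2 ν) (k : ℝ) : ∫ x, (X x + k * Y x) ^ 2 ∂ν =
      (∫ x, X x ^ 2 ∂ν) + 2 * k * (∫ x, X x * Y x ∂ν) + k ^ 2 * ∫ x, Y x ^ 2 ∂ν := by
  have h := integral_lin4 hX.integrable_sq (hX.integrable_mul hY) hY.integrable_sq
    hY.integrable_sq 1 (2 * k) (k ^ 2) 0
  simp only [Pi.mul_apply, one_mul, zero_mul, add_zero] at h
  rw [← h]
  refine integral_congr_ae (ae_of_all _ fun x => ?_)
  ring

/-- Polarisation: the variance of `X + Y` is known, because `X + Y` is itself a pairing. -/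
theorem integral_mul (hW : IsWhiteNoise μ χ W) (hχ : 0 ≤ χ) (hX : Pairs μ W f X)
    (hY : Pairs μ W g Y) : ∫ ω, X ω * Y ω ∂μ = χ * ∫ x, f x * g x := by
  have h1 := (hX.add (hY.const_mul 1)).integral_sq hW hχ
  rw [integral_add_mul_sq (hX.memLp_prob hW (by norm_num)) (hY.memLp_prob hW (by norm_num)),
    integral_add_mul_sq hX.memLp hY.memLp, hX.integral_sq hW hχ, hY.integral_sq hW hχ] at h1
  linarith

theorem integrable_pow_four (hW : IsWhiteNoise μ χ W) (hX : Pairs μ W f X) :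
    Integrable (fun ω => X ω ^ 4) μ := by
  have := (hX.memLp_prob hW (p := 4) (by norm_num)).integrable_norm_pow (by norm_num)
  refine this.congr (ae_of_all _ fun ω => ?_)
  simp only [Real.norm_eq_abs]
  exact Even.pow_abs (by decide) _

/-- Wick's formula by polarisation, `12 X²Y² = (X+Y)⁴ + (X-Y)⁴ - 2X⁴ - 2Y⁴`. Only one-dimensional
fourth moments are needed, since `X ± Y` are again pairings. -/
theorem integral_sq_mul_sq (hW : IsWhiteNoise μ χ W) (hχ : 0 ≤ χ) (hX : Pairs μ W f X)
    (hY : Pairs μ W g Y) : ∫ ω, X ω ^ 2 * Y ω ^ 2 ∂μ =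
      χ ^ 2 * ((∫ x, f x ^ 2) * (∫ x, g x ^ 2) + 2 * (∫ x, f x * g x) ^ 2) := by
  have hp := hX.add (hY.const_mul 1)
  have hm := hX.add (hY.const_mul (-1))
  have e := integral_lin4 (hp.integrable_pow_four hW) (hm.integrable_pow_four hW)
    (hX.integrable_pow_four hW) (hY.integrable_pow_four hW) (1 / 12) (1 / 12) (-1 / 6) (-1 / 6)
  rw [hp.integral_pow_four hW hχ, hm.integral_pow_four hW hχ, hX.integral_pow_four hW hχ,
    hY.integral_pow_four hW hχ, integral_add_mul_sq hX.memLp hY.memLp,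
    integral_add_mul_sq hX.memLp hY.memLp] at e
  have e5 : ∫ ω, X ω ^ 2 * Y ω ^ 2 ∂μ = ∫ ω, (1 / 12 * (X ω + 1 * Y ω) ^ 4 +
      1 / 12 * (X ω + -1 * Y ω) ^ 4 + (-1 / 6 * X ω ^ 4 + -1 / 6 * Y ω ^ 4)) ∂μ := by
    refine integral_congr_ae (ae_of_all _ fun x => ?_)
    ring
  rw [e5, e]
  ring

end Pairs

end Pairing

/-! ### Inner products of the kernels `i_ε(x)`. -/

section IncrementKernel

theorem iEps_memLp (ε x : ℝ) (p : ℝ≥0∞) : MemLp (iEps ε x) p volume :=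
  memLp_indicator_const p measurableSet_Ioc _ (Or.inr (by simp))

theorem integral_iEps_mul (ε x : ℝ) (f : ℝ → ℝ) :
    ∫ z, iEps ε x z * f z = ε⁻¹ * ∫ z in Ioc x (x + ε), f z := by
  rw [← integral_const_mul, ← integral_indicator measurableSet_Ioc]
  refine integral_congr_ae (ae_of_all _ fun z => ?_)
  by_cases hz : z ∈ Ioc x (x + ε) <;> simp [iEps, hz]

theorem integral_iEps_sq {ε : ℝ} (hε : 0 < ε) (x : ℝ) : ∫ z, iEps ε x z ^ 2 = ε⁻¹ := by
  simp only [sq]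
  rw [integral_iEps_mul]
  have : ∫ z in Ioc x (x + ε), iEps ε x z = ∫ z in Ioc x (x + ε), ε⁻¹ :=
    setIntegral_congr_fun measurableSet_Ioc fun z hz => indicator_of_mem hz _
  rw [this]
  simp [hε.le, hε.ne']

theorem iEps_nonneg {ε : ℝ} (hε : 0 < ε) (x z : ℝ) : 0 ≤ iEps ε x z :=
  indicator_nonneg (fun _ _ => (inv_pos.2 hε).le) _

/-- The kernels have disjoint supports unless `|x - y| ≤ ε`. On the support of `i_ε(x)` one has
`i_ε(y) ≤ ε⁻¹ = i_ε(x)`, so the inner product is at most the squared norm `ε⁻¹`. -/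
theorem integral_iEps_mul_iEps_sq_le {ε : ℝ} (hε : 0 < ε) (x y : ℝ) :
    (∫ z, iEps ε x z * iEps ε y z) ^ 2 ≤ (Icc (x - ε) (x + ε)).indicator (fun _ => (ε⁻¹) ^ 2) y := by
  by_cases hy : y ∈ Icc (x - ε) (x + ε)
  · rw [indicator_of_mem hy]
    have h0 : 0 ≤ ∫ z, iEps ε x z * iEps ε y z :=
      integral_nonneg fun z => mul_nonneg (iEps_nonneg hε x z) (iEps_nonneg hε y z)
    refine pow_le_pow_left₀ h0 ?_ 2
    rw [← integral_iEps_sq hε x]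
    rw [integral_iEps_mul]
    simp only [sq]
    rw [integral_iEps_mul]
    refine mul_le_mul_of_nonneg_left (setIntegral_mono_on (memLp_one_iff_integrable.1 (iEps_memLp ε y 1)).integrableOn
      (memLp_one_iff_integrable.1 (iEps_memLp ε x 1)).integrableOn measurableSet_Ioc fun z hz => ?_)
      (inv_pos.2 hε).le
    have : iEps ε x z = ε⁻¹ := indicator_of_mem hz _
    rw [this]
    exact indicator_le_self' (fun _ _ => (inv_pos.2 hε).le) z
  · rw [indicator_of_notMem hy]
    have : ∀ z, iEps ε x z * iEps ε y z = 0 := by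
      intro z
      rw [mul_eq_zero]
      by_contra! h
      have h1 := mem_of_indicator_ne_zero h.1
      have h2 := mem_of_indicator_ne_zero h.2
      exact hy ⟨by linarith [h1.1, h2.2], by linarith [h1.2, h2.1]⟩
    simp [this]

end IncrementKernel

/-! ### Second moment of the renormalised square at a fixed time. -/

section FixedTime

variable {Ω : Type*} [MeasurableSpace Ω] {μ : Measure Ω} [IsProbabilityMeasure μ] {χ ε : ℝ}
  {W : Ω → Distr} {X : ℝ → Ω → ℝ}

/-- The constant `χ/ε` is the variance of each `X x`, so what remains of Wick's formula is twice the
square of the covariance. -/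
theorem integral_renorm_mul_renorm (hW : IsWhiteNoise μ χ W) (hχ : 0 ≤ χ) (hε : 0 < ε)
    (hX : ∀ x, Pairs μ W (iEps ε x) (X x)) (x y : ℝ) :
    Integrable (fun ω => (X x ω ^ 2 - χ / ε) * (X y ω ^ 2 - χ / ε)) μ ∧
    ∫ ω, (X x ω ^ 2 - χ / ε) * (X y ω ^ 2 - χ / ε) ∂μ =
      2 * χ ^ 2 * (∫ z, iEps ε x z * iEps ε y z) ^ 2 := by
  have m : ∀ x, MemLp (fun ω => X x ω ^ 2) 2 μ := fun x => by
    have h2 : AEStronglyMeasurable (fun ω => X x ω ^ 2) μ := (hX x).aesm.pow 2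
    rw [memLp_two_iff_integrable_sq h2]
    refine ((hX x).integrable_pow_four hW).congr (ae_of_all _ fun ω => ?_)
    ring
  have i1 : ∀ x, Integrable (fun ω => X x ω ^ 2) μ := fun x => (m x).integrable (by norm_num)
  have i2 : Integrable (fun ω => X x ω ^ 2 * X y ω ^ 2) μ := (m x).integrable_mul (m y)
  have e : ∀ ω, (X x ω ^ 2 - χ / ε) * (X y ω ^ 2 - χ / ε) = 1 * (X x ω ^ 2 * X y ω ^ 2) +
      (-(χ / ε)) * X x ω ^ 2 + ((-(χ / ε)) * X y ω ^ 2 + (χ / ε) ^ 2 * 1) := fun ω => by ring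
  constructor
  · exact ((m x).sub (memLp_const _)).integrable_mul ((m y).sub (memLp_const _))
  · simp only [e]
    rw [Pairs.integral_lin4 i2 (i1 x) (i1 y) (integrable_const 1), (hX x).integral_sq hW hχ,
      (hX y).integral_sq hW hχ, (hX x).integral_sq_mul_sq hW hχ (hX y), integral_iEps_sq hε,
      integral_iEps_sq hε]
    simp
    field_simp
    ring

theorem integrable_band (g : 𝓢(ℝ, ℝ)) (hε : 0 < ε) :
    Integrable (fun p : ℝ × ℝ => (Icc (p.1 - ε) (p.1 + ε)).indicator (fun _ => g p.1 ^ 2) p.2)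
      (volume.prod volume) ∧
    ∫ p : ℝ × ℝ, (Icc (p.1 - ε) (p.1 + ε)).indicator (fun _ => g p.1 ^ 2) p.2 = 2 * ε * sqNorm g := by
  have hm : Measurable fun p : ℝ × ℝ => (Icc (p.1 - ε) (p.1 + ε)).indicator
      (fun _ => g p.1 ^ 2) p.2 := by
    have hs : MeasurableSet ({p : ℝ × ℝ | p.1 - ε ≤ p.2} ∩ {p : ℝ × ℝ | p.2 ≤ p.1 + ε}) :=
      (measurableSet_le (by fun_prop) (by fun_prop)).inter
        (measurableSet_le (by fun_prop) (by fun_prop))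
    have hg : Measurable fun p : ℝ × ℝ => g p.1 ^ 2 :=
      (g.continuous.measurable.comp measurable_fst).pow_const 2
    exact hg.indicator hs
  have h1 : ∀ x : ℝ, Integrable (fun y => (Icc (x - ε) (x + ε)).indicator (fun _ => g x ^ 2) y) :=
    fun x => (integrable_indicator_iff measurableSet_Icc).2 (integrableOn_const (by simp))
  have h2 : ∀ x : ℝ, ∫ y, (Icc (x - ε) (x + ε)).indicator (fun _ => g x ^ 2) y =
      2 * ε * g x ^ 2 := fun x => by
    rw [integral_indicator measurableSet_Icc]
    simp only [integral_const, MeasurableSet.univ, measureReal_restrict_apply, univ_inter,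
      Real.volume_real_Icc, smul_eq_mul]
    rw [max_eq_left (by linarith)]
    ring
  have h3 : Integrable fun x => 2 * ε * g x ^ 2 := ((g.memLp 2).integrable_sq).const_mul _
  have hint : Integrable (fun p : ℝ × ℝ => (Icc (p.1 - ε) (p.1 + ε)).indicator
      (fun _ => g p.1 ^ 2) p.2) (volume.prod volume) := by
    rw [integrable_prod_iff hm.aestronglyMeasurable]
    refine ⟨ae_of_all _ h1, h3.congr (ae_of_all _ fun x => ?_)⟩
    refine (h2 x).symm.trans ?_
    refine integral_congr_ae (ae_of_all _ fun y => ?_)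
    exact (Real.norm_of_nonneg (indicator_nonneg (fun _ _ => sq_nonneg _) y)).symm
  refine ⟨hint, ?_⟩
  rw [Measure.volume_eq_prod, integral_prod _ hint]
  simp only [h2]
  rw [integral_const_mul, sqNorm]

/-- Expanding the square and exchanging integrals gives the double integral of `g(x) g(y)` against
the covariance of the renormalised squares. That covariance is at most `2χ²/ε²` and vanishes off the
band `|x - y| ≤ ε`, whose sections have length `2ε`. With `ab ≤ (a² + b²)/2` the result is `(4χ²/ε)
‖g‖²`. The subtraction of `χ/ε` is what confines the integrand to the band. -/
theorem hasL2Bound_renorm (hW : IsWhiteNoise μ χ W) (hχ : 0 ≤ χ) (hε : 0 < ε)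
    (hm : Measurable (Function.uncurry X)) (hX : ∀ x, Pairs μ W (iEps ε x) (X x))
    (g : 𝓢(ℝ, ℝ)) :
    HasL2Bound μ (fun ω => ∫ x, (X x ω ^ 2 - χ / ε) * g x) (√(4 * χ ^ 2 / ε * sqNorm g)) ∧
    ∀ᵐ ω ∂μ, Integrable fun x => (X x ω ^ 2 - χ / ε) * g x := by
  let H : Ω × (ℝ × ℝ) → ℝ := fun p => ((X p.2.1 p.1 ^ 2 - χ / ε) * g p.2.1) *
    ((X p.2.2 p.1 ^ 2 - χ / ε) * g p.2.2)
  have hφ : Measurable fun p : Ω × ℝ => (X p.2 p.1 ^ 2 - χ / ε) * g p.2 := by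
    have h1 : Measurable fun p : Ω × ℝ => X p.2 p.1 := hm.comp measurable_swap
    have h2 : Measurable fun p : Ω × ℝ => g p.2 := g.continuous.measurable.comp measurable_snd
    fun_prop
  have hH : Measurable H := by
    have h1 : Measurable fun p : Ω × (ℝ × ℝ) => (p.1, p.2.1) := by fun_prop
    have h2 : Measurable fun p : Ω × (ℝ × ℝ) => (p.1, p.2.2) := by fun_prop
    exact (hφ.comp h1).mul (hφ.comp h2)
  have key := integral_renorm_mul_renorm hW hχ hε hX
  have hB : ∀ x y, ∫ ω, ‖(X x ω ^ 2 - χ / ε) * (X y ω ^ 2 - χ / ε)‖ ∂μ ≤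
      2 * χ ^ 2 * (ε⁻¹) ^ 2 := by
    intro x y
    have hd : ∀ x, ∫ ω, (X x ω ^ 2 - χ / ε) * (X x ω ^ 2 - χ / ε) ∂μ =
        2 * χ ^ 2 * (ε⁻¹) ^ 2 := fun x => by
      rw [(key x x).2, ← integral_iEps_sq hε x]
      simp only [sq]
    calc _ ≤ ∫ ω, (1 / 2 * ((X x ω ^ 2 - χ / ε) * (X x ω ^ 2 - χ / ε)) +
          1 / 2 * ((X y ω ^ 2 - χ / ε) * (X y ω ^ 2 - χ / ε))) ∂μ := by
          refine integral_mono (key x y).1.norm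
            (((key x x).1.const_mul _).add ((key y y).1.const_mul _)) fun ω => ?_
          simp only [Real.norm_eq_abs, abs_mul]
          nlinarith [sq_nonneg (|X x ω ^ 2 - χ / ε| - |X y ω ^ 2 - χ / ε|),
            sq_abs (X x ω ^ 2 - χ / ε), sq_abs (X y ω ^ 2 - χ / ε)]
      _ = _ := by
          rw [integral_add ((key x x).1.const_mul _) ((key y y).1.const_mul _),
            integral_const_mul, integral_const_mul, hd, hd]
          ring
  -- The moments in `ω` are bounded uniformly in `(x, y)` by `hB`, so `|g(x)| |g(y)|` is an
  -- integrable majorant.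
  have hHint : Integrable H (μ.prod (volume.prod volume)) := by
    rw [integrable_prod_iff' hH.aestronglyMeasurable]
    constructor
    · refine ae_of_all _ fun p => ?_
      refine ((key p.1 p.2).1.const_mul (g p.1 * g p.2)).congr (ae_of_all _ fun ω => ?_)
      simp only [H]; ring
    · have hg : Integrable (fun p : ℝ × ℝ => 2 * χ ^ 2 * (ε⁻¹) ^ 2 * (‖g p.1‖ * ‖g p.2‖))
          (volume.prod volume) :=
        (g.integrable.norm.mul_prod g.integrable.norm).const_mul _
      refine hg.mono' (hH.norm.stronglyMeasurable.integral_prod_left'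
        (μ := μ)).aestronglyMeasurable (ae_of_all _ fun p => ?_)
      rw [Real.norm_of_nonneg (integral_nonneg fun _ => norm_nonneg _)]
      have : ∫ ω, ‖H (ω, p)‖ ∂μ = (‖g p.1‖ * ‖g p.2‖) *
          ∫ ω, ‖(X p.1 ω ^ 2 - χ / ε) * (X p.2 ω ^ 2 - χ / ε)‖ ∂μ := by
        rw [← integral_const_mul]
        refine integral_congr_ae (ae_of_all _ fun ω => ?_)
        simp only [H, norm_mul]; ring
      rw [this, mul_comm]
      gcongr
      exact hB p.1 p.2
  have hsq : ∀ ω, ∫ p : ℝ × ℝ, H (ω, p) = (∫ x, (X x ω ^ 2 - χ / ε) * g x) ^ 2 := fun ω => by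
    rw [sq]
    exact integral_prod_mul (fun x => (X x ω ^ 2 - χ / ε) * g x)
      (fun x => (X x ω ^ 2 - χ / ε) * g x)
  have hSm : AEStronglyMeasurable (fun ω => ∫ x, (X x ω ^ 2 - χ / ε) * g x) μ :=
    (hφ.stronglyMeasurable.integral_prod_right' (ν := volume)).aestronglyMeasurable
  have hS : MemLp (fun ω => ∫ x, (X x ω ^ 2 - χ / ε) * g x) 2 μ := by
    rw [memLp_two_iff_integrable_sq hSm]
    exact hHint.integral_prod_left.congr (ae_of_all _ hsq)
  -- The squared integral does not show that the integrand is integrable in `x`; this comes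
  -- separately from the first moment, at most `2χ/ε` for every `x`.
  have hA : ∀ᵐ ω ∂μ, Integrable fun x => (X x ω ^ 2 - χ / ε) * g x := by
    have hdd : ∀ x, ∫ ω, ‖(X x ω ^ 2 - χ / ε)‖ ∂μ ≤ 2 * χ / ε ∧
        Integrable (fun ω => X x ω ^ 2 - χ / ε) μ := fun x => by
      have i1 : Integrable (fun ω => X x ω ^ 2) μ :=
        ((hX x).memLp_prob hW (by norm_num)).integrable_sq
      refine ⟨?_, i1.sub (integrable_const _)⟩
      calc _ ≤ ∫ ω, (X x ω ^ 2 + χ / ε) ∂μ := by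
            refine integral_mono (i1.sub (integrable_const _)).norm
              (i1.add (integrable_const _)) fun ω => ?_
            refine (norm_sub_le _ _).trans_eq ?_
            rw [Real.norm_of_nonneg (sq_nonneg _), Real.norm_of_nonneg (by positivity)]
        _ = _ := by
            rw [integral_add i1 (integrable_const _), (hX x).integral_sq hW hχ,
              integral_iEps_sq hε]
            simp
            ring
    have : Integrable (fun p : Ω × ℝ => (X p.2 p.1 ^ 2 - χ / ε) * g p.2) (μ.prod volume) := by
      rw [integrable_prod_iff' hφ.aestronglyMeasurable]
      refine ⟨ae_of_all _ fun x => (hdd x).2.mul_const (g x), ?_⟩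
      refine (g.integrable.norm.const_mul (2 * χ / ε)).mono'
        (hφ.norm.stronglyMeasurable.integral_prod_left'
        (μ := μ)).aestronglyMeasurable (ae_of_all _ fun x => ?_)
      rw [Real.norm_of_nonneg (integral_nonneg fun _ => norm_nonneg _)]
      simp only [norm_mul]
      rw [integral_mul_const]
      gcongr
      exact (hdd x).1
    exact this.prod_right_ae
  refine ⟨.of_integral_le hS ?_, hA⟩
  have hband := integrable_band g hε
  have hband' := hband.1.swap
  rw [← integral_congr_ae (ae_of_all μ hsq),
    show ∫ ω, (∫ p : ℝ × ℝ, H (ω, p)) ∂μ = ∫ p : ℝ × ℝ, ∫ ω, H (ω, p) ∂μ from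
      integral_integral_swap (f := fun ω p => H (ω, p)) hHint]
  have hin : ∀ p : ℝ × ℝ, ∫ ω, H (ω, p) ∂μ =
      g p.1 * g p.2 * (2 * χ ^ 2 * (∫ z, iEps ε p.1 z * iEps ε p.2 z) ^ 2) := fun p => by
    rw [← (key p.1 p.2).2, ← integral_const_mul]
    refine integral_congr_ae (ae_of_all _ fun ω => ?_)
    simp only [H]; ring
  have hle : ∫ p : ℝ × ℝ, ∫ ω, H (ω, p) ∂μ ≤ ∫ p : ℝ × ℝ, (χ ^ 2 * (ε⁻¹) ^ 2) *
      ((Icc (p.1 - ε) (p.1 + ε)).indicator (fun _ => g p.1 ^ 2) p.2 +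
      (Icc (p.2 - ε) (p.2 + ε)).indicator (fun _ => g p.2 ^ 2) p.1) := by
    refine integral_mono hHint.integral_prod_right ((hband.1.add hband').const_mul _) fun p => ?_
    simp only [hin]
    have h1 := integral_iEps_mul_iEps_sq_le hε p.1 p.2
    have h0 := sq_nonneg (∫ z, iEps ε p.1 z * iEps ε p.2 z)
    have h2 : g p.1 * g p.2 ≤ (g p.1 ^ 2 + g p.2 ^ 2) / 2 := by
      nlinarith [sq_nonneg (g p.1 - g p.2)]
    by_cases hp : p.2 ∈ Icc (p.1 - ε) (p.1 + ε)
    · have hp' : p.1 ∈ Icc (p.2 - ε) (p.2 + ε) := ⟨by linarith [hp.2], by linarith [hp.1]⟩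
      rw [indicator_of_mem hp] at h1
      rw [indicator_of_mem hp, indicator_of_mem hp']
      calc g p.1 * g p.2 * (2 * χ ^ 2 * (∫ z, iEps ε p.1 z * iEps ε p.2 z) ^ 2)
          ≤ (g p.1 ^ 2 + g p.2 ^ 2) / 2 *
            (2 * χ ^ 2 * (∫ z, iEps ε p.1 z * iEps ε p.2 z) ^ 2) := by gcongr
        _ ≤ (g p.1 ^ 2 + g p.2 ^ 2) / 2 * (2 * χ ^ 2 * (ε⁻¹) ^ 2) := by gcongr
        _ = _ := by ring
    · have hp' : ¬ p.1 ∈ Icc (p.2 - ε) (p.2 + ε) := fun h =>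
        hp ⟨by linarith [h.2], by linarith [h.1]⟩
      rw [indicator_of_notMem hp] at h1
      have : (∫ z, iEps ε p.1 z * iEps ε p.2 z) ^ 2 = 0 := le_antisymm h1 h0
      rw [indicator_of_notMem hp, indicator_of_notMem hp', this]
      simp
  refine hle.trans_eq ?_
  have hsw : ∫ p : ℝ × ℝ, (Icc (p.2 - ε) (p.2 + ε)).indicator (fun _ => g p.2 ^ 2) p.1 =
      2 * ε * sqNorm g := by
    rw [← hband.2, Measure.volume_eq_prod]
    exact integral_prod_swap
      (fun p : ℝ × ℝ => (Icc (p.1 - ε) (p.1 + ε)).indicator (fun _ => g p.1 ^ 2) p.2)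
  rw [integral_const_mul]
  have hadd : ∫ p : ℝ × ℝ, ((Icc (p.1 - ε) (p.1 + ε)).indicator (fun _ => g p.1 ^ 2) p.2 +
      (Icc (p.2 - ε) (p.2 + ε)).indicator (fun _ => g p.2 ^ 2) p.1) =
      2 * ε * sqNorm g + 2 * ε * sqNorm g := by
    rw [integral_add (by exact hband.1) (by exact hband'), hband.2, hsw]
  rw [hadd]
  field_simp
  ring

end FixedTime

/-! ### Integration in time of processes bounded in L². -/

section TimeIntegral

variable {Ω : Type*} [MeasurableSpace Ω] {μ : Measure Ω} [SFinite μ] {Φ Ψ : ℝ → Ω → ℝ}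
  {s t c : ℝ}

theorem lintegral_lintegral_sq_le (hst : s ≤ t) (hm : Measurable (Function.uncurry Φ))
    (hc : ∀ r, HasL2Bound μ (Φ r) c) :
    ∫⁻ ω, (∫⁻ r in Ioc s t, ENNReal.ofReal (Φ r ω ^ 2)) ∂μ ≤
      ENNReal.ofReal ((t - s) * c ^ 2) := by
  have hm' : Measurable fun p : Ω × ℝ => ENNReal.ofReal (Φ p.2 p.1 ^ 2) :=
    ((hm.comp measurable_swap).pow_const 2).ennreal_ofReal
  rw [lintegral_lintegral_swap hm'.aemeasurable]
  calc _ ≤ ∫⁻ _ in Ioc s t, ENNReal.ofReal (c ^ 2) := lintegral_mono fun r => (hc r).lintegral_le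
    _ = _ := by
      rw [setLIntegral_const, Real.volume_Ioc, mul_comm, ENNReal.ofReal_mul (by linarith)]

theorem ae_intervalIntegrable (hst : s ≤ t) (hm : Measurable (Function.uncurry Φ))
    (hc : ∀ r, HasL2Bound μ (Φ r) c) : ∀ᵐ ω ∂μ, IntervalIntegrable (fun r => Φ r ω) volume s t := by
  have hm' : Measurable fun p : Ω × ℝ => ENNReal.ofReal (Φ p.2 p.1 ^ 2) :=
    ((hm.comp measurable_swap).pow_const 2).ennreal_ofReal
  have h := (lintegral_lintegral_sq_le hst hm hc).trans_lt ENNReal.ofReal_lt_top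
  filter_upwards [ae_lt_top (hm'.lintegral_prod_right' (ν := volume.restrict (Ioc s t))) h.ne]
    with ω hω
  rw [intervalIntegrable_iff_integrableOn_Ioc_of_le hst]
  have hmω : Measurable fun r => Φ r ω := hm.comp measurable_prodMk_right
  have : MemLp (fun r => Φ r ω) 2 (volume.restrict (Ioc s t)) := by
    refine ⟨hmω.aestronglyMeasurable, ?_⟩
    have h2 := eLpNorm_two_sq (μ := volume.restrict (Ioc s t)) (fun r => Φ r ω)
    by_contra hcon
    rw [not_lt, top_le_iff] at hcon
    rw [hcon] at h2
    exact absurd h2.symm (by simpa using hω.ne)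
  exact this.integrable (by norm_num)

theorem sq_integral_le (hst : s ≤ t) {f : ℝ → ℝ}
    (hf : AEStronglyMeasurable f (volume.restrict (Ioc s t))) :
    ENNReal.ofReal ((∫ r in s..t, f r) ^ 2) ≤
      ENNReal.ofReal (t - s) * ∫⁻ r in Ioc s t, ENNReal.ofReal (f r ^ 2) := by
  rw [intervalIntegral.integral_of_le hst, ← eLpNorm_two_sq]
  have h1 : ENNReal.ofReal ((∫ r in Ioc s t, f r) ^ 2) ≤
      (eLpNorm f 1 (volume.restrict (Ioc s t))) ^ 2 := by
    rw [← sq_abs, ENNReal.ofReal_pow (abs_nonneg _), ← Real.enorm_eq_ofReal_abs,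
      eLpNorm_one_eq_lintegral_enorm]
    gcongr
    exact enorm_integral_le_lintegral_enorm _
  have h2 := eLpNorm_le_eLpNorm_mul_rpow_measure_univ (p := 1) (q := 2) (by norm_num) hf
  refine h1.trans ((pow_le_pow_left' h2 2).trans_eq ?_)
  rw [mul_pow, mul_comm, Measure.restrict_apply_univ, Real.volume_Ioc, ← ENNReal.rpow_natCast,
    ← ENNReal.rpow_mul]
  norm_num

/-- Cauchy–Schwarz in time, `(∫ f)² ≤ (t - s) ∫ f²`, followed by Tonelli. -/
theorem hasL2Bound_integral (hst : s ≤ t) (hm : Measurable (Function.uncurry Φ))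
    (hc : ∀ r, HasL2Bound μ (Φ r) c) :
    HasL2Bound μ (fun ω => ∫ r in s..t, Φ r ω) ((t - s) * c) := by
  have hc0 := (hc s).nonneg
  have hm2 : StronglyMeasurable (Function.uncurry fun ω r => Φ r ω) :=
    (hm.comp measurable_swap).stronglyMeasurable
  have hsm : AEStronglyMeasurable (fun ω => ∫ r in s..t, Φ r ω) μ := by
    simp only [intervalIntegral.integral_of_le hst]
    exact (hm2.integral_prod_right (ν := volume.restrict (Ioc s t))).aestronglyMeasurable
  refine ⟨hsm, mul_nonneg (by linarith) hc0, ?_⟩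
  rw [eLpNorm_two_le_iff _ (mul_nonneg (by linarith) hc0)]
  calc _ ≤ ∫⁻ ω, (ENNReal.ofReal (t - s) * ∫⁻ r in Ioc s t, ENNReal.ofReal (Φ r ω ^ 2)) ∂μ :=
        lintegral_mono fun ω =>
          sq_integral_le hst (hm.comp measurable_prodMk_right).aestronglyMeasurable
    _ ≤ ENNReal.ofReal (t - s) * ENNReal.ofReal ((t - s) * c ^ 2) := by
        rw [lintegral_const_mul' _ _ ENNReal.ofReal_ne_top]
        gcongr
        exact lintegral_lintegral_sq_le hst hm hc
    _ = _ := by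
        rw [← ENNReal.ofReal_mul (by linarith)]
        congr 1; ring

/-- The exceptional null set depends on `r`. Joint measurability allows Fubini to turn it into a
null set of times for almost every `ω`, which an integral over `r` ignores. -/
theorem integral_congr_of_forall_ae (hΦ : Measurable (Function.uncurry Φ))
    (hΨ : Measurable (Function.uncurry Ψ)) (h : ∀ r, Φ r =ᵐ[μ] Ψ r) :
    ∀ᵐ ω ∂μ, ∀ᵐ r ∂(volume : Measure ℝ), Φ r ω = Ψ r ω :=
  (Measure.ae_ae_comm (p := fun r ω => Φ r ω = Ψ r ω) (measurableSet_eq_fun hΦ hΨ)).1 (ae_of_all _ h)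

theorem intervalIntegral_ae_congr (hΦ : Measurable (Function.uncurry Φ))
    (hΨ : Measurable (Function.uncurry Ψ)) (h : ∀ r, Φ r =ᵐ[μ] Ψ r) (s t : ℝ) :
    (fun ω => ∫ r in s..t, Φ r ω) =ᵐ[μ] fun ω => ∫ r in s..t, Ψ r ω := by
  filter_upwards [integral_congr_of_forall_ae hΦ hΨ h] with ω hω
  exact intervalIntegral.integral_congr_ae (hω.mono fun r hr _ => hr)

end TimeIntegral

/-! ### The renormalised quadratic functional, for arbitrary test functions. -/

section RenormQuad

variable {Ω : Type*} [MeasurableSpace Ω] {μ : Measure Ω} {χ ε : ℝ} {W : ℝ → Ω → Distr}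
  {V V' : ℝ → ℝ → Ω → ℝ}

/-- The space integral `∫ (V_r(x)² - χ/ε) g(x) dx`. -/
def renormSlice (χ ε : ℝ) (V : ℝ → ℝ → Ω → ℝ) (g : 𝓢(ℝ, ℝ)) (r : ℝ) (ω : Ω) : ℝ :=
  ∫ x, (V r x ω ^ 2 - χ / ε) * g x

/-- The space-time integral `∫_s^t ∫ (V_r(x)² - χ/ε) g(x) dx dr`. -/
def renormQuad (χ ε : ℝ) (V : ℝ → ℝ → Ω → ℝ) (s t : ℝ) (g : 𝓢(ℝ, ℝ)) (ω : Ω) : ℝ :=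
  ∫ r in s..t, renormSlice χ ε V g r ω

/-- `V r x` is a version of `W_r(i_ε(x))`, measurable in all variables. -/
structure IsField (μ : Measure Ω) (ε : ℝ) (W : ℝ → Ω → Distr) (V : ℝ → ℝ → Ω → ℝ) : Prop where
  measurable : Measurable fun p : ℝ × ℝ × Ω => V p.1 p.2.1 p.2.2
  pairs : ∀ r x, Pairs μ (W r) (iEps ε x) (V r x)

namespace IsField

theorem measurable_integrand (hV : IsField μ ε W V) (g : 𝓢(ℝ, ℝ)) :
    Measurable fun p : (ℝ × Ω) × ℝ => (V p.1.1 p.2 p.1.2 ^ 2 - χ / ε) * g p.2 := by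
  have h1 : Measurable fun p : (ℝ × Ω) × ℝ => V p.1.1 p.2 p.1.2 :=
    hV.measurable.comp (by fun_prop : Measurable fun p : (ℝ × Ω) × ℝ => (p.1.1, p.2, p.1.2))
  have h2 : Measurable fun p : (ℝ × Ω) × ℝ => g p.2 := g.continuous.measurable.comp measurable_snd
  exact ((h1.pow_const 2).sub_const _).mul h2

theorem measurable_slice (hV : IsField μ ε W V) (g : 𝓢(ℝ, ℝ)) :
    Measurable (Function.uncurry (renormSlice χ ε V g)) :=
  ((hV.measurable_integrand g).stronglyMeasurable.integral_prod_right'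
    (ν := volume)).measurable

variable [IsProbabilityMeasure μ]

theorem hasL2Bound_slice (hW : ∀ r, IsWhiteNoise μ χ (W r)) (hχ : 0 ≤ χ) (hε : 0 < ε)
    (hV : IsField μ ε W V) (g : 𝓢(ℝ, ℝ)) (r : ℝ) :
    HasL2Bound μ (renormSlice χ ε V g r) (√(4 * χ ^ 2 / ε * sqNorm g)) ∧
      ∀ᵐ ω ∂μ, Integrable fun x => (V r x ω ^ 2 - χ / ε) * g x :=
  hasL2Bound_renorm (X := V r) (hW r) hχ hε
    (hV.measurable.comp (by fun_prop : Measurable fun p : ℝ × Ω => (r, p.1, p.2))) (hV.pairs r) g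

theorem hasL2Bound_quad (hW : ∀ r, IsWhiteNoise μ χ (W r)) (hχ : 0 ≤ χ) (hε : 0 < ε)
    (hV : IsField μ ε W V) (g : 𝓢(ℝ, ℝ)) {s t : ℝ} (hst : s ≤ t) :
    HasL2Bound μ (renormQuad χ ε V s t g) ((t - s) * √(4 * χ ^ 2 / ε * sqNorm g)) :=
  hasL2Bound_integral hst (hV.measurable_slice g) fun r => (hV.hasL2Bound_slice hW hχ hε g r).1

/-- Linearity in the test function holds only almost surely: the space and time integrals split
where they converge, and this is known off a null set. -/
theorem quad_sub_ae_eq (hW : ∀ r, IsWhiteNoise μ χ (W r)) (hχ : 0 ≤ χ) (hε : 0 < ε)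
    (hV : IsField μ ε W V) (g g' : 𝓢(ℝ, ℝ)) {s t : ℝ} (hst : s ≤ t) :
    renormQuad χ ε V s t (g - g') =ᵐ[μ]
      fun ω => renormQuad χ ε V s t g ω - renormQuad χ ε V s t g' ω := by
  have h1 : ∀ r, renormSlice χ ε V (g - g') r =ᵐ[μ]
      fun ω => renormSlice χ ε V g r ω - renormSlice χ ε V g' r ω := fun r => by
    filter_upwards [(hV.hasL2Bound_slice hW hχ hε g r).2, (hV.hasL2Bound_slice hW hχ hε g' r).2]
      with ω h h'
    simp only [renormSlice]
    rw [← integral_sub h h']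
    refine integral_congr_ae (ae_of_all _ fun x => ?_)
    simp only [sub_apply]
    ring
  have h2 := intervalIntegral_ae_congr
    (Ψ := fun r ω => renormSlice χ ε V g r ω - renormSlice χ ε V g' r ω) (hV.measurable_slice (χ := χ) (g - g'))
    ((hV.measurable_slice (χ := χ) g).sub (hV.measurable_slice (χ := χ) g')) h1 s t
  filter_upwards [h2, ae_intervalIntegrable hst (hV.measurable_slice g)
      fun r => (hV.hasL2Bound_slice hW hχ hε g r).1,
    ae_intervalIntegrable hst (hV.measurable_slice g')
      fun r => (hV.hasL2Bound_slice hW hχ hε g' r).1] with ω h h3 h4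
  simp only [renormQuad]
  rw [h, ← intervalIntegral.integral_sub h3 h4]

theorem quad_time_sub_ae_eq (hW : ∀ r, IsWhiteNoise μ χ (W r)) (hχ : 0 ≤ χ) (hε : 0 < ε)
    (hV : IsField μ ε W V) (g : 𝓢(ℝ, ℝ)) {r s t : ℝ} (hrs : r ≤ s) (hst : s ≤ t) :
    (fun ω => renormQuad χ ε V r t g ω - renormQuad χ ε V r s g ω) =ᵐ[μ]
      renormQuad χ ε V s t g := by
  filter_upwards [ae_intervalIntegrable hst (hV.measurable_slice g)
      fun r => (hV.hasL2Bound_slice hW hχ hε g r).1,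
    ae_intervalIntegrable hrs (hV.measurable_slice g)
      fun r => (hV.hasL2Bound_slice hW hχ hε g r).1] with ω h1 h2
  simp only [renormQuad]
  rw [← intervalIntegral.integral_add_adjacent_intervals h2 h1]
  ring

theorem quad_congr (hV : IsField μ ε W V)
    (hm : Measurable fun p : ℝ × ℝ × Ω => V' p.1 p.2.1 p.2.2)
    (h : ∀ r x, ∀ᵐ ω ∂μ, V r x ω ^ 2 = V' r x ω ^ 2) (g : 𝓢(ℝ, ℝ)) (s t : ℝ) :
    renormQuad χ ε V s t g =ᵐ[μ] renormQuad χ ε V' s t g := by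
  have hm' : Measurable fun p : (ℝ × Ω) × ℝ => (V' p.1.1 p.2 p.1.2 ^ 2 - χ / ε) * g p.2 := by
    have h1 : Measurable fun p : (ℝ × Ω) × ℝ => V' p.1.1 p.2 p.1.2 :=
      hm.comp (by fun_prop : Measurable fun p : (ℝ × Ω) × ℝ => (p.1.1, p.2, p.1.2))
    have h2 : Measurable fun p : (ℝ × Ω) × ℝ => g p.2 :=
      g.continuous.measurable.comp measurable_snd
    exact ((h1.pow_const 2).sub_const _).mul h2
  refine intervalIntegral_ae_congr (Ψ := renormSlice χ ε V' g) (hV.measurable_slice g)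
    (hm'.stronglyMeasurable.integral_prod_right' (ν := volume)).measurable (fun r => ?_) s t
  have e1 : Measurable fun p : ℝ × Ω => V r p.1 p.2 ^ 2 :=
    (hV.measurable.comp (by fun_prop : Measurable fun p : ℝ × Ω => (r, p.1, p.2))).pow_const 2
  have e2 : Measurable fun p : ℝ × Ω => V' r p.1 p.2 ^ 2 :=
    (hm.comp (by fun_prop : Measurable fun p : ℝ × Ω => (r, p.1, p.2))).pow_const 2
  filter_upwards [integral_congr_of_forall_ae (Φ := fun x ω => V r x ω ^ 2)
    (Ψ := fun x ω => V' r x ω ^ 2) e1 e2 (h r)] with ω hω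
  refine integral_congr_ae (hω.mono fun x hx => ?_)
  simp only
  rw [hx]

end IsField

theorem integral_grad (u : 𝓢(ℝ, ℝ)) : ∫ x, grad u x = 0 := by
  have h := integral_of_hasDerivAt_of_tendsto (f := u) (f' := grad u) (m := 0) (n := 0)
    (fun x => by
      have := u.differentiableAt (x := x)
      simpa [grad] using this.hasDerivAt)
    (grad u).integrable
    (u.tendsto_cocompact.mono_left atBot_le_cocompact)
    (u.tendsto_cocompact.mono_left atTop_le_cocompact)
  simpa using h

/-- A gradient has integral zero, so the diverging constant `χ/ε` can be subtracted for free. This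
puts the Burgers and KPZ nonlinearities in a common form. -/
theorem IsField.burgersNonlin_ae_eq [IsProbabilityMeasure μ] {𝒱 : ℝ → ℝ → ℝ → Ω → ℝ}
    (hW : ∀ r, IsWhiteNoise μ χ (W r)) (hχ : 0 ≤ χ) (hε : 0 < ε)
    (hV : IsField μ ε W (𝒱 ε)) (u : 𝓢(ℝ, ℝ)) (s t : ℝ) :
    burgersNonlin 𝒱 ε s t u =ᵐ[μ] renormQuad χ ε (𝒱 ε) s t (grad u) := by
  have hm := hV.measurable_integrand (χ := 0) (grad u)
  simp only [zero_div, sub_zero] at hm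
  refine intervalIntegral_ae_congr
    (hm.stronglyMeasurable.integral_prod_right' (ν := volume)).measurable
    (hV.measurable_slice (grad u)) (fun r => ?_) s t
  filter_upwards [(hV.hasL2Bound_slice hW hχ hε (grad u) r).2] with ω hω
  have h1 : Integrable fun x => χ / ε * grad u x := (grad u).integrable.const_mul _
  have h2 : ∫ x, 𝒱 ε r x ω ^ 2 * grad u x =
      (∫ x, (𝒱 ε r x ω ^ 2 - χ / ε) * grad u x) + ∫ x, χ / ε * grad u x := by
    rw [← integral_add hω h1]
    refine integral_congr_ae (ae_of_all _ fun x => ?_)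
    ring
  rw [integral_const_mul, integral_grad, mul_zero, add_zero] at h2
  exact h2

end RenormQuad

theorem kpzNonlin_eq_renormQuad {Ω' : Type*} (χ : ℝ) (h : ℝ → ℝ → Ω' → ℝ) (ε s t : ℝ) (u : 𝓢(ℝ, ℝ)) :
    kpzNonlin χ h ε s t u =
      renormQuad χ ε (fun r x ω => (h r (x + ε) ω - h r x ω) / ε) s t u := rfl

/-! ### Deterministic chaining along dyadic points. -/

section Chaining

/-- The dyadic point `⌊2ⁿ t⌋ / 2ⁿ`. -/
def dyadicFloor (n : ℕ) (t : ℝ) : ℝ := (⌊2 ^ n * t⌋ : ℝ) / 2 ^ n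

theorem dyadicFloor_le (n : ℕ) (t : ℝ) : dyadicFloor n t ≤ t := by
  rw [dyadicFloor, div_le_iff₀ (by positivity), mul_comm]
  exact Int.floor_le _

theorem lt_dyadicFloor_add (n : ℕ) (t : ℝ) : t < dyadicFloor n t + 1 / 2 ^ n := by
  rw [dyadicFloor, ← add_div, lt_div_iff₀ (by positivity), mul_comm]
  exact Int.lt_floor_add_one _

theorem le_dyadicFloor {a : ℤ} {t : ℝ} (h : a ≤ t) (n : ℕ) : a ≤ dyadicFloor n t := by
  rw [dyadicFloor, le_div_iff₀ (by positivity)]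
  have : (a * 2 ^ n : ℤ) ≤ ⌊2 ^ n * t⌋ := by
    rw [Int.le_floor]
    push_cast
    rw [mul_comm]
    gcongr
  exact_mod_cast this

theorem dyadicFloor_succ (n : ℕ) (t : ℝ) :
    dyadicFloor n t = ((2 * ⌊2 ^ n * t⌋ : ℤ) : ℝ) / 2 ^ (n + 1) ∧
    (dyadicFloor (n + 1) t = dyadicFloor n t ∨
      dyadicFloor (n + 1) t = (((2 * ⌊2 ^ n * t⌋ : ℤ) : ℝ) + 1) / 2 ^ (n + 1)) := by
  have h0 : dyadicFloor n t = ((2 * ⌊2 ^ n * t⌋ : ℤ) : ℝ) / 2 ^ (n + 1) := by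
    rw [dyadicFloor, pow_succ]
    push_cast
    field_simp
  refine ⟨h0, ?_⟩
  have h1 : 2 * ⌊2 ^ n * t⌋ ≤ ⌊2 ^ (n + 1) * t⌋ := by
    rw [Int.le_floor, pow_succ]
    push_cast
    have := Int.floor_le (2 ^ n * t)
    linarith
  have h2 : ⌊2 ^ (n + 1) * t⌋ < 2 * ⌊2 ^ n * t⌋ + 2 := by
    rw [Int.floor_lt, pow_succ]
    push_cast
    have := Int.lt_floor_add_one (2 ^ n * t)
    linarith
  rcases (by omega : ⌊2 ^ (n + 1) * t⌋ = 2 * ⌊2 ^ n * t⌋ ∨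
    ⌊2 ^ (n + 1) * t⌋ = 2 * ⌊2 ^ n * t⌋ + 1) with h | h
  · left; rw [h0, dyadicFloor, h]
  · right; rw [dyadicFloor, h]; push_cast; ring

theorem tendsto_dyadicFloor (t : ℝ) : Tendsto (fun n => dyadicFloor n t) atTop (𝓝 t) := by
  have h : Tendsto (fun n : ℕ => t - (1 / 2 : ℝ) ^ n) atTop (𝓝 (t - 0)) :=
    (tendsto_pow_atTop_nhds_zero_of_lt_one (by norm_num) (by norm_num)).const_sub t
  rw [sub_zero] at h
  refine tendsto_of_tendsto_of_tendsto_of_le_of_le h tendsto_const_nhds (fun n => ?_)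
    (fun n => dyadicFloor_le n t)
  have := lt_dyadicFloor_add n t
  simp only [one_div, inv_pow] at this ⊢
  linarith

/-- `d n` bounds the increments of `b` over the dyadic intervals of length `2⁻ⁿ` in `[α, β]`. -/
def GridBound (b : ℝ → ℝ) (α : ℤ) (β : ℝ) (d : ℕ → ℝ) : Prop :=
  ∀ (n : ℕ) (k : ℤ), (α : ℝ) ≤ k / 2 ^ n → ((k : ℝ) + 1) / 2 ^ n ≤ β →
    |b (((k : ℝ) + 1) / 2 ^ n) - b (k / 2 ^ n)| ≤ d n

namespace GridBound

variable {b : ℝ → ℝ} {α : ℤ} {β : ℝ} {d : ℕ → ℝ}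

theorem step (h : GridBound b α β d) (hd : ∀ n, 0 ≤ d n) {t : ℝ} (h1 : α ≤ t) (h2 : t ≤ β)
    (n : ℕ) : |b (dyadicFloor (n + 1) t) - b (dyadicFloor n t)| ≤ d (n + 1) := by
  obtain ⟨e, h' | h'⟩ := dyadicFloor_succ n t
  · rw [h', sub_self, abs_zero]; exact hd _
  · rw [h', e]
    refine h (n + 1) _ ?_ ?_
    · rw [← e]; exact le_dyadicFloor h1 n
    · rw [← h']; exact (dyadicFloor_le _ t).trans h2

/-- Two points at distance less than `2⁻ⁿ` have equal or neighbouring dyadic floors of level `n`, so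
at most one grid increment separates them. -/
theorem near (h : GridBound b α β d) (hd : ∀ n, 0 ≤ d n) {s t : ℝ} (h1 : α ≤ s) (h2 : t ≤ β)
    (hst : s ≤ t) (n : ℕ) (hn : t < s + 1 / 2 ^ n) :
    |b (dyadicFloor n t) - b (dyadicFloor n s)| ≤ d n := by
  have hp : (0 : ℝ) < 2 ^ n := by positivity
  have a1 : ⌊2 ^ n * s⌋ ≤ ⌊2 ^ n * t⌋ := Int.floor_le_floor (by gcongr)
  have a2 : ⌊2 ^ n * t⌋ < ⌊2 ^ n * s⌋ + 2 := by
    rw [Int.floor_lt]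
    push_cast
    have h3 := Int.lt_floor_add_one (2 ^ n * s)
    have h4 : 2 ^ n * t < 2 ^ n * (s + 1 / 2 ^ n) := by gcongr
    rw [mul_add, mul_one_div_cancel hp.ne'] at h4
    linarith
  rcases (by omega : ⌊2 ^ n * t⌋ = ⌊2 ^ n * s⌋ ∨ ⌊2 ^ n * t⌋ = ⌊2 ^ n * s⌋ + 1) with h' | h'
  · simp only [dyadicFloor, h', sub_self, abs_zero]; exact hd n
  · have e : dyadicFloor n t = ((⌊2 ^ n * s⌋ : ℝ) + 1) / 2 ^ n := by
      rw [dyadicFloor, h']; push_cast; ring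
    rw [e]
    refine h n _ ?_ ?_
    · exact le_dyadicFloor h1 n
    · rw [← e]; exact (dyadicFloor_le _ t).trans h2

theorem dist_le (h : GridBound b α β d) (hd : ∀ n, 0 ≤ d n) (hs : Summable d) {t : ℝ}
    (h1 : α ≤ t) (h2 : t ≤ β) (n m : ℕ) :
    |b (dyadicFloor (n + m) t) - b (dyadicFloor n t)| ≤ ∑' i, d (i + (n + 1)) := by
  have hs' : Summable fun i => d (i + (n + 1)) := (summable_nat_add_iff (n + 1)).2 hs
  have : |b (dyadicFloor (n + m) t) - b (dyadicFloor n t)| ≤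
      ∑ i ∈ Finset.range m, d (i + (n + 1)) := by
    induction m with
    | zero => simp
    | succ m ih =>
      rw [Finset.sum_range_succ]
      have := h.step hd h1 h2 (n + m)
      have e : n + m + 1 = m + (n + 1) := by ring
      rw [e] at this
      rw [show n + (m + 1) = m + (n + 1) by ring]
      refine (abs_sub_le _ (b (dyadicFloor (n + m) t)) _).trans ?_
      linarith
  exact this.trans (hs'.sum_le_tsum _ fun i _ => hd _)

theorem exists_tendsto (h : GridBound b α β d) (hd : ∀ n, 0 ≤ d n) (hs : Summable d) {t : ℝ}
    (h1 : α ≤ t) (h2 : t ≤ β) :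
    ∃ l, Tendsto (fun n => b (dyadicFloor n t)) atTop (𝓝 l) := by
  have : CauchySeq fun n => b (dyadicFloor n t) := by
    refine cauchySeq_of_dist_le_of_summable (fun n => d (n + 1)) (fun n => ?_)
      ((summable_nat_add_iff 1).2 hs)
    rw [dist_comm, Real.dist_eq]
    exact h.step hd h1 h2 n
  exact cauchySeq_tendsto_of_complete this

theorem abs_limit_sub_le (h : GridBound b α β d) (hd : ∀ n, 0 ≤ d n) (hs : Summable d) {t l : ℝ}
    (h1 : α ≤ t) (h2 : t ≤ β) (hl : Tendsto (fun n => b (dyadicFloor n t)) atTop (𝓝 l)) (n : ℕ) :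
    |l - b (dyadicFloor n t)| ≤ ∑' i, d (i + (n + 1)) := by
  have h3 := ((tendsto_add_atTop_iff_nat n).2 hl).sub_const (b (dyadicFloor n t))
  refine le_of_tendsto h3.abs (Eventually.of_forall fun m => ?_)
  rw [add_comm m n]
  exact h.dist_le hd hs h1 h2 n m

theorem abs_sub_le_tsum (h : GridBound b 0 1 d) (hd : ∀ n, 0 ≤ d n) (hs : Summable d)
    (hb : ContinuousOn b (Icc 0 1)) {t : ℝ} (ht : t ∈ Icc (0 : ℝ) 1) :
    |b t - b 0| ≤ ∑' n, d n := by
  have hz : ((0 : ℤ) : ℝ) ≤ t := by simpa using ht.1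
  have hl : Tendsto (fun n => b (dyadicFloor n t)) atTop (𝓝 (b t)) := by
    refine (hb t ht).tendsto.comp (tendsto_nhdsWithin_iff.2 ⟨tendsto_dyadicFloor t, ?_⟩)
    refine Eventually.of_forall fun n => ⟨?_, (dyadicFloor_le n t).trans ht.2⟩
    simpa using le_dyadicFloor hz n
  have h1 := h.abs_limit_sub_le hd hs hz ht.2 hl 0
  have h2 : |b (dyadicFloor 0 t) - b 0| ≤ d 0 := by
    have e : b (dyadicFloor 0 0) = b 0 := by simp [dyadicFloor]
    -- For `t < 1` the points `0` and `t` are close at level `0`. For `t = 1` they are not, and the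
    -- increment over the whole interval `[0, 1]` is used instead.
    rcases lt_or_eq_of_le ht.2 with h' | h'
    · rw [← e]
      exact h.near hd (by simp) ht.2 ht.1 0 (by simpa using h')
    · have := h 0 0 (by simp) (by simp)
      simpa [dyadicFloor, h'] using this
  have h3 := hs.tsum_eq_zero_add
  rw [zero_add] at h1
  calc _ ≤ |b t - b (dyadicFloor 0 t)| + |b (dyadicFloor 0 t) - b 0| := abs_sub_le _ _ _
    _ ≤ _ := by rw [h3]; linarith

/-- For `|s - s'| < 2⁻ⁿ` the limits differ by at most one grid increment of level `n` and two tails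
of the series. This gives a modulus of continuity on each `[-K, K]`; `K` is taken one unit larger
than `t` requires, so that a whole neighbourhood of `t` is covered. -/
theorem exists_continuous {b : ℝ → ℝ} {d : ℕ → ℕ → ℝ}
    (h : ∀ K : ℕ, GridBound b (-(K : ℤ)) K (d K))
    (hd : ∀ K n, 0 ≤ d K n) (hs : ∀ K, Summable (d K)) :
    ∃ L : ℝ → ℝ, Continuous L ∧ ∀ t, Tendsto (fun n => b (dyadicFloor n t)) atTop (𝓝 (L t)) := by
  have hK : ∀ t : ℝ, ∃ K : ℕ, ((-(K : ℤ) : ℤ) : ℝ) + 1 ≤ t ∧ t + 1 ≤ K := fun t => by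
    obtain ⟨K, hK⟩ := exists_nat_ge (|t| + 1)
    refine ⟨K, ?_, ?_⟩
    · push_cast; linarith [neg_abs_le t]
    · linarith [le_abs_self t]
  have hL : ∀ t, ∃ l, Tendsto (fun n => b (dyadicFloor n t)) atTop (𝓝 l) := fun t => by
    obtain ⟨K, h1, h2⟩ := hK t
    exact (h K).exists_tendsto (hd K) (hs K) (by linarith) (by linarith)
  choose L hL using hL
  refine ⟨L, ?_, hL⟩
  rw [Metric.continuous_iff']
  intro t η hη
  obtain ⟨K, h1, h2⟩ := hK t
  have hlim : Tendsto (fun n => (∑' i, d K (i + (n + 1))) + d K n + ∑' i, d K (i + (n + 1)))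
      atTop (𝓝 (0 + 0 + 0)) := by
    have e1 := (tendsto_add_atTop_iff_nat 1).2 (tendsto_sum_nat_add (d K))
    exact (e1.add (hs K).tendsto_atTop_zero).add e1
  rw [add_zero, add_zero] at hlim
  obtain ⟨n, hn⟩ := (hlim.eventually (gt_mem_nhds hη)).exists
  have key : ∀ s s' : ℝ, t - 1 ≤ s → s ≤ s' → s' ≤ t + 1 → s' < s + 1 / 2 ^ n →
      |L s' - L s| < η := by
    intro s s' ha hb hc hd'
    have c1 := (h K).abs_limit_sub_le (hd K) (hs K) (t := s) (by linarith) (by linarith) (hL s) n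
    have c2 := (h K).abs_limit_sub_le (hd K) (hs K) (t := s') (by linarith) (by linarith)
      (hL s') n
    have c3 := (h K).near (hd K) (s := s) (t := s') (by linarith) (by linarith) hb n hd'
    rw [abs_le] at c1 c2 c3
    rw [abs_lt]
    constructor <;> linarith [c1.1, c1.2, c2.1, c2.2, c3.1, c3.2]
  have hpos : (0 : ℝ) < min 1 (1 / 2 ^ n) := by positivity
  filter_upwards [Metric.ball_mem_nhds t hpos] with s hs'
  rw [Metric.mem_ball, Real.dist_eq, lt_min_iff, abs_lt, abs_lt] at hs'
  obtain ⟨⟨a1, a2⟩, a3, a4⟩ := hs'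
  rw [Real.dist_eq]
  rcases le_total s t with hst | hst
  · rw [abs_sub_comm]
    exact key s t (by linarith) hst (by linarith) (by linarith)
  · exact key t s (by linarith) hst (by linarith) (by linarith)

end GridBound

end Chaining

/-! ### Kolmogorov's continuity estimates. -/

section RandomChaining

variable {Ω : Type*} [MeasurableSpace Ω] {μ : Measure Ω} [IsProbabilityMeasure μ]

/-- The fourth root of `1/2`. -/
def rootHalf : ℝ := √√(1 / 2)

theorem rootHalf_pos : 0 < rootHalf := by unfold rootHalf; positivity

theorem rootHalf_lt_one : rootHalf < 1 := by
  unfold rootHalf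
  rw [Real.sqrt_lt' one_pos, Real.sqrt_lt' (by norm_num)]
  norm_num

theorem rootHalf_sq : rootHalf ^ 2 = √(1 / 2) := Real.sq_sqrt (Real.sqrt_nonneg _)

theorem rootHalf_pow_four (n : ℕ) : (rootHalf ^ n) ^ 4 = 1 / 2 ^ n := by
  rw [← pow_mul, mul_comm, pow_mul, show rootHalf ^ 4 = (rootHalf ^ 2) ^ 2 by ring, rootHalf_sq,
    Real.sq_sqrt (by norm_num), one_div_pow]

theorem sqrt_one_div_two_pow (n : ℕ) : √(1 / 2 ^ n) = (rootHalf ^ n) ^ 2 := by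
  rw [← rootHalf_pow_four, show (rootHalf ^ n) ^ 4 = ((rootHalf ^ n) ^ 2) ^ 2 by ring,
    Real.sqrt_sq (sq_nonneg _)]

theorem summable_rootHalf_mul (c : ℝ) : Summable fun n => rootHalf ^ n * c :=
  (summable_geometric_of_lt_one rootHalf_pos.le rootHalf_lt_one).mul_right c

/-- With a threshold `l`, the largest increment of a level is bounded by a constant plus a multiple
of the sum of squares. The bound is linear in that sum, so only the expectation of the sum is
needed. -/
theorem le_add_sq_div {m l S : ℝ} (hl : 0 < l) (hS : m ^ 2 ≤ S) : m ≤ l + l⁻¹ * S := by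
  have h1 : l⁻¹ * m ^ 2 ≤ l⁻¹ * S := by gcongr
  have h2 : m ≤ l + l⁻¹ * m ^ 2 := by
    have : l + l⁻¹ * m ^ 2 - m = l⁻¹ * ((m - l / 2) ^ 2 + 3 / 4 * l ^ 2) := by field_simp; ring
    have h3 : 0 ≤ l⁻¹ * ((m - l / 2) ^ 2 + 3 / 4 * l ^ 2) := by positivity
    linarith
  linarith

theorem le_add_pow_four_div {m l S : ℝ} (hl : 0 < l) (hm : 0 ≤ m) (hS : m ^ 4 ≤ S) :
    m ≤ l + (l ^ 3)⁻¹ * S := by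
  have h1 : (l ^ 3)⁻¹ * m ^ 4 ≤ (l ^ 3)⁻¹ * S := by gcongr
  rcases le_total m l with h | h
  · have : 0 ≤ (l ^ 3)⁻¹ * m ^ 4 := by positivity
    linarith
  · have h3 : l ^ 3 ≤ m ^ 3 := by gcongr
    have h4 : m ≤ (l ^ 3)⁻¹ * m ^ 4 := by
      rw [← div_eq_inv_mul, le_div_iff₀ (by positivity)]
      nlinarith
    linarith

/-- The constant in the chaining estimate on `[0, T]`. -/
def chainConst (T : ℝ) : ℝ := (1 + T * √T) * (1 - rootHalf)⁻¹

theorem chainConst_nonneg {T : ℝ} (hT : 0 ≤ T) : 0 ≤ chainConst T := by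
  have := rootHalf_lt_one
  unfold chainConst
  have : 0 < 1 - rootHalf := by linarith
  positivity

/-- Kolmogorov's estimate of the supremum of a continuous process. -/
theorem lintegral_norm_le_of_increments {T a : ℝ} (hT : 0 < T) (ha : 0 < a)
    (X : Ω → C(Icc (0 : ℝ) T, ℝ)) (h0 : ∀ᵐ ω ∂μ, X ω ⟨0, left_mem_Icc.2 hT.le⟩ = 0)
    (hX : ∀ s t : Icc (0 : ℝ) T, (s : ℝ) ≤ t →
      HasL2Bound μ (fun ω => X ω t - X ω s) (a * √((t - s) * √(t - s)))) :
    ∫⁻ ω, ENNReal.ofReal ‖X ω‖ ∂μ ≤ ENNReal.ofReal (a * chainConst T) := by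
  -- Time is rescaled to `[0, 1]` to use the dyadic grid.
  let b : Ω → ℝ → ℝ := fun ω s => X ω (projIcc 0 T hT.le (T * s))
  let inc : ℕ → ℕ → Ω → ℝ := fun n k ω =>
    b ω (((k : ℝ) + 1) / 2 ^ n) - b ω ((k : ℝ) / 2 ^ n)
  -- The squares of the `2ⁿ` increments of level `n` have total expectation at most `2ⁿ a²
  -- (T/2ⁿ)^(3/2) = T^(3/2) (a rootHalf ^ n)²`. With threshold `a rootHalf ^ n` both terms of `d`
  -- are then of the same, geometrically decaying order.
  let d : Ω → ℕ → ℝ := fun ω n =>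
    a * rootHalf ^ n + (a * rootHalf ^ n)⁻¹ * ∑ k ∈ Finset.range (2 ^ n), inc n k ω ^ 2
  have hr := rootHalf_pos
  have hd0 : ∀ ω n, 0 ≤ d ω n := fun ω n => by positivity
  have hgrid : ∀ ω, GridBound (b ω) 0 1 (d ω) := by
    intro ω n k h1 h2
    have hp : (0 : ℝ) < 2 ^ n := by positivity
    rw [Int.cast_zero, le_div_iff₀ hp, zero_mul] at h1
    rw [div_le_one hp] at h2
    have hk : 0 ≤ k := by exact_mod_cast h1
    lift k to ℕ using hk
    have hk2 : k < 2 ^ n := by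
      have : ((k + 1 : ℕ) : ℝ) ≤ ((2 ^ n : ℕ) : ℝ) := by push_cast; simpa using h2
      have := Nat.cast_le.1 this
      omega
    refine le_add_sq_div (by positivity) ?_
    rw [sq_abs]
    simp only [Int.cast_natCast]
    exact Finset.single_le_sum (f := fun k => inc n k ω ^ 2) (fun _ _ => sq_nonneg _)
      (Finset.mem_range.2 hk2)
  have hcont : ∀ ω, Continuous (b ω) := fun ω =>
    (X ω).continuous.comp (continuous_projIcc.comp (by fun_prop))
  have hnorm : ∀ᵐ ω ∂μ, ENNReal.ofReal ‖X ω‖ ≤ ∑' n, ENNReal.ofReal (d ω n) := by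
    filter_upwards [h0] with ω hω
    by_cases htop : ∑' n, ENNReal.ofReal (d ω n) = ∞
    · rw [htop]; exact le_top
    have hs : Summable (d ω) := by
      have := ENNReal.summable_toReal htop
      simpa [ENNReal.toReal_ofReal (hd0 ω _)] using this
    rw [← ENNReal.ofReal_tsum_of_nonneg (hd0 ω) hs]
    refine ENNReal.ofReal_le_ofReal ?_
    rw [ContinuousMap.norm_le _ (tsum_nonneg (hd0 ω))]
    intro t
    have ht : (t : ℝ) / T ∈ Icc (0 : ℝ) 1 :=
      ⟨div_nonneg t.2.1 hT.le, (div_le_one hT).2 t.2.2⟩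
    have := (hgrid ω).abs_sub_le_tsum (hd0 ω) hs (hcont ω).continuousOn ht
    have e1 : b ω (t / T) = X ω t := by
      simp only [b]
      rw [mul_div_cancel₀ _ hT.ne', projIcc_val]
    have e2 : b ω 0 = 0 := by
      simp only [b, mul_zero]
      rw [projIcc_left]
      exact hω
    rwa [e1, e2, sub_zero] at this
  have hinc : ∀ n k, k < 2 ^ n → HasL2Bound μ (inc n k)
      (a * √(T / 2 ^ n * √(T / 2 ^ n))) := by
    intro n k hk
    have hp : (0 : ℝ) < 2 ^ n := by positivity
    have hk' : (k : ℝ) + 1 ≤ 2 ^ n := by exact_mod_cast hk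
    have m1 : T * ((k : ℝ) / 2 ^ n) ∈ Icc 0 T :=
      ⟨by positivity, mul_le_of_le_one_right hT.le ((div_le_one hp).2 (by linarith))⟩
    have m2 : T * (((k : ℝ) + 1) / 2 ^ n) ∈ Icc 0 T :=
      ⟨by positivity, mul_le_of_le_one_right hT.le ((div_le_one hp).2 hk')⟩
    have := hX ⟨_, m1⟩ ⟨_, m2⟩ (by simp only; gcongr; linarith)
    simp only at this
    have e : T * (((k : ℝ) + 1) / 2 ^ n) - T * ((k : ℝ) / 2 ^ n) = T / 2 ^ n := by field_simp; ring
    rw [e] at this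
    refine this.congr (ae_of_all _ fun ω => ?_)
    simp only [inc, b]
    rw [projIcc_of_mem hT.le m1, projIcc_of_mem hT.le m2]
  have hdint : ∀ n, AEMeasurable (fun ω => ENNReal.ofReal (d ω n)) μ ∧
      ∫⁻ ω, ENNReal.ofReal (d ω n) ∂μ ≤
        ENNReal.ofReal (a * rootHalf ^ n) +
        ENNReal.ofReal (a * rootHalf ^ n * (T * √T)) := by
    intro n
    have hm : ∀ k ∈ Finset.range (2 ^ n),
        AEMeasurable (fun ω => ENNReal.ofReal (inc n k ω ^ 2)) μ := fun k hk =>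
      ((hinc n k (Finset.mem_range.1 hk)).aesm.aemeasurable.pow_const 2).ennreal_ofReal
    have e : ∀ ω, ENNReal.ofReal (d ω n) = ENNReal.ofReal (a * rootHalf ^ n) +
        ENNReal.ofReal (a * rootHalf ^ n)⁻¹ *
          ∑ k ∈ Finset.range (2 ^ n), ENNReal.ofReal (inc n k ω ^ 2) := fun ω => by
      simp only [d]
      rw [ENNReal.ofReal_add (by positivity)
        (mul_nonneg (by positivity) (Finset.sum_nonneg fun _ _ => sq_nonneg _)),
        ENNReal.ofReal_mul (p := (a * rootHalf ^ n)⁻¹) (by positivity),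
        ENNReal.ofReal_sum_of_nonneg fun _ _ => sq_nonneg _]
    simp only [e]
    refine ⟨((Finset.aemeasurable_fun_sum _ hm).const_mul _).const_add _, ?_⟩
    rw [lintegral_add_left measurable_const, lintegral_const, measure_univ, mul_one,
      lintegral_const_mul' _ _ ENNReal.ofReal_ne_top, lintegral_finsetSum' _ hm]
    gcongr
    calc _ ≤ ENNReal.ofReal (a * rootHalf ^ n)⁻¹ * ∑ k ∈ Finset.range (2 ^ n),
          ENNReal.ofReal ((a * √(T / 2 ^ n * √(T / 2 ^ n))) ^ 2) := by
          gcongr with k hk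
          exact (hinc n k (Finset.mem_range.1 hk)).lintegral_le
      _ = _ := by
          rw [Finset.sum_const, Finset.card_range, nsmul_eq_mul, mul_pow,
            Real.sq_sqrt (by positivity)]
          rw [show ((2 ^ n : ℕ) : ℝ≥0∞) = ENNReal.ofReal (2 ^ n) by
            rw [ENNReal.ofReal_pow (by norm_num)]; simp]
          rw [← ENNReal.ofReal_mul (by positivity), ← ENNReal.ofReal_mul (by positivity)]
          congr 1
          rw [show T / 2 ^ n = T * (1 / 2 ^ n) by ring, Real.sqrt_mul hT.le, sqrt_one_div_two_pow]
          field_simp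
  calc _ ≤ ∫⁻ ω, ∑' n, ENNReal.ofReal (d ω n) ∂μ := lintegral_mono_ae hnorm
    _ = ∑' n, ∫⁻ ω, ENNReal.ofReal (d ω n) ∂μ := lintegral_tsum fun n => (hdint n).1
    _ ≤ ∑' n, ENNReal.ofReal (rootHalf ^ n * (a * (1 + T * √T))) := by
        refine ENNReal.tsum_le_tsum fun n => (hdint n).2.trans_eq ?_
        rw [← ENNReal.ofReal_add (by positivity) (by positivity)]
        congr 1; ring
    _ = _ := by
        rw [← ENNReal.ofReal_tsum_of_nonneg (fun n => by positivity) (summable_rootHalf_mul _),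
          tsum_mul_right, tsum_geometric_of_lt_one rootHalf_pos.le rootHalf_lt_one, chainConst]
        congr 1; ring

/-- Kolmogorov's construction of a continuous version from the dyadic points. -/
theorem ae_exists_continuous_limit {b : ℝ → Ω → ℝ} {C : ℝ} (hC : 0 ≤ C)
    (hm : ∀ x, AEMeasurable (b x) μ)
    (hb : ∀ x y, x ≤ y →
      ∫⁻ ω, ENNReal.ofReal ((b y ω - b x ω) ^ 4) ∂μ ≤ ENNReal.ofReal (C * (y - x) ^ 2)) :
    ∀ᵐ ω ∂μ, ∃ L : ℝ → ℝ, Continuous L ∧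
      ∀ t, Tendsto (fun n => b (dyadicFloor n t) ω) atTop (𝓝 (L t)) := by
  let inc : ℕ → ℤ → Ω → ℝ := fun n k ω =>
    b (((k : ℝ) + 1) / 2 ^ n) ω - b ((k : ℝ) / 2 ^ n) ω
  let I : ℕ → ℕ → Finset ℤ := fun K n => Finset.Ico (-(K * 2 ^ n : ℤ)) (K * 2 ^ n)
  -- On `[-K, K]` there are `2K·2ⁿ` increments, each of fourth moment at most `C 4⁻ⁿ`, so their sum
  -- has expectation at most `2KC (rootHalf ^ n) ^ 4`. Division by the cube of the threshold leaves
  -- `rootHalf ^ n`, which is summable.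
  let d : Ω → ℕ → ℕ → ℝ := fun ω K n =>
    rootHalf ^ n + ((rootHalf ^ n) ^ 3)⁻¹ * ∑ k ∈ I K n, inc n k ω ^ 4
  have hr := rootHalf_pos
  have hpow : ∀ x : ℝ, 0 ≤ x ^ 4 := fun x => Even.pow_nonneg (by decide) x
  have hd0 : ∀ ω K n, 0 ≤ d ω K n := fun ω K n =>
    add_nonneg (by positivity) (mul_nonneg (by positivity) (Finset.sum_nonneg fun _ _ => hpow _))
  have hgrid : ∀ ω (K : ℕ), GridBound (fun x => b x ω) (-(K : ℤ)) K (d ω K) := by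
    intro ω K n k h1 h2
    have hp : (0 : ℝ) < 2 ^ n := by positivity
    rw [le_div_iff₀ hp] at h1
    rw [div_le_iff₀ hp] at h2
    have hk : k ∈ I K n := by
      have h1' : -(K : ℤ) * 2 ^ n ≤ k := by exact_mod_cast h1
      have h2' : k + 1 ≤ (K : ℤ) * 2 ^ n := by exact_mod_cast h2
      rw [Finset.mem_Ico]
      constructor <;> linarith
    refine le_add_pow_four_div (by positivity) (abs_nonneg _) ?_
    rw [Even.pow_abs (by decide)]
    exact Finset.single_le_sum (f := fun k => inc n k ω ^ 4) (fun _ _ => hpow _) hk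
  have hint : ∀ K : ℕ, ∀ᵐ ω ∂μ, Summable (d ω K) := by
    intro K
    have hm' : ∀ n, ∀ k ∈ I K n, AEMeasurable (fun ω => ENNReal.ofReal (inc n k ω ^ 4)) μ :=
      fun n k _ => (((hm _).sub (hm _)).pow_const 4).ennreal_ofReal
    have e : ∀ n ω, ENNReal.ofReal (d ω K n) = ENNReal.ofReal (rootHalf ^ n) +
        ENNReal.ofReal ((rootHalf ^ n) ^ 3)⁻¹ *
          ∑ k ∈ I K n, ENNReal.ofReal (inc n k ω ^ 4) := fun n ω => by
      simp only [d]
      rw [ENNReal.ofReal_add (by positivity)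
        (mul_nonneg (by positivity) (Finset.sum_nonneg fun _ _ => hpow _)),
        ENNReal.ofReal_mul (p := ((rootHalf ^ n) ^ 3)⁻¹) (by positivity),
        ENNReal.ofReal_sum_of_nonneg fun _ _ => hpow _]
    have hdm : ∀ n, AEMeasurable (fun ω => ENNReal.ofReal (d ω K n)) μ := fun n => by
      simp only [e]
      exact ((Finset.aemeasurable_fun_sum _ (hm' n)).const_mul _).const_add _
    have hdn : ∀ n, ∫⁻ ω, ENNReal.ofReal (d ω K n) ∂μ ≤
        ENNReal.ofReal (rootHalf ^ n * (1 + 2 * K * C)) := by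
      intro n
      simp only [e]
      rw [lintegral_add_left measurable_const, lintegral_const, measure_univ, mul_one,
        lintegral_const_mul' _ _ ENNReal.ofReal_ne_top, lintegral_finsetSum' _ (hm' n)]
      calc _ ≤ ENNReal.ofReal (rootHalf ^ n) + ENNReal.ofReal ((rootHalf ^ n) ^ 3)⁻¹ *
            ∑ k ∈ I K n, ENNReal.ofReal (C * (1 / 2 ^ n) ^ 2) := by
            gcongr with k hk
            refine (hb _ _ (by gcongr; linarith)).trans_eq ?_
            congr 3
            ring
        _ = _ := by
            have hcard : (I K n).card = 2 * K * 2 ^ n := by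
              simp only [I, Int.card_Ico]
              rw [show (K * 2 ^ n : ℤ) - -(K * 2 ^ n) = ((2 * K * 2 ^ n : ℕ) : ℤ) by
                push_cast; ring, Int.toNat_natCast]
            rw [Finset.sum_const, hcard, nsmul_eq_mul,
              show ((2 * K * 2 ^ n : ℕ) : ℝ≥0∞) = ENNReal.ofReal (2 * K * 2 ^ n) by
                rw [← ENNReal.ofReal_natCast]; push_cast; rfl,
              ← ENNReal.ofReal_mul (by positivity), ← ENNReal.ofReal_mul (by positivity),
              ← ENNReal.ofReal_add (by positivity) (by positivity)]
            congr 1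
            rw [← rootHalf_pow_four,
              show (2 : ℝ) ^ n = ((rootHalf ^ n) ^ 4)⁻¹ by rw [rootHalf_pow_four]; simp]
            field_simp
    have hfin : ∫⁻ ω, ∑' n, ENNReal.ofReal (d ω K n) ∂μ ≠ ∞ := by
      rw [lintegral_tsum hdm]
      refine ((ENNReal.tsum_le_tsum hdn).trans_lt ?_).ne
      rw [← ENNReal.ofReal_tsum_of_nonneg (fun n => by positivity) (summable_rootHalf_mul _)]
      exact ENNReal.ofReal_lt_top
    filter_upwards [ae_lt_top' (AEMeasurable.tsum hdm) hfin] with ω hω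
    have := ENNReal.summable_toReal hω.ne
    simpa [ENNReal.toReal_ofReal (hd0 ω K _)] using this
  filter_upwards [ae_all_iff.2 hint] with ω hω
  exact GridBound.exists_continuous (hgrid ω) (hd0 ω) hω

end RandomChaining

/-! ### Random elements of the space of continuous paths. -/

section PathSpace

variable {Ω : Type*} [MeasurableSpace Ω] {μ : Measure Ω} {T : ℝ}

/-- Evaluation on a countable dense set of times is continuous and injective between Polish spaces,
hence a measurable embedding. -/
theorem measurable_of_eval {X : Ω → C(Icc (0 : ℝ) T, ℝ)} (h : ∀ t, Measurable fun ω => X ω t) :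
    Measurable X := by
  obtain ⟨S, hS, hd⟩ := TopologicalSpace.exists_countable_dense (Icc (0 : ℝ) T)
  have : Countable S := hS
  let e : C(Icc (0 : ℝ) T, ℝ) → S → ℝ := fun f s => f s
  have hc : Continuous e := continuous_pi fun s => continuous_eval_const (s : Icc (0 : ℝ) T)
  have hi : Function.Injective e := fun f g hfg => by
    refine ContinuousMap.ext fun t => ?_
    refine congrFun (Continuous.ext_on hd f.continuous g.continuous fun s hs => ?_) t
    exact congrFun hfg ⟨s, hs⟩
  rw [← (hc.measurableEmbedding hi).measurable_comp_iff]
  exact measurable_pi_lambda _ fun s => h s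

theorem eLpNorm_one_path (X : Ω → C(Icc (0 : ℝ) T, ℝ)) :
    eLpNorm X 1 μ = ∫⁻ ω, ENNReal.ofReal ‖X ω‖ ∂μ := by
  rw [eLpNorm_one_eq_lintegral_enorm]
  exact lintegral_congr fun ω => (ofReal_norm _).symm

theorem ae_eq_path {X X' : Ω → C(Icc (0 : ℝ) T, ℝ)} (h : ∀ t, ∀ᵐ ω ∂μ, X ω t = X' ω t) :
    X =ᵐ[μ] X' := by
  obtain ⟨S, hS, hd⟩ := TopologicalSpace.exists_countable_dense (Icc (0 : ℝ) T)
  filter_upwards [(ae_ball_iff hS).2 fun t _ => h t] with ω hω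
  refine ContinuousMap.ext fun t => ?_
  exact congrFun (Continuous.ext_on hd (X ω).continuous (X' ω).continuous fun s hs => hω s hs) t

theorem exists_limit_of_cauchy {E : Type*} [NormedAddCommGroup E] [CompleteSpace E] {p : ℝ≥0∞}
    [Fact (1 ≤ p)] {X : ℕ+ → Ω → E} (hX : ∀ n, MemLp (X n) p μ) {e : ℕ+ → ℝ}
    (he : Tendsto e atTop (𝓝 0))
    (hc : ∀ m n, eLpNorm (X m - X n) p μ ≤ ENNReal.ofReal (e m + e n)) :
    ∃ Z : Ω → E, StronglyMeasurable Z ∧ MemLp Z p μ ∧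
      Tendsto (fun n => eLpNorm (X n - Z) p μ) atTop (𝓝 0) := by
  have hcau : CauchySeq fun n => (hX n).toLp (X n) := by
    rw [Lp.cauchySeq_Lp_iff_cauchySeq_eLpNorm]
    have h1 : Tendsto (fun n : ℕ+ × ℕ+ => ENNReal.ofReal (e n.1 + e n.2)) atTop (𝓝 0) := by
      have h2 : Tendsto (fun n : ℕ+ × ℕ+ => e n.1 + e n.2) atTop (𝓝 (0 + 0)) := by
        rw [← prod_atTop_atTop_eq]
        exact (he.comp tendsto_fst).add (he.comp tendsto_snd)
      rw [add_zero] at h2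
      simpa using ENNReal.tendsto_ofReal h2
    refine tendsto_of_tendsto_of_tendsto_of_le_of_le tendsto_const_nhds h1 (fun _ => zero_le)
      fun n => ?_
    refine (eLpNorm_congr_ae ?_).trans_le (hc n.1 n.2)
    exact (hX n.1).coeFn_toLp.sub (hX n.2).coeFn_toLp
  obtain ⟨Z, hZ⟩ := cauchySeq_tendsto_of_complete hcau
  refine ⟨Z, Lp.stronglyMeasurable Z, Lp.memLp Z, ?_⟩
  have := (Lp.tendsto_Lp_iff_tendsto_eLpNorm' _ _).1 hZ
  refine this.congr fun n => eLpNorm_congr_ae ?_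
  exact (hX n).coeFn_toLp.sub (ae_eq_refl _)

end PathSpace

/-! ### Maximal inequality for continuous martingales. -/

section Doob

variable {Ω : Type*} {mΩ : MeasurableSpace Ω} {μ : Measure Ω} [IsProbabilityMeasure μ] {T c : ℝ}
  {𝓕 : Filtration (Icc (0 : ℝ) T) mΩ} {N : Icc (0 : ℝ) T → Ω → ℝ}

/-- The trajectory of a continuous process. -/
def contPath (N : Icc (0 : ℝ) T → Ω → ℝ) (h : ∀ ω, Continuous fun t => N t ω) (ω : Ω) :
    C(Icc (0 : ℝ) T, ℝ) := ⟨fun t => N t ω, h ω⟩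

namespace IsMartingaleWithQV

omit [IsProbabilityMeasure μ] in
theorem measurable (h : IsMartingaleWithQV μ 𝓕 c N) (t : Icc (0 : ℝ) T) : Measurable (N t) :=
  (h.martingale.stronglyMeasurable t).measurable.mono (𝓕.le t) le_rfl

theorem integrable_sq (h : IsMartingaleWithQV μ 𝓕 c N) (t : Icc (0 : ℝ) T) :
    Integrable (fun ω => N t ω ^ 2) μ := by
  have := (h.quadraticVariation.integrable t).add (integrable_const (c * (t : ℝ)))
  refine this.congr (ae_of_all _ fun ω => ?_)
  simp

theorem integral_sq (h : IsMartingaleWithQV μ 𝓕 c N) (hT : 0 ≤ T)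
    (h0 : ∀ᵐ ω ∂μ, N ⟨0, left_mem_Icc.2 hT⟩ ω = 0) (t : Icc (0 : ℝ) T) :
    ∫ ω, N t ω ^ 2 ∂μ = c * t := by
  have h1 := h.quadraticVariation.setIntegral_eq (i := ⟨0, left_mem_Icc.2 hT⟩) (j := t) t.2.1
    MeasurableSet.univ
  simp only [setIntegral_univ, mul_zero, sub_zero] at h1
  rw [integral_sub (h.integrable_sq t) (integrable_const _)] at h1
  have h2 : ∫ ω, N ⟨0, left_mem_Icc.2 hT⟩ ω ^ 2 ∂μ = 0 := by
    rw [integral_congr_ae (g := fun _ => 0) (h0.mono fun ω hω => by simp [hω])]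
    simp
  rw [h2] at h1
  simp at h1
  linarith

theorem hasL2Bound (h : IsMartingaleWithQV μ 𝓕 c N) (hT : 0 ≤ T)
    (h0 : ∀ᵐ ω ∂μ, N ⟨0, left_mem_Icc.2 hT⟩ ω = 0) (t : Icc (0 : ℝ) T) :
    HasL2Bound μ (N t) √(c * t) :=
  .of_integral_le ((memLp_two_iff_integrable_sq
    (h.measurable t).aestronglyMeasurable).2 (h.integrable_sq t)) (h.integral_sq hT h0 t).le

/-- The square is the martingale `N² - ct` plus a deterministic nondecreasing function. -/
theorem submartingale_sq (h : IsMartingaleWithQV μ 𝓕 c N) (hc : 0 ≤ c) :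
    Submartingale (fun t ω => N t ω ^ 2) 𝓕 μ := by
  have h1 : Submartingale (fun (t : Icc (0 : ℝ) T) (_ : Ω) => c * (t : ℝ)) 𝓕 μ := by
    refine ⟨fun t => stronglyMeasurable_const, fun i j hij => ?_, fun t => integrable_const _⟩
    rw [condExp_const (𝓕.le i)]
    refine ae_of_all _ fun ω => ?_
    have : (i : ℝ) ≤ j := hij
    simp only
    gcongr
  have h2 := h.quadraticVariation.submartingale.add h1
  have e : ((fun (t : Icc (0 : ℝ) T) ω => N t ω ^ 2 - c * (t : ℝ)) +
      fun (t : Icc (0 : ℝ) T) (_ : Ω) => c * (t : ℝ)) =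
      fun t ω => N t ω ^ 2 := by
    ext t ω; simp
  rwa [e] at h2

/-- The discrete maximal inequality for `N²` along a dyadic grid. The bound involves only the
terminal time, not the mesh, so the grid can be refined. -/
theorem measure_grid_le (h : IsMartingaleWithQV μ 𝓕 c N) (hT : 0 < T) (hc : 0 ≤ c)
    (h0 : ∀ᵐ ω ∂μ, N ⟨0, left_mem_Icc.2 hT.le⟩ ω = 0) {x : ℝ} (hx : 0 < x) (n : ℕ) :
    μ {ω | ∃ k : ℕ, k ≤ 2 ^ n ∧ x ≤ |N (projIcc 0 T hT.le (T * (k / 2 ^ n))) ω|} ≤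
      ENNReal.ofReal (c * T / x ^ 2) := by
  let g : ℕ → Icc (0 : ℝ) T := fun k => projIcc 0 T hT.le (T * (k / 2 ^ n))
  have hg : Monotone g := fun i j hij => monotone_projIcc hT.le (by gcongr)
  let 𝓖 : Filtration ℕ mΩ := ⟨fun k => 𝓕 (g k), fun i j hij => 𝓕.mono (hg hij), fun k => 𝓕.le _⟩
  have hs := h.submartingale_sq hc
  have hs' : Submartingale (fun k ω => N (g k) ω ^ 2) 𝓖 μ :=
    ⟨fun k => hs.stronglyMeasurable (g k), fun i j hij => hs.2.1 _ _ (hg hij),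
      fun k => hs.integrable _⟩
  have hmax := maximal_ineq hs' (fun k ω => sq_nonneg _) (ε := NNReal.mk (x ^ 2) (sq_nonneg x)) (2 ^ n)
  have hle : {ω | ∃ k ≤ 2 ^ n, x ≤ |N (g k) ω|} ⊆
      {ω | x ^ 2 ≤ (Finset.range (2 ^ n + 1)).sup' Finset.nonempty_range_add_one
        fun k => N (g k) ω ^ 2} := by
    rintro ω ⟨k, hk, hkx⟩
    refine le_trans ?_ (Finset.le_sup' (fun k => N (g k) ω ^ 2)
      (Finset.mem_range.2 (Nat.lt_succ_of_le hk)))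
    rw [← sq_abs (N (g k) ω)]
    gcongr
  have hgn : (g (2 ^ n) : ℝ) = T := by
    have e1 : ((2 ^ n : ℕ) : ℝ) / 2 ^ n = 1 := by push_cast; exact div_self (by positivity)
    simp only [g, e1, mul_one, projIcc_right]
  have h2 : ENNReal.ofReal (x ^ 2) * μ {ω | ∃ k ≤ 2 ^ n, x ≤ |N (g k) ω|} ≤
      ENNReal.ofReal (c * T) := by
    calc _ ≤ ENNReal.ofReal (x ^ 2) * μ {ω | x ^ 2 ≤ (Finset.range (2 ^ n + 1)).sup'
          Finset.nonempty_range_add_one fun k => N (g k) ω ^ 2} := by gcongr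
      _ ≤ _ := by
          have e : ENNReal.ofReal (x ^ 2) = ((NNReal.mk (x ^ 2) (sq_nonneg x) : ℝ≥0) : ℝ≥0∞) :=
            ENNReal.ofReal_eq_coe_nnreal _
          rw [e]
          refine hmax.trans (ENNReal.ofReal_le_ofReal ?_)
          refine (setIntegral_le_integral (h.integrable_sq _)
            (ae_of_all _ fun _ => sq_nonneg _)).trans_eq ?_
          rw [h.integral_sq hT.le h0, hgn]
  rw [ENNReal.ofReal_div_of_pos (by positivity)]
  rw [ENNReal.le_div_iff_mul_le (Or.inl (by simpa using hx.ne')) (Or.inl ENNReal.ofReal_ne_top),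
    mul_comm]
  exact h2

/-- The grids are nested, so their events increase. If a continuous path exceeds `x` strictly
somewhere, it still does so at a nearby dyadic time. -/
theorem measure_norm_le (h : IsMartingaleWithQV μ 𝓕 c N) (hT : 0 < T) (hc : 0 ≤ c)
    (h0 : ∀ᵐ ω ∂μ, N ⟨0, left_mem_Icc.2 hT.le⟩ ω = 0) {x : ℝ} (hx : 0 < x) :
    μ {ω | x < ‖contPath N h.continuous ω‖} ≤ ENNReal.ofReal (c * T / x ^ 2) := by
  let A : ℕ → Set Ω := fun n =>
    {ω | ∃ k : ℕ, k ≤ 2 ^ n ∧ x ≤ |N (projIcc 0 T hT.le (T * (k / 2 ^ n))) ω|}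
  have hA : Monotone A := by
    refine monotone_nat_of_le_succ fun n => ?_
    rintro ω ⟨k, hk, hkx⟩
    refine ⟨2 * k, by rw [pow_succ]; omega, ?_⟩
    have e : (((2 * k : ℕ) : ℝ) / 2 ^ (n + 1)) = k / 2 ^ n := by
      push_cast; rw [pow_succ]; field_simp
    rw [e]
    exact hkx
  have hsub : {ω | x < ‖contPath N h.continuous ω‖} ⊆ ⋃ n, A n := by
    intro ω hω
    have hω' : ¬ ‖contPath N h.continuous ω‖ ≤ x := not_le.2 hω
    rw [ContinuousMap.norm_le _ hx.le] at hω'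
    push Not at hω'
    obtain ⟨t, ht⟩ := hω'
    have hlim : Tendsto (fun n => |N (projIcc 0 T hT.le (T * dyadicFloor n (t / T))) ω|) atTop
        (𝓝 |N t ω|) := by
      have h1 : Continuous fun s : ℝ => |N (projIcc 0 T hT.le (T * s)) ω| :=
        ((h.continuous ω).comp (continuous_projIcc.comp (by fun_prop))).abs
      have h2 := (h1.tendsto (t / T)).comp (tendsto_dyadicFloor (t / T))
      rw [mul_div_cancel₀ _ hT.ne', projIcc_val] at h2
      exact h2
    obtain ⟨n, hn⟩ := (hlim.eventually (lt_mem_nhds (show x < |N t ω| from ht))).exists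
    refine mem_iUnion.2 ⟨n, ⌊2 ^ n * ((t : ℝ) / T)⌋.toNat, ?_, ?_⟩
    · rw [Int.toNat_le]
      have h3 : (t : ℝ) / T ≤ 1 := (div_le_one hT).2 t.2.2
      have h4 : (⌊2 ^ n * ((t : ℝ) / T)⌋ : ℝ) ≤ 2 ^ n :=
        (Int.floor_le _).trans (mul_le_of_le_one_right (by positivity) h3)
      exact_mod_cast h4
    · have h5 : 0 ≤ ⌊2 ^ n * ((t : ℝ) / T)⌋ :=
        Int.floor_nonneg.2 (mul_nonneg (by positivity) (div_nonneg t.2.1 hT.le))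
      have h6 : ((⌊2 ^ n * ((t : ℝ) / T)⌋.toNat : ℕ) : ℝ) = ⌊2 ^ n * ((t : ℝ) / T)⌋ := by
        exact_mod_cast Int.toNat_of_nonneg h5
      rw [h6]
      exact hn.le
  calc _ ≤ μ (⋃ n, A n) := measure_mono hsub
    _ = ⨆ n, μ (A n) := hA.measure_iUnion
    _ ≤ _ := iSup_le fun n => h.measure_grid_le hT hc h0 hx n

/-- Layer-cake formula: the tail is bounded by `1` below `a` and by `cT/x²` above it, which gives `a
+ cT/a ≤ 2a`. Leaving `a` free avoids a separate treatment of `c = 0`. -/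
theorem eLpNorm_path_le (h : IsMartingaleWithQV μ 𝓕 c N) (hT : 0 < T) (hc : 0 ≤ c)
    (h0 : ∀ᵐ ω ∂μ, N ⟨0, left_mem_Icc.2 hT.le⟩ ω = 0) {a : ℝ} (ha : 0 < a) (hca : c * T ≤ a ^ 2) :
    eLpNorm (contPath N h.continuous) 1 μ ≤ ENNReal.ofReal (2 * a) := by
  have hm : Measurable (contPath N h.continuous) := measurable_of_eval fun t => h.measurable t
  rw [eLpNorm_one_path, lintegral_eq_lintegral_meas_lt μ (ae_of_all _ fun _ => norm_nonneg _)
    hm.norm.aemeasurable, ← Ioc_union_Ioi_eq_Ioi ha.le,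
    lintegral_union measurableSet_Ioi
      (Set.disjoint_left.2 fun x hx hx' => not_lt.2 hx.2 hx')]
  have h1 : ∫⁻ x in Ioc 0 a, μ {ω | x < ‖contPath N h.continuous ω‖} ≤ ENNReal.ofReal a := by
    calc _ ≤ ∫⁻ _ in Ioc 0 a, (1 : ℝ≥0∞) := lintegral_mono fun x => prob_le_one
      _ = _ := by simp
  have h2 : ∫⁻ x in Ioi a, μ {ω | x < ‖contPath N h.continuous ω‖} ≤ ENNReal.ofReal a := by
    calc _ ≤ ∫⁻ x in Ioi a, ENNReal.ofReal (c * T * x ^ (-2 : ℝ)) := by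
          refine setLIntegral_mono' measurableSet_Ioi fun x hx => ?_
          have hx0 : 0 < x := ha.trans hx
          refine (h.measure_norm_le hT hc h0 hx0).trans_eq ?_
          rw [Real.rpow_neg hx0.le, div_eq_mul_inv]
          norm_cast
      _ = ENNReal.ofReal (∫ x in Ioi a, c * T * x ^ (-2 : ℝ)) := by
          refine (ofReal_integral_eq_lintegral_ofReal
            ((integrableOn_Ioi_rpow_of_lt (by norm_num) ha).const_mul _) ?_).symm
          refine (ae_restrict_mem measurableSet_Ioi).mono fun x hx => ?_
          have hx0 : 0 < x := ha.trans hx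
          positivity
      _ ≤ _ := by
          refine ENNReal.ofReal_le_ofReal ?_
          rw [integral_const_mul, integral_Ioi_rpow_of_lt (by norm_num) ha]
          norm_num
          rw [Real.rpow_neg ha.le, Real.rpow_one, ← div_eq_mul_inv, div_le_iff₀ ha]
          nlinarith
  calc _ ≤ ENNReal.ofReal a + ENNReal.ofReal a := add_le_add h1 h2
    _ = _ := by rw [← ENNReal.ofReal_add ha.le ha.le]; congr 1; ring

end IsMartingaleWithQV

end Doob

/-! ### Density of test functions, and measurability of pairings. -/

section Approximation

theorem exists_schwartz_near {f : ℝ → ℝ} (hf : MemLp f 2 volume) {η : ℝ} (hη : 0 < η) :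
    ∃ u : 𝓢(ℝ, ℝ), HasL2Bound volume (fun x => u x - f x) η := by
  have hd := SchwartzMap.denseRange_toLpCLM (E := ℝ) (F := ℝ) (p := 2) (μ := volume)
    ENNReal.ofNat_ne_top
  obtain ⟨u, hu⟩ := hd.exists_dist_lt (hf.toLp f) hη
  refine ⟨u, ?_, hη.le, ?_⟩
  · exact (u.continuous.aestronglyMeasurable).sub hf.1
  · rw [dist_comm, SchwartzMap.toLpCLM_apply, Lp.dist_def] at hu
    have h1 : eLpNorm (fun x => u x - f x) 2 volume =
        eLpNorm (⇑(u.toLp 2 volume) - ⇑(hf.toLp f)) 2 volume :=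
      eLpNorm_congr_ae ((SchwartzMap.coeFn_toLp u 2 volume).symm.sub hf.coeFn_toLp.symm)
    rw [h1]
    refine (ENNReal.le_ofReal_iff_toReal_le ?_ hη.le).2 hu.le
    exact ((Lp.memLp _).sub (Lp.memLp _)).eLpNorm_ne_top

end Approximation

/-- A pairing is an almost sure limit, along a subsequence, of evaluations on test functions. It is
thus measurable for any σ-algebra containing these, up to a null set. -/
theorem Pairs.aestronglyMeasurable_of_le {Ω : Type*} {m m₀ : MeasurableSpace Ω}
    {μ : Measure[m₀] Ω} {χ : ℝ} {W : Ω → Distr} {f : ℝ → ℝ} {X : Ω → ℝ}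
    (h : Pairs μ W f X) (hW : IsWhiteNoise μ χ W) (hm : ∀ u, Measurable[m] fun ω => W ω u) : AEStronglyMeasurable[m] X μ := by
  obtain ⟨-, u, -, h2⟩ := h.isPairing
  have h3 := tendstoInMeasure_of_tendsto_eLpNorm (p := 2) (by norm_num)
    (fun n => ((hW.measurable (u n)).aestronglyMeasurable)) h.aesm h2
  obtain ⟨ns, -, hns⟩ := h3.exists_seq_tendsto_ae
  refine ⟨fun ω => limsup (fun i => W ω (u (ns i))) atTop,
    (Measurable.limsup fun i => hm (u (ns i))).stronglyMeasurable, ?_⟩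
  filter_upwards [hns] with ω hω
  exact hω.limsup_eq.symm

/-! ### Jointly measurable and continuous versions. -/

section Versions

variable {Ω : Type*} [MeasurableSpace Ω] {μ : Measure Ω} {χ : ℝ}

/-- One sequence of test functions, with errors `2⁻ⁿ`, serves all times, because the law of the
noise is the same at each of them. Summability gives almost sure convergence for every `t`, and the
`limsup` is a version given by a single formula, hence measurable in `(t, ω)`. -/
theorem exists_pairs_version [IsProbabilityMeasure μ] {W : ℝ → Ω → Distr}
    (hW : ∀ t, IsWhiteNoise μ χ (W t)) (hχ : 0 ≤ χ)
    (hm : ∀ u, Measurable fun p : ℝ × Ω => W p.1 p.2 u) {f : ℝ → ℝ} (hf : MemLp f 2 volume) :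
    ∃ X : ℝ → Ω → ℝ, Measurable (Function.uncurry X) ∧ ∀ t, Pairs μ (W t) f (X t) := by
  choose u hu using fun n : ℕ => exists_schwartz_near hf (η := (1 / 2) ^ n) (by positivity)
  have hXm : Measurable fun p : ℝ × Ω => limsup (fun n => W p.1 p.2 (u n)) atTop :=
    Measurable.limsup (f := fun n (p : ℝ × Ω) => W p.1 p.2 (u n)) fun n => hm (u n)
  refine ⟨fun t ω => limsup (fun n => W t ω (u n)) atTop, hXm, fun t => ?_⟩
  -- The distances are at most `2√χ 2⁻ᴺ`; the larger constant makes the inequality strict, also for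
  -- `χ = 0`.
  let B : ℕ → ℝ≥0∞ := fun N => ENNReal.ofReal ((√χ + 1) * 3 * (1 / 2) ^ N)
  have hB : ∑' N, B N ≠ ∞ := by
    have hs : Summable fun N : ℕ => (√χ + 1) * 3 * (1 / 2 : ℝ) ^ N :=
      (summable_geometric_of_lt_one (by norm_num) (by norm_num)).mul_left _
    rw [← ENNReal.ofReal_tsum_of_nonneg (fun n => by positivity) hs]
    exact ENNReal.ofReal_ne_top
  have hae : ∀ n, AEStronglyMeasurable (fun ω => W t ω (u n)) μ := fun n =>
    ((hW t).measurable _).aestronglyMeasurable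
  have hc : ∀ N n m : ℕ, N ≤ n → N ≤ m →
      eLpNorm ((fun ω => W t ω (u n)) - fun ω => W t ω (u m)) 2 μ < B N := by
    intro N n m hn hm'
    have h1 : HasL2Bound volume (fun x => u n x - u m x) ((1 / 2) ^ n + (1 / 2) ^ m) := by
      refine ((hu n).sub (hu m)).congr (ae_of_all _ fun x => ?_)
      ring
    have h2 := ((Pairs.of_schwartz (hW t) (u n)).sub (Pairs.of_schwartz (hW t) (u m))).hasL2Bound'
      (hW t) hχ h1
    refine h2.le.trans_lt ?_
    have h3 : (1 / 2 : ℝ) ^ n ≤ (1 / 2) ^ N := pow_le_pow_of_le_one (by norm_num) (by norm_num) hn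
    have h4 : (1 / 2 : ℝ) ^ m ≤ (1 / 2) ^ N := pow_le_pow_of_le_one (by norm_num) (by norm_num) hm'
    have h5 : (0 : ℝ) < (1 / 2) ^ N := by positivity
    refine (ENNReal.ofReal_lt_ofReal_iff (by positivity)).2 ?_
    have h6 := Real.sqrt_nonneg χ
    nlinarith [mul_nonneg h6 h5.le, mul_le_mul_of_nonneg_left (add_le_add h3 h4) h6]
  have hlim : ∀ᵐ ω ∂μ, Tendsto (fun n => W t ω (u n)) atTop
      (𝓝 (limsup (fun n => W t ω (u n)) atTop)) := by
    filter_upwards [Lp.ae_tendsto_of_cauchy_eLpNorm hae (by norm_num) hB hc] with ω ⟨l, hl⟩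
    rwa [hl.limsup_eq]
  have ht := Lp.cauchy_tendsto_of_tendsto hae _ hB hc hlim
  have hX : AEStronglyMeasurable (fun ω => limsup (fun n => W t ω (u n)) atTop) μ :=
    (Measurable.limsup fun n => (hW t).measurable (u n)).aestronglyMeasurable
  refine Pairs.of_isPairing (hW t) hf ⟨hX, u, ?_, ht⟩
  exact HasL2Bound.tendsto_eLpNorm hu
    (tendsto_pow_atTop_nhds_zero_of_lt_one (by norm_num) (by norm_num))

theorem orientedIndicator_sub {x y : ℝ} (hxy : x ≤ y) (z : ℝ) :
    orientedIndicator y z - orientedIndicator x z = (Ioc x y).indicator (fun _ => 1) z := by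
  simp only [orientedIndicator, indicator, mem_Ioc]
  split_ifs <;> first | (norm_num; done) | (exfalso; grind)

theorem orientedIndicator_zero (z : ℝ) : orientedIndicator 0 z = 0 := by
  simp [orientedIndicator]

theorem memLp_indicator_Ioc (x y : ℝ) (p : ℝ≥0∞) :
    MemLp ((Ioc x y).indicator fun _ => (1 : ℝ)) p volume :=
  memLp_indicator_const p measurableSet_Ioc 1 (Or.inr measure_Ioc_lt_top.ne)

theorem memLp_orientedIndicator (x : ℝ) (p : ℝ≥0∞) : MemLp (orientedIndicator x) p volume :=
  (memLp_indicator_Ioc 0 x p).sub (memLp_indicator_Ioc x 0 p)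

theorem integral_orientedIndicator_sub_sq {x y : ℝ} (hxy : x ≤ y) :
    ∫ z, (orientedIndicator y z - orientedIndicator x z) ^ 2 = y - x := by
  have h : (fun z => (orientedIndicator y z - orientedIndicator x z) ^ 2) =
      (Ioc x y).indicator fun _ => 1 := by
    funext z
    rw [orientedIndicator_sub hxy]
    by_cases hz : z ∈ Ioc x y <;> simp [hz]
  rw [h, integral_indicator measurableSet_Ioc]
  simp [hxy]

/-- The floor takes countably many values, so joint measurability in the space variable reduces to
that of each `b · q`. -/
theorem measurable_dyadicFloor_comp {b : ℝ → ℝ → Ω → ℝ}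
    (hb : ∀ q, Measurable (Function.uncurry fun t => b t q)) (n : ℕ) :
    Measurable fun p : ℝ × ℝ × Ω => b p.1 (dyadicFloor n p.2.1) p.2.2 := by
  have h1 : Measurable fun p : ℤ × (ℝ × Ω) => b p.2.1 ((p.1 : ℝ) / 2 ^ n) p.2.2 :=
    measurable_from_prod_countable_right fun k => hb ((k : ℝ) / 2 ^ n)
  have h2 : Measurable fun p : ℝ × ℝ × Ω => (⌊2 ^ n * p.2.1⌋, (p.1, p.2.2)) :=
    (Int.measurable_floor.comp (measurable_snd.fst.const_mul _)).prodMk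
      (measurable_fst.prodMk measurable_snd.snd)
  exact h1.comp h2

/-- The fourth moment of an increment is `3χ²(y - x)²`, so chaining gives a continuous limit along
dyadic points at each time. Writing it as a `limsup` keeps measurability in all variables. At fixed
`x` it is also the L² limit, so it is still a pairing with the indicator. -/
theorem exists_brownian_version [IsProbabilityMeasure μ] {W : ℝ → Ω → Distr}
    (hW : ∀ t, IsWhiteNoise μ χ (W t)) (hχ : 0 ≤ χ)
    (hm : ∀ u, Measurable fun p : ℝ × Ω => W p.1 p.2 u) :
    ∃ B : ℝ → ℝ → Ω → ℝ, Measurable (fun p : ℝ × ℝ × Ω => B p.1 p.2.1 p.2.2) ∧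
      (∀ t x, Pairs μ (W t) (orientedIndicator x) (B t x)) ∧
      ∀ t, ∀ᵐ ω ∂μ, Continuous fun x => B t x ω := by
  choose b hbm hbp using fun q : ℝ => exists_pairs_version hW hχ hm (memLp_orientedIndicator q 2)
  have hsub : ∀ t {x y : ℝ}, x ≤ y → Pairs μ (W t)
      (fun z => orientedIndicator y z - orientedIndicator x z) (fun ω => b y t ω - b x t ω) :=
    fun t x y _ => (hbp y t).sub (hbp x t)
  have hex : ∀ t, ∀ᵐ ω ∂μ, ∃ L : ℝ → ℝ, Continuous L ∧
      ∀ x, Tendsto (fun n => b (dyadicFloor n x) t ω) atTop (𝓝 (L x)) := by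
    intro t
    refine ae_exists_continuous_limit (b := fun x => b x t) (C := 3 * χ ^ 2) (by positivity)
      (fun x => (hbp x t).aesm.aemeasurable) fun x y hxy => ?_
    rw [← ofReal_integral_eq_lintegral_ofReal (Pairs.integrable_pow_four (hW t) (hsub t hxy))
      (ae_of_all _ fun ω => by positivity), Pairs.integral_pow_four (hW t) hχ (hsub t hxy),
      integral_orientedIndicator_sub_sq hxy]
    exact ENNReal.ofReal_le_ofReal (by ring_nf; rfl)
  have hBm : Measurable fun p : ℝ × ℝ × Ω =>
      limsup (fun n => b (dyadicFloor n p.2.1) p.1 p.2.2) atTop :=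
    Measurable.limsup (f := fun n (p : ℝ × ℝ × Ω) => b (dyadicFloor n p.2.1) p.1 p.2.2)
      fun n => measurable_dyadicFloor_comp (b := fun t q => b q t) hbm n
  refine ⟨fun t x ω => limsup (fun n => b (dyadicFloor n x) t ω) atTop,
    hBm, fun t x => ?_, fun t => ?_⟩
  · have hlim : ∀ᵐ ω ∂μ, Tendsto (fun n => b (dyadicFloor n x) t ω) atTop
        (𝓝 (limsup (fun n => b (dyadicFloor n x) t ω) atTop)) := by
      filter_upwards [hex t] with ω ⟨L, _, hL⟩
      have := hL x
      rwa [this.limsup_eq]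
    have h1 : ∀ n, HasL2Bound μ (fun ω => b (dyadicFloor n x) t ω - b x t ω)
        √(χ * (x - dyadicFloor n x)) := by
      intro n
      refine (((hsub t (dyadicFloor_le n x)).hasL2Bound (hW t) hχ
        (integral_orientedIndicator_sub_sq (dyadicFloor_le n x)).le).neg).congr
        (ae_of_all _ fun ω => ?_)
      simp
    have h2 : Tendsto (fun n => √(χ * (x - dyadicFloor n x))) atTop (𝓝 0) := by
      have h := ((tendsto_dyadicFloor x).const_sub x).const_mul χ
      rw [sub_self, mul_zero] at h
      simpa using h.sqrt
    have h3 := tendstoInMeasure_of_tendsto_eLpNorm (p := 2) (by norm_num)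
      (fun n => (hbp (dyadicFloor n x) t).aesm) (hbp x t).aesm (HasL2Bound.tendsto_eLpNorm h1 h2)
    have h4 := tendstoInMeasure_of_tendsto_ae (fun n => (hbp (dyadicFloor n x) t).aesm) hlim
    exact (hbp x t).congr ae_eq_rfl (tendstoInMeasure_ae_unique h3 h4)
  · filter_upwards [hex t] with ω ⟨L, hLc, hL⟩
    have : (fun x => limsup (fun n => b (dyadicFloor n x) t ω) atTop) = L :=
      funext fun x => (hL x).limsup_eq
    rw [this]
    exact hLc

end Versions

/-! ### Derivatives of the cutoffs and approximation of primitives. -/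

section TestFunctions

theorem grad_apply (u : 𝓢(ℝ, ℝ)) (x : ℝ) : grad u x = deriv u x := SchwartzMap.derivCLM_apply _ u x

theorem grad_eq_of_hasDerivAt {u : 𝓢(ℝ, ℝ)} {x d : ℝ} (h : HasDerivAt u d x) : grad u x = d := by
  rw [grad_apply, h.deriv]

theorem grad_add (u v : 𝓢(ℝ, ℝ)) : grad (u + v) = grad u + grad v := map_add _ u v

theorem grad_sub (u v : 𝓢(ℝ, ℝ)) : grad (u - v) = grad u - grad v := map_sub _ u v

theorem grad_smul (k : ℝ) (u : 𝓢(ℝ, ℝ)) : grad (k • u) = k • grad u := map_smul _ k u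

theorem lap_sub (u v : 𝓢(ℝ, ℝ)) : lap (u - v) = lap u - lap v := by
  simp only [lap, grad_sub]

theorem sqrt_sqNorm_le {u : 𝓢(ℝ, ℝ)} {c : ℝ} (h : HasL2Bound volume u c) : √(sqNorm u) ≤ c :=
  Real.sqrt_le_iff.2 ⟨h.nonneg, h.integral_sq_le⟩

theorem sqNorm_smul (k : ℝ) (u : 𝓢(ℝ, ℝ)) : sqNorm (k • u) = k ^ 2 * sqNorm u := by
  unfold sqNorm
  rw [← integral_const_mul]
  refine integral_congr_ae (ae_of_all _ fun x => ?_)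
  simp only [smul_apply, smul_eq_mul]
  ring

theorem sqrt_sqNorm_smul (k : ℝ) (u : 𝓢(ℝ, ℝ)) : √(sqNorm (k • u)) = |k| * √(sqNorm u) := by
  rw [sqNorm_smul, Real.sqrt_mul (sq_nonneg k), Real.sqrt_sq_eq_abs]

theorem sqrt_sqNorm_sub_le (u v w : 𝓢(ℝ, ℝ)) :
    √(sqNorm (u - v)) ≤ √(sqNorm (u - w)) + √(sqNorm (v - w)) := by
  refine sqrt_sqNorm_le ?_
  refine ((SchwartzMap.hasL2Bound (u - w)).sub (SchwartzMap.hasL2Bound (v - w))).congr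
    (ae_of_all _ fun x => ?_)
  simp

theorem hasDerivAt_schwartz (u : 𝓢(ℝ, ℝ)) (x : ℝ) : HasDerivAt u (grad u x) x := by
  rw [grad_apply]
  exact u.differentiableAt.hasDerivAt

theorem integral_Iic_grad (u : 𝓢(ℝ, ℝ)) (x : ℝ) : ∫ y in Iic x, grad u y = u x := by
  have h := integral_Iic_of_hasDerivAt_of_tendsto' (a := x) (fun y _ => hasDerivAt_schwartz u y)
    (grad u).integrable.integrableOn ((u.tendsto_cocompact).mono_left atBot_le_cocompact)
  simpa using h

theorem mean_grad (u : 𝓢(ℝ, ℝ)) : mean (grad u) = 0 := integral_grad u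

theorem correctedPrimitive_apply (u : 𝓢(ℝ, ℝ)) (x : ℝ) :
    correctedPrimitive u x = (∫ y in Iic x, u y) - mean u * logistic x := rfl

theorem correctedPrimitive_grad (u : 𝓢(ℝ, ℝ)) : correctedPrimitive (grad u) = u := by
  ext x
  rw [correctedPrimitive_apply, integral_Iic_grad, mean_grad, zero_mul, sub_zero]

theorem dlogistic_apply (x : ℝ) : dlogistic x = logistic x * (1 - logistic x) := rfl

theorem hasDerivAt_logistic (x : ℝ) : HasDerivAt logistic (dlogistic x) x :=
  Real.hasDerivAt_sigmoid x

theorem integral_Iic_dlogistic (x : ℝ) : ∫ y in Iic x, dlogistic y = logistic x := by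
  have h := integral_Iic_of_hasDerivAt_of_tendsto' (a := x) (fun y _ => hasDerivAt_logistic y)
    dlogistic.integrable.integrableOn Real.tendsto_sigmoid_atBot
  simpa using h

theorem mean_dlogistic : mean dlogistic = 1 := by
  have h := integral_of_hasDerivAt_of_tendsto (fun y => hasDerivAt_logistic y)
    dlogistic.integrable Real.tendsto_sigmoid_atBot Real.tendsto_sigmoid_atTop
  simpa [mean] using h

theorem correctedPrimitive_dlogistic : correctedPrimitive dlogistic = 0 := by
  ext x
  rw [correctedPrimitive_apply, integral_Iic_dlogistic, mean_dlogistic]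
  simp

theorem grad_correctedPrimitive (u : 𝓢(ℝ, ℝ)) :
    grad (correctedPrimitive u) = u - mean u • dlogistic := by
  ext x
  refine grad_eq_of_hasDerivAt ?_
  have hs : ∀ x, ∫ y in Iic x, u y = (∫ y in Iic 0, u y) + ∫ y in (0 : ℝ)..x, u y := by
    intro x
    rw [← intervalIntegral.integral_Iic_sub_Iic u.integrable.integrableOn
      u.integrable.integrableOn]
    ring
  have h1 : HasDerivAt (fun x => ∫ y in Iic x, u y) (u x) x := by
    rw [funext hs]
    exact (u.continuous.integral_hasStrictDerivAt 0 x).hasDerivAt.const_add _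
  exact h1.sub ((hasDerivAt_logistic x).const_mul (mean u))

theorem theta_zero : theta 0 = 1 := theta_eq_one le_rfl

theorem exists_theta_bound : ∃ K : ℝ, 0 ≤ K ∧
    (∀ y, |deriv theta y| ≤ (Icc (0 : ℝ) 1).indicator (fun _ => K) y) ∧
    (∀ y, |deriv (deriv theta) y| ≤ (Icc (0 : ℝ) 1).indicator (fun _ => K) y) ∧
    ∀ y, |theta y - 1| ≤ K * |y| := by
  have hc1 : Continuous (deriv theta) := ((contDiff_infty_iff_deriv.1 theta_contDiff).2).continuous
  have hc2 : Continuous (deriv (deriv theta)) :=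
    ((contDiff_infty_iff_deriv.1 (contDiff_infty_iff_deriv.1 theta_contDiff).2).2).continuous
  have hs1 : tsupport (deriv theta) ⊆ Icc 0 1 := by
    refine closure_minimal (fun y hy => bump_support fun h => hy ?_) isClosed_Icc
    rw [(hasDerivAt_theta y).deriv, h]
    simp
  obtain ⟨K1, hK1⟩ := isCompact_Icc.exists_bound_of_continuousOn (s := Icc (0 : ℝ) 1)
    hc1.continuousOn
  obtain ⟨K2, hK2⟩ := isCompact_Icc.exists_bound_of_continuousOn (s := Icc (0 : ℝ) 1)
    hc2.continuousOn
  have hK0 : 0 ≤ max K1 K2 :=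
    ((norm_nonneg _).trans (hK1 0 ⟨le_rfl, zero_le_one⟩)).trans (le_max_left _ _)
  have hb1 : ∀ y, |deriv theta y| ≤ (Icc (0 : ℝ) 1).indicator (fun _ => max K1 K2) y := by
    intro y
    by_cases hy : y ∈ Icc (0 : ℝ) 1
    · rw [indicator_of_mem hy]
      exact (hK1 y hy).trans (le_max_left _ _)
    · rw [indicator_of_notMem hy, image_eq_zero_of_notMem_tsupport fun h => hy (hs1 h), abs_zero]
  refine ⟨max K1 K2, hK0, hb1, fun y => ?_, fun y => ?_⟩
  · by_cases hy : y ∈ Icc (0 : ℝ) 1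
    · rw [indicator_of_mem hy]
      exact (hK2 y hy).trans (le_max_right _ _)
    · have : deriv (deriv theta) y = 0 := by
        by_contra h
        exact hy (hs1 (support_deriv_subset h))
      rw [indicator_of_notMem hy, this, abs_zero]
  · have h := Convex.norm_image_sub_le_of_norm_deriv_le (f := theta) (C := max K1 K2) (s := univ)
      (fun x _ => (hasDerivAt_theta x).differentiableAt)
      (fun x _ => (hb1 x).trans (indicator_le_self' (fun _ _ => hK0) x)) convex_univ
      (mem_univ 0) (mem_univ y)
    simpa [theta_zero] using h

theorem hasDerivAt_comp_div {f : ℝ → ℝ} (hf : Differentiable ℝ f) (M x : ℝ) :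
    HasDerivAt (fun x => f (x / M)) (deriv f (x / M) * (1 / M)) x :=
  HasDerivAt.comp (h := fun x : ℝ => x / M) x (hf (x / M)).hasDerivAt
    ((hasDerivAt_id' x).div_const _)

theorem differentiable_theta : Differentiable ℝ theta :=
  fun x => (hasDerivAt_theta x).differentiableAt

theorem differentiable_deriv_theta : Differentiable ℝ (deriv theta) :=
  ((contDiff_infty_iff_deriv.1 (contDiff_infty_iff_deriv.1 theta_contDiff).2).1)

theorem grad_logisticCutoff (M : ℕ+) (x : ℝ) : grad (logisticCutoff M) x =
    dlogistic x * theta (x / M) + logistic x * (deriv theta (x / M) * (1 / M)) :=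
  grad_eq_of_hasDerivAt ((hasDerivAt_logistic x).mul (hasDerivAt_comp_div differentiable_theta M x))

theorem lap_logisticCutoff (M : ℕ+) (x : ℝ) : lap (logisticCutoff M) x =
    grad dlogistic x * theta (x / M) + dlogistic x * (deriv theta (x / M) * (1 / M)) +
    (dlogistic x * (deriv theta (x / M) * (1 / M)) +
      logistic x * (deriv (deriv theta) (x / M) * (1 / M) * (1 / M))) := by
  refine grad_eq_of_hasDerivAt ?_
  rw [funext (grad_logisticCutoff M)]
  exact ((hasDerivAt_schwartz dlogistic x).mul (hasDerivAt_comp_div differentiable_theta M x)).add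
    ((hasDerivAt_logistic x).mul
      ((hasDerivAt_comp_div differentiable_deriv_theta M x).mul_const _))

/-- A function of size `K/M` on `[0, M]`, zero elsewhere, has squared norm at most `K²/M`. -/
theorem hasL2Bound_of_abs_le_indicator {f : ℝ → ℝ} (hf : Continuous f) {M : ℕ+} {K : ℝ} (hK : 0 ≤ K)
    (h : ∀ x, |f x| ≤ (Icc (0 : ℝ) 1).indicator (fun _ => K) (x / M) * (1 / M)) :
    HasL2Bound volume f (K * (1 / √M)) := by
  have hM : (0 : ℝ) < M := by exact_mod_cast M.pos
  have e : K * (1 / √M) = √(K ^ 2 * (1 / M)) := by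
    rw [Real.sqrt_mul (sq_nonneg K), Real.sqrt_sq hK, Real.sqrt_div zero_le_one, Real.sqrt_one]
  rw [e]
  refine HasL2Bound.of_lintegral_le hf.aestronglyMeasurable ?_
  calc ∫⁻ x, ENNReal.ofReal (f x ^ 2)
      ≤ ∫⁻ x, (Icc (0 : ℝ) M).indicator (fun _ => ENNReal.ofReal ((K * (1 / M)) ^ 2)) x := by
        refine lintegral_mono fun x => ?_
        have hx := h x
        by_cases hxM : x ∈ Icc (0 : ℝ) M
        · rw [indicator_of_mem hxM]
          have : x / M ∈ Icc (0 : ℝ) 1 := ⟨div_nonneg hxM.1 hM.le, (div_le_one hM).2 hxM.2⟩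
          rw [indicator_of_mem this] at hx
          exact ENNReal.ofReal_le_ofReal (sq_le_sq' (abs_le.1 hx).1 (abs_le.1 hx).2)
        · rw [indicator_of_notMem hxM]
          have : x / M ∉ Icc (0 : ℝ) 1 := fun h' => hxM
            ⟨by have := mul_nonneg h'.1 hM.le; rwa [div_mul_cancel₀ _ hM.ne'] at this,
              (div_le_one hM).1 h'.2⟩
          rw [indicator_of_notMem this, zero_mul] at hx
          rw [abs_eq_zero.1 (le_antisymm hx (abs_nonneg _))]
          simp
    _ = ENNReal.ofReal ((K * (1 / M)) ^ 2) * ENNReal.ofReal M := by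
        rw [lintegral_indicator_const measurableSet_Icc, Real.volume_Icc, sub_zero]
    _ ≤ ENNReal.ofReal (K ^ 2 * (1 / M)) := by
        rw [← ENNReal.ofReal_mul (by positivity)]
        refine ENNReal.ofReal_le_ofReal (le_of_eq ?_)
        field_simp

/-- Since `|θ(x/M) - 1| ≤ K|x|/M`, the decay of `g` absorbs the factor `|x|`. The rate `1/M` is
weakened to `1/√M` to match the other error terms. -/
theorem hasL2Bound_theta_sub_one (g : 𝓢(ℝ, ℝ)) {K : ℝ} (hK0 : 0 ≤ K)
    (hK : ∀ y, |theta y - 1| ≤ K * |y|) :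
    ∃ C, 0 ≤ C ∧
      ∀ M : ℕ+, HasL2Bound volume (fun x => g x * (theta (x / M) - 1)) (C * (1 / √M)) := by
  let xg : 𝓢(ℝ, ℝ) := SchwartzMap.smulLeftCLM ℝ (fun x : ℝ => x) g
  have hxg : ∀ x, xg x = x * g x := fun x => by
    simp only [xg]
    rw [SchwartzMap.smulLeftCLM_apply_apply (Function.HasTemperateGrowth.id' (E := ℝ)), smul_eq_mul]
  refine ⟨K * √(sqNorm xg), by positivity, fun M => ?_⟩
  have hM : (1 : ℝ) ≤ M := by exact_mod_cast M.pos
  have hM0 : (0 : ℝ) < M := by linarith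
  have h1 := (SchwartzMap.hasL2Bound xg).const_mul (K * (1 / M))
  have hcont : Continuous fun x => g x * (theta (x / M) - 1) := g.continuous.mul
    ((theta_contDiff.continuous.comp (continuous_id.div_const _)).sub continuous_const)
  have h2 : HasL2Bound volume (fun x => g x * (theta (x / M) - 1))
      (|K * (1 / M)| * √(sqNorm xg)) := by
    refine ⟨hcont.aestronglyMeasurable, h1.nonneg, le_trans (eLpNorm_mono fun x => ?_) h1.le⟩
    have h3 := hK (x / M)
    rw [abs_div, abs_of_pos hM0] at h3
    rw [hxg, Real.norm_eq_abs, Real.norm_eq_abs, abs_mul, abs_mul (K * _), abs_mul x,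
      abs_of_nonneg (show 0 ≤ K * (1 / (M : ℝ)) by positivity)]
    calc |g x| * |theta (x / M) - 1| ≤ |g x| * (K * (|x| / M)) := by gcongr
      _ = _ := by ring
  refine h2.mono ?_
  rw [abs_of_nonneg (by positivity)]
  have h4 : 1 / (M : ℝ) ≤ 1 / √M := by
    refine one_div_le_one_div_of_le (by positivity) ?_
    rw [Real.sqrt_le_iff]
    exact ⟨hM0.le, by nlinarith⟩
  calc K * (1 / M) * √(sqNorm xg) = K * √(sqNorm xg) * (1 / M) := by ring
    _ ≤ _ := by gcongr

/-- Although `F_M` does not converge in L², its derivatives do. Where the cutoff is not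
differentiated, the factor `F'` or `F''` localises. Where it is, the term has size `1/M` on an
interval of length `M`. -/
theorem exists_cutoff_rate : ∃ e : ℕ+ → ℝ, Tendsto e atTop (𝓝 0) ∧ ∀ M, 0 < e M ∧
    √(sqNorm (grad (logisticCutoff M) - dlogistic)) ≤ e M ∧
    √(sqNorm (lap (logisticCutoff M) - grad dlogistic)) ≤ e M := by
  obtain ⟨K, hK0, hK1, hK2, hK3⟩ := exists_theta_bound
  obtain ⟨C1, hC1, h1⟩ := hasL2Bound_theta_sub_one dlogistic hK0 hK3
  obtain ⟨C2, hC2, h2⟩ := hasL2Bound_theta_sub_one (grad dlogistic) hK0 hK3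
  have hcl : Continuous logistic := continuous_sigmoid
  have hct : ∀ M : ℕ+, Continuous fun x : ℝ => deriv theta (x / M) := fun M =>
    differentiable_deriv_theta.continuous.comp (continuous_id.div_const _)
  have hct2 : ∀ M : ℕ+, Continuous fun x : ℝ => deriv (deriv theta) (x / M) := fun M =>
    (((contDiff_infty_iff_deriv.1 (contDiff_infty_iff_deriv.1 theta_contDiff).2).2).continuous).comp
      (continuous_id.div_const _)
  have hl : ∀ x, |logistic x| ≤ 1 := fun x => by
    rw [logistic_eq_sigmoid, abs_of_nonneg (Real.sigmoid_nonneg x)]; exact Real.sigmoid_le_one x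
  have hd : ∀ x, |dlogistic x| ≤ 1 := fun x => by
    have h0 := Real.sigmoid_nonneg x
    have h1 := Real.sigmoid_le_one x
    have : dlogistic x = Real.sigmoid x * (1 - Real.sigmoid x) := rfl
    rw [this, abs_of_nonneg (mul_nonneg h0 (sub_nonneg.2 h1))]
    nlinarith
  have hM1 : ∀ M : ℕ+, 0 ≤ 1 / (M : ℝ) ∧ 1 / (M : ℝ) ≤ 1 := fun M =>
    have : (1 : ℝ) ≤ M := by exact_mod_cast M.pos
    ⟨by positivity, (div_le_one (by linarith)).2 this⟩
  have b1 : ∀ M : ℕ+, HasL2Bound volume (fun x => logistic x * (deriv theta (x / M) * (1 / M)))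
      (K * (1 / √M)) := fun M => by
    refine hasL2Bound_of_abs_le_indicator (hcl.mul ((hct M).mul continuous_const)) hK0 fun x => ?_
    simp only [Pi.mul_apply]
    rw [abs_mul, abs_mul, abs_of_nonneg (hM1 M).1]
    refine mul_le_of_le_one_left (mul_nonneg (abs_nonneg _) (hM1 M).1) (hl x) |>.trans ?_
    exact mul_le_mul_of_nonneg_right (hK1 _) (hM1 M).1
  have b2 : ∀ M : ℕ+, HasL2Bound volume (fun x => dlogistic x * (deriv theta (x / M) * (1 / M)))
      (K * (1 / √M)) := fun M => by
    refine hasL2Bound_of_abs_le_indicator (dlogistic.continuous.mul ((hct M).mul continuous_const))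
      hK0 fun x => ?_
    simp only [Pi.mul_apply]
    rw [abs_mul, abs_mul, abs_of_nonneg (hM1 M).1]
    refine mul_le_of_le_one_left (mul_nonneg (abs_nonneg _) (hM1 M).1) (hd x) |>.trans ?_
    exact mul_le_mul_of_nonneg_right (hK1 _) (hM1 M).1
  have b3 : ∀ M : ℕ+, HasL2Bound volume
      (fun x => logistic x * (deriv (deriv theta) (x / M) * (1 / M) * (1 / M)))
      (K * (1 / √M)) := fun M => by
    refine hasL2Bound_of_abs_le_indicator
      (hcl.mul (((hct2 M).mul continuous_const).mul continuous_const)) hK0 fun x => ?_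
    simp only [Pi.mul_apply]
    rw [abs_mul, abs_mul, abs_mul, abs_of_nonneg (hM1 M).1]
    have hp := mul_nonneg (abs_nonneg (deriv (deriv theta) (x / M))) (hM1 M).1
    refine mul_le_of_le_one_left (mul_nonneg hp (hM1 M).1) (hl x) |>.trans ?_
    refine mul_le_of_le_one_right hp (hM1 M).2 |>.trans ?_
    exact mul_le_mul_of_nonneg_right (hK2 _) (hM1 M).1
  -- The extra `1` makes the rate strictly positive, as the estimates that use it require.
  refine ⟨fun M => (C1 + C2 + 3 * K + 1) * (1 / √M), ?_, fun M => ⟨?_, ?_, ?_⟩⟩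
  · have hc : Tendsto (fun M : ℕ+ => ((M : ℕ) : ℝ)) atTop atTop :=
      tendsto_natCast_atTop_atTop.comp tendsto_PNat_val_atTop_atTop
    have h := (tendsto_const_nhds (x := (1 : ℝ))).div_atTop (Real.tendsto_sqrt_atTop.comp hc)
    simpa using h.const_mul (C1 + C2 + 3 * K + 1)
  · have : (0 : ℝ) < M := by exact_mod_cast M.pos
    positivity
  · refine (sqrt_sqNorm_le (((h1 M).add (b1 M)).congr (ae_of_all _ fun x => ?_))).trans ?_
    · simp only [sub_apply, grad_logisticCutoff]
      ring
    · have : (0 : ℝ) ≤ 1 / √M := by positivity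
      nlinarith [mul_nonneg hC2 this, mul_nonneg hK0 this]
  · refine (sqrt_sqNorm_le (((h2 M).add ((b2 M).add ((b2 M).add (b3 M)))).congr
      (ae_of_all _ fun x => ?_))).trans ?_
    · simp only [sub_apply, lap_logisticCutoff]
      ring
    · have : (0 : ℝ) ≤ 1 / √M := by positivity
      nlinarith [mul_nonneg hC1 this, mul_nonneg hK0 this]

/-- The approximation `U - ū F + ū F_M` of the primitive `U` of `u` by test functions. -/
def cutPrimitive (M : ℕ+) (u : 𝓢(ℝ, ℝ)) : 𝓢(ℝ, ℝ) :=
  correctedPrimitive u + mean u • logisticCutoff M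

/-- The cutoffs `F_M` are thus the instance `u = F'` of the general approximation. -/
theorem cutPrimitive_dlogistic (M : ℕ+) : cutPrimitive M dlogistic = logisticCutoff M := by
  rw [cutPrimitive, correctedPrimitive_dlogistic, mean_dlogistic, one_smul, zero_add]

theorem grad_cutPrimitive_sub (M : ℕ+) (u : 𝓢(ℝ, ℝ)) :
    grad (cutPrimitive M u) - u = mean u • (grad (logisticCutoff M) - dlogistic) := by
  rw [cutPrimitive, grad_add, grad_correctedPrimitive, grad_smul, smul_sub]
  abel

theorem lap_cutPrimitive_sub (M : ℕ+) (u : 𝓢(ℝ, ℝ)) :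
    lap (cutPrimitive M u) - grad u = mean u • (lap (logisticCutoff M) - grad dlogistic) := by
  rw [lap, ← grad_sub, grad_cutPrimitive_sub, grad_smul, grad_sub, lap]

theorem exists_cutPrimitive_rate (u : 𝓢(ℝ, ℝ)) : ∃ e : ℕ+ → ℝ, Tendsto e atTop (𝓝 0) ∧ ∀ M, 0 < e M ∧
    √(sqNorm (grad (cutPrimitive M u) - u)) ≤ e M ∧
    √(sqNorm (lap (cutPrimitive M u) - grad u)) ≤ e M := by
  obtain ⟨e, he, h⟩ := exists_cutoff_rate
  refine ⟨fun M => (|mean u| + 1) * e M, by simpa using he.const_mul (|mean u| + 1), fun M => ⟨?_, ?_, ?_⟩⟩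
  · have := (h M).1
    positivity
  · rw [grad_cutPrimitive_sub, sqrt_sqNorm_smul]
    exact mul_le_mul (by linarith) (h M).2.1 (Real.sqrt_nonneg _) (by positivity)
  · rw [lap_cutPrimitive_sub, sqrt_sqNorm_smul]
    exact mul_le_mul (by linarith) (h M).2.2 (Real.sqrt_nonneg _) (by positivity)

/-- The difference `1_{(0, ∞)} - F`. -/
def stepDefect (x : ℝ) : ℝ := (Ioi 0).indicator (fun _ => 1) x - logistic x

/-- On each half-line one of `F`, `1 - F` is at least `1/2`, and the defect is the other one in
absolute value. Hence the defect is square integrable although neither the step nor `F` is. -/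
theorem abs_stepDefect_le (x : ℝ) : |stepDefect x| ≤ 2 * dlogistic x := by
  have h0 := Real.sigmoid_nonneg x
  have h1 := Real.sigmoid_le_one x
  have hz : Real.sigmoid 0 = 1 / 2 := by norm_num [Real.sigmoid]
  rw [dlogistic_apply, stepDefect, logistic_eq_sigmoid]
  by_cases hx : x ∈ Ioi (0 : ℝ)
  · rw [indicator_of_mem hx, abs_of_nonneg (by linarith)]
    have := Real.sigmoid_monotone (le_of_lt hx)
    rw [hz] at this
    nlinarith
  · rw [indicator_of_notMem hx, zero_sub, abs_neg, abs_of_nonneg h0]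
    have := Real.sigmoid_monotone (not_lt.1 hx)
    rw [hz] at this
    nlinarith

theorem measurable_stepDefect : Measurable stepDefect :=
  (measurable_const.indicator measurableSet_Ioi).sub continuous_sigmoid.measurable

theorem memLp_stepDefect (p : ℝ≥0∞) : MemLp stepDefect p volume := by
  refine MemLp.mono ((dlogistic.memLp p volume).const_mul 2)
    measurable_stepDefect.aestronglyMeasurable (ae_of_all _ fun x => ?_)
  rw [Real.norm_eq_abs]
  exact (abs_stepDefect_le x).trans (le_abs_self _)

end TestFunctions

/-! ### L² limits as `ε → 0`. -/

section L2Limit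

variable {Ω : Type*} [MeasurableSpace Ω] {μ : Measure Ω}

theorem HasL2Bound.of_limit {ι : Type*} {l : Filter ι} [l.NeBot] {X : Ω → ℝ} {Z : ι → Ω → ℝ} {c : ℝ}
    (hX : AEStronglyMeasurable X μ) (h : ∀ᶠ i in l, HasL2Bound μ (Z i) c)
    (hZ : Tendsto (fun i => eLpNorm (fun ω => Z i ω - X ω) 2 μ) l (𝓝 0)) : HasL2Bound μ X c := by
  refine ⟨hX, ?_, ?_⟩
  · obtain ⟨i, hi⟩ := h.exists
    exact hi.nonneg
  · have h1 : Tendsto (fun i => ENNReal.ofReal c + eLpNorm (fun ω => Z i ω - X ω) 2 μ) l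
        (𝓝 (ENNReal.ofReal c + 0)) := tendsto_const_nhds.add hZ
    rw [add_zero] at h1
    refine ge_of_tendsto h1 ?_
    filter_upwards [h] with i hi
    have h2 : X = Z i - fun ω => Z i ω - X ω := by
      funext ω
      simp
    calc eLpNorm X 2 μ = eLpNorm (Z i - fun ω => Z i ω - X ω) 2 μ := by rw [← h2]
      _ ≤ eLpNorm (Z i) 2 μ + eLpNorm (fun ω => Z i ω - X ω) 2 μ :=
          eLpNorm_sub_le hi.aesm (hi.aesm.sub hX) (by norm_num)
      _ ≤ _ := by gcongr; exact hi.le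

namespace IsL2Limit

variable {A B : ℝ → Ω → ℝ} {X Y : Ω → ℝ} {c : ℝ}

theorem congr (h : IsL2Limit μ A X) (hAB : ∀ᶠ ε in 𝓝[>] 0, A ε =ᵐ[μ] B ε) : IsL2Limit μ B X := by
  refine ⟨h.1, h.2.congr' ?_⟩
  filter_upwards [hAB] with ε hε
  exact eLpNorm_congr_ae (hε.sub ae_eq_rfl)

theorem sub (hA : IsL2Limit μ A X) (hB : IsL2Limit μ B Y)
    (hAm : ∀ᶠ ε in 𝓝[>] 0, AEStronglyMeasurable (A ε) μ)
    (hBm : ∀ᶠ ε in 𝓝[>] 0, AEStronglyMeasurable (B ε) μ) :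
    IsL2Limit μ (fun ε ω => A ε ω - B ε ω) fun ω => X ω - Y ω := by
  refine ⟨hA.1.sub hB.1, ?_⟩
  have h := hA.2.add hB.2
  rw [add_zero] at h
  refine tendsto_of_tendsto_of_tendsto_of_le_of_le' tendsto_const_nhds h
    (Eventually.of_forall fun _ => zero_le) ?_
  filter_upwards [hAm, hBm] with ε h1 h2
  have e : (fun ω => A ε ω - B ε ω - (X ω - Y ω)) =
      (fun ω => A ε ω - X ω) - fun ω => B ε ω - Y ω := by
    funext ω
    simp only [Pi.sub_apply]
    ring
  rw [e]
  exact eLpNorm_sub_le (h1.sub hA.1.1) (h2.sub hB.1.1) (by norm_num)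

theorem hasL2Bound (h : IsL2Limit μ A X) (hA : ∀ᶠ ε in 𝓝[>] 0, HasL2Bound μ (A ε) c) :
    HasL2Bound μ X c :=
  HasL2Bound.of_limit h.1.1 hA h.2

theorem hasL2Bound_sub (h : IsL2Limit μ A X) (hY : AEStronglyMeasurable Y μ)
    (hA : ∀ᶠ ε in 𝓝[>] 0, HasL2Bound μ (fun ω => Y ω - A ε ω) c) :
    HasL2Bound μ (fun ω => Y ω - X ω) c := by
  refine HasL2Bound.of_limit (hY.sub h.1.1) hA (h.2.congr fun ε => ?_)
  rw [← eLpNorm_neg]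
  congr 1
  funext ω
  simp only [Pi.neg_apply]
  ring

theorem unique (hX : IsL2Limit μ A X) (hY : IsL2Limit μ A Y)
    (hA : ∀ᶠ ε in 𝓝[>] 0, AEStronglyMeasurable (A ε) μ) : X =ᵐ[μ] Y := by
  have h := hX.sub hY hA hA
  refine HasL2Bound.ae_eq_of_sub (h.hasL2Bound ?_)
  filter_upwards [hA] with ε hε
  refine ⟨hε.sub hε, le_rfl, ?_⟩
  simp

end IsL2Limit

end L2Limit

/-! ### The Burgers solution and the increments of its nonlinearity. -/

section Flow

variable {Ω : Type*} [MeasurableSpace Ω] {μ : Measure Ω} {D χ lam T κ : ℝ}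

/-- A stationary energy solution of the Burgers equation, extended to all times by freezing it
outside `[0, T]`, together with the objects attached to it. -/
structure IsBurgersFlow (μ : Measure Ω) (D χ lam T κ : ℝ) (W : ℝ → Ω → Distr)
    (V : ℝ → ℝ → ℝ → Ω → ℝ) (𝓕 : Filtration (Icc (0 : ℝ) T) ‹MeasurableSpace Ω›)
    (A N : 𝓢(ℝ, ℝ) → Icc (0 : ℝ) T → Ω → ℝ) : Prop where
  white : ∀ t, IsWhiteNoise μ χ (W t)
  cont : ∀ ω u, Continuous fun t => W t ω u
  field : ∀ ε > 0, IsField μ ε W (V ε)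
  energy_one : ∀ u s t, 0 ≤ s → s < t → t ≤ T →
    HasL2Bound μ (fun ω => ∫ r in s..t, W r ω (lap u)) √(κ * (t - s) * energy u)
  energy_two : ∀ u s t ε δ, 0 ≤ s → s < t → t ≤ T → 0 < δ → δ < ε → ε < 1 →
    HasL2Bound μ (fun ω => renormQuad χ ε (V ε) s t (grad u) ω -
      renormQuad χ δ (V δ) s t (grad u) ω) √(κ * (t - s) * ε * energy u)
  adapted : ∀ (t : Icc (0 : ℝ) T) u, Measurable[𝓕 t] fun ω => W t ω u
  limit : ∀ u (t : Icc (0 : ℝ) T),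
    IsL2Limit μ (fun ε => renormQuad χ ε (V ε) 0 t (grad u)) (A u t)
  mart : ∀ u, IsMartingaleWithQV μ 𝓕 (2 * χ * D * energy u) (N u)
  formula : ∀ u (t : Icc (0 : ℝ) T), ∀ᵐ ω ∂μ, N u t ω =
    W t ω u - W 0 ω u - D * (∫ s in (0 : ℝ)..t, W s ω (lap u)) - lam * A u t ω

theorem measurable_white {W : ℝ → Ω → Distr} (hW : ∀ t, IsWhiteNoise μ χ (W t))
    (hc : ∀ ω u, Continuous fun t => W t ω u) (u : 𝓢(ℝ, ℝ)) :
    Measurable fun p : ℝ × Ω => W p.1 p.2 u :=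
  measurable_uncurry_of_continuous_of_measurable (u := fun t ω => W t ω u)
    (fun ω => hc ω u) fun t => (hW t).measurable u

theorem hasL2Bound_time_integral {W : ℝ → Ω → Distr} (hχ : 0 ≤ χ) (hW : ∀ t, IsWhiteNoise μ χ (W t))
    (hc : ∀ ω u, Continuous fun t => W t ω u) [IsProbabilityMeasure μ] (u : 𝓢(ℝ, ℝ)) {s t : ℝ} (hst : s ≤ t) :
    HasL2Bound μ (fun ω => ∫ r in s..t, W r ω u) ((t - s) * (√χ * √(sqNorm u))) :=
  hasL2Bound_integral (Φ := fun r ω => W r ω u) hst (measurable_white hW hc u)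
    fun r => (hW r).hasL2Bound hχ u

theorem uIcc_subset_of_mem {s t : ℝ} (hs : 0 ≤ s) (hst : s ≤ t) (ht : t ≤ T) {r : ℝ}
    (hr : r ∈ uIcc s t) : r ∈ Icc (0 : ℝ) T := by
  rw [uIcc_of_le hst] at hr
  exact ⟨hs.trans hr.1, hr.2.trans ht⟩

/-- Composition with the projection onto `[0, T]` gives white noises with continuous evaluations at
all real times, so later statements carry no membership conditions. Energy estimates are only
claimed inside `[0, T]`, where nothing has changed. -/
theorem exists_isBurgersFlow [IsProbabilityMeasure μ] (hχ : 0 < χ) (hT : 0 < T)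
    {Y : ℝ → Ω → Distr} (hY : IsStationaryEnergySolution D χ lam T μ Y) :
    ∃ κ W V 𝓕 A N, 0 < κ ∧ IsBurgersFlow μ D χ lam T κ W V 𝓕 A N ∧ ∀ t ∈ Icc 0 T, W t = Y t := by
  obtain ⟨κ₁, hκ₁, h1⟩ := hY.energy_one
  obtain ⟨V, hV, ⟨κ₂, hκ₂, h2⟩, 𝓕, had, hsol⟩ := hY.nonlinear
  choose A N hA hN hf using hsol
  let π : ℝ → Icc (0 : ℝ) T := projIcc 0 T hT.le
  have hπ : Continuous π := continuous_projIcc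
  have hπv : ∀ {t}, t ∈ Icc (0 : ℝ) T → ((π t : Icc (0 : ℝ) T) : ℝ) = t := fun ht => by
    simp only [π, projIcc_of_mem hT.le ht]
  let W : ℝ → Ω → Distr := fun t => Y (π t)
  let V' : ℝ → ℝ → ℝ → Ω → ℝ := fun ε t => V ε (π t)
  have hWY : ∀ t ∈ Icc 0 T, W t = Y t := fun t ht => by simp only [W, hπv ht]
  have hW : ∀ t, IsWhiteNoise μ χ (W t) := fun t => hY.stationary _ (π t).2
  have hc : ∀ ω u, Continuous fun t => W t ω u := fun ω u => by
    have h := continuousOn_iff_continuous_domRestrict.1 (hY.continuous_paths ω)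
    exact ((continuous_eval_const u).comp h).comp hπ
  have hfield : ∀ ε > 0, IsField μ ε W (V' ε) := fun ε hε => by
    refine ⟨?_, fun r x => Pairs.of_isPairing (hW r) (iEps_memLp ε x 2) ((hV ε hε).2 _ (π r).2 x)⟩
    have : Measurable fun p : ℝ × ℝ × Ω => (π p.1, p.2) :=
      (hπ.measurable.comp measurable_fst).prodMk measurable_snd
    exact (hV ε hε).1.comp this
  have hb : ∀ u ε s t, 0 < ε → 0 ≤ s → s ≤ t → t ≤ T →
      burgersNonlin V ε s t u =ᵐ[μ] renormQuad χ ε (V' ε) s t (grad u) := by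
    intro u ε s t hε hs hst ht
    have e : burgersNonlin V ε s t u = burgersNonlin V' ε s t u := by
      funext ω
      refine intervalIntegral.integral_congr fun r hr => ?_
      simp only [V', hπv (uIcc_subset_of_mem hs hst ht hr)]
    rw [e]
    exact (hfield ε hε).burgersNonlin_ae_eq (𝒱 := V') hW hχ.le hε u s t
  have hJ : ∀ u s t, 0 ≤ s → s ≤ t → t ≤ T → (fun ω => ∫ r in s..t, Y r ω (lap u)) =
      fun ω => ∫ r in s..t, W r ω (lap u) := by
    intro u s t hs hst ht
    funext ω
    refine intervalIntegral.integral_congr fun r hr => ?_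
    simp only [hWY r (uIcc_subset_of_mem hs hst ht hr)]
  have hquad : ∀ u ε s t, 0 < ε → s ≤ t →
      AEStronglyMeasurable (renormQuad χ ε (V' ε) s t (grad u)) μ := fun u ε s t hε hst =>
    ((hfield ε hε).hasL2Bound_quad hW hχ.le hε (grad u) hst).aesm
  refine ⟨max κ₁ κ₂, W, V', 𝓕, A, N, lt_max_of_lt_left hκ₁,
    ⟨hW, hc, hfield, ?_, ?_, fun t u => ?_, fun u t => ?_, hN, fun u t => ?_⟩, hWY⟩
  · intro u s t hs hst ht
    have h := HasL2Bound.of_lintegral_le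
      (hasL2Bound_time_integral hχ.le hW hc (lap u) hst.le).aesm
      (by have := h1 u s t hs hst ht; rw [hJ u s t hs hst.le ht] at this; exact this)
    refine h.mono (Real.sqrt_le_sqrt ?_)
    have := sqNorm_nonneg (grad u)
    have h' : 0 ≤ (t - s) * energy u := mul_nonneg (sub_nonneg.2 hst.le) this
    calc κ₁ * (t - s) * energy u = κ₁ * ((t - s) * energy u) := by ring
      _ ≤ max κ₁ κ₂ * ((t - s) * energy u) := by gcongr; exact le_max_left _ _
      _ = _ := by ring
  · intro u s t ε δ hs hst ht hδ hδε hε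
    have hae : (fun ω => burgersNonlin V ε s t u ω - burgersNonlin V δ s t u ω) =ᵐ[μ]
        fun ω => renormQuad χ ε (V' ε) s t (grad u) ω - renormQuad χ δ (V' δ) s t (grad u) ω :=
      (hb u ε s t (hδ.trans hδε) hs hst.le ht).sub (hb u δ s t hδ hs hst.le ht)
    have hm := (hquad u ε s t (hδ.trans hδε) hst.le).sub (hquad u δ s t hδ hst.le)
    have h := (HasL2Bound.of_lintegral_le (hm.congr hae.symm)
      (h2 u s t ε δ hs hst ht hδ hδε hε)).congr hae
    refine h.mono (Real.sqrt_le_sqrt ?_)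
    have := sqNorm_nonneg (grad u)
    have h' : 0 ≤ (t - s) * ε * energy u :=
      mul_nonneg (mul_nonneg (sub_nonneg.2 hst.le) (hδ.trans hδε).le) this
    calc κ₂ * (t - s) * ε * energy u = κ₂ * ((t - s) * ε * energy u) := by ring
      _ ≤ max κ₁ κ₂ * ((t - s) * ε * energy u) := by gcongr; exact le_max_right _ _
      _ = _ := by ring
  · rw [hWY t t.2]
    exact had t u
  · refine (hA u t).congr ?_
    filter_upwards [self_mem_nhdsWithin] with ε hε
    exact hb u ε 0 t hε le_rfl t.2.1 t.2.2
  · filter_upwards [hf u t] with ω hω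
    rw [hω, hWY t t.2, hWY 0 ⟨le_rfl, hT.le⟩]
    have := congrFun (hJ u 0 t le_rfl t.2.1 t.2.2) ω
    rw [this]

namespace IsBurgersFlow

variable {W : ℝ → Ω → Distr} {V : ℝ → ℝ → ℝ → Ω → ℝ}
  {𝓕 : Filtration (Icc (0 : ℝ) T) ‹MeasurableSpace Ω›} {A N : 𝓢(ℝ, ℝ) → Icc (0 : ℝ) T → Ω → ℝ}
  [IsProbabilityMeasure μ]

theorem hasL2Bound_quad (h : IsBurgersFlow μ D χ lam T κ W V 𝓕 A N) (hχ : 0 ≤ χ) {ε : ℝ} (hε : 0 < ε)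
    (g : 𝓢(ℝ, ℝ)) {s t : ℝ} (hst : s ≤ t) :
    HasL2Bound μ (renormQuad χ ε (V ε) s t g) ((t - s) * √(4 * χ ^ 2 / ε * sqNorm g)) :=
  (h.field ε hε).hasL2Bound_quad h.white hχ hε g hst

theorem eventually_aesm_quad (h : IsBurgersFlow μ D χ lam T κ W V 𝓕 A N) (hχ : 0 ≤ χ)
    (g : 𝓢(ℝ, ℝ)) {s t : ℝ} (hst : s ≤ t) :
    ∀ᶠ ε in 𝓝[>] 0, AEStronglyMeasurable (renormQuad χ ε (V ε) s t g) μ := by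
  filter_upwards [self_mem_nhdsWithin] with ε hε
  exact (h.hasL2Bound_quad hχ hε g hst).aesm

/-- The `A u` are chosen separately for each `u`; linearity is recovered from uniqueness of L²
limits. -/
theorem nonlin_sub_ae_eq (h : IsBurgersFlow μ D χ lam T κ W V 𝓕 A N) (hχ : 0 ≤ χ)
    (u v : 𝓢(ℝ, ℝ)) (t : Icc (0 : ℝ) T) : A (u - v) t =ᵐ[μ] fun ω => A u t ω - A v t ω := by
  have h1 := (h.limit u t).sub (h.limit v t) (h.eventually_aesm_quad hχ _ t.2.1)
    (h.eventually_aesm_quad hχ _ t.2.1)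
  refine ((h.limit (u - v) t).congr ?_).unique h1 ?_
  · filter_upwards [self_mem_nhdsWithin] with ε hε
    rw [grad_sub]
    exact (h.field ε hε).quad_sub_ae_eq h.white hχ hε _ _ t.2.1
  · filter_upwards [h.eventually_aesm_quad hχ (grad u) t.2.1,
      h.eventually_aesm_quad hχ (grad v) t.2.1] with ε h1 h2
    exact h1.sub h2

theorem mart_sub_ae_eq (h : IsBurgersFlow μ D χ lam T κ W V 𝓕 A N) (hχ : 0 ≤ χ)
    (u v : 𝓢(ℝ, ℝ)) (t : Icc (0 : ℝ) T) : N (u - v) t =ᵐ[μ] fun ω => N u t ω - N v t ω := by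
  filter_upwards [h.nonlin_sub_ae_eq hχ u v t, h.formula u t, h.formula v t, h.formula (u - v) t]
    with ω h1 h2 h3 h4
  rw [h2, h3, h4, h1, lap_sub]
  simp only [map_sub]
  rw [intervalIntegral.integral_sub ((h.cont ω _).intervalIntegrable _ _)
    ((h.cont ω _).intervalIntegrable _ _)]
  ring

theorem nonlin_zero (h : IsBurgersFlow μ D χ lam T κ W V 𝓕 A N) (hT : 0 ≤ T) (u : 𝓢(ℝ, ℝ)) :
    A u ⟨0, left_mem_Icc.2 hT⟩ =ᵐ[μ] 0 := by
  refine ((h.limit u ⟨0, left_mem_Icc.2 hT⟩).hasL2Bound (c := 0) ?_).ae_eq_zero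
  refine Eventually.of_forall fun ε => ?_
  have : renormQuad χ ε (V ε) 0 (⟨0, left_mem_Icc.2 hT⟩ : Icc (0 : ℝ) T) (grad u) = fun _ => 0 := by
    funext ω
    simp [renormQuad]
  rw [this]
  exact ⟨aestronglyMeasurable_const, le_rfl, by simp⟩

theorem mart_zero (h : IsBurgersFlow μ D χ lam T κ W V 𝓕 A N) (hT : 0 ≤ T) (u : 𝓢(ℝ, ℝ)) :
    ∀ᵐ ω ∂μ, N u ⟨0, left_mem_Icc.2 hT⟩ ω = 0 := by
  filter_upwards [h.nonlin_zero hT u, h.formula u ⟨0, left_mem_Icc.2 hT⟩] with ω h1 h2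
  rw [h2, h1]
  simp

theorem limit_increment (h : IsBurgersFlow μ D χ lam T κ W V 𝓕 A N) (hχ : 0 ≤ χ)
    (u : 𝓢(ℝ, ℝ)) {s t : Icc (0 : ℝ) T} (hst : (s : ℝ) ≤ t) :
    IsL2Limit μ (fun ε => renormQuad χ ε (V ε) s t (grad u)) fun ω => A u t ω - A u s ω := by
  refine ((h.limit u t).sub (h.limit u s) (h.eventually_aesm_quad hχ _ t.2.1)
    (h.eventually_aesm_quad hχ _ s.2.1)).congr ?_
  filter_upwards [self_mem_nhdsWithin] with ε hε
  exact (h.field ε hε).quad_time_sub_ae_eq h.white hχ hε _ s.2.1 hst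

/-- The constant in the bound on the increments of the nonlinearity. -/
def nonlinConst (χ T κ : ℝ) : ℝ :=
  √(κ * (1 / (2 * (1 + √T)))) + √(4 * χ ^ 2 * (2 * (1 + √T)))

/-- With `τ = t - s`, replacing the increment of `A` by its regularisation costs `κ τ ε` times the
energy, and the regularisation itself has second moment at most `4χ²τ²/ε` times the energy. Both are
of order `τ^(3/2)` when `ε` is proportional to `√τ`. -/
theorem hasL2Bound_nonlin (h : IsBurgersFlow μ D χ lam T κ W V 𝓕 A N) (hχ : 0 ≤ χ)
    (u : 𝓢(ℝ, ℝ)) {s t : Icc (0 : ℝ) T} (hst : (s : ℝ) ≤ t) :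
    HasL2Bound μ (fun ω => A u t ω - A u s ω)
      (nonlinConst χ T κ * √(energy u) * √((t - s) * √(t - s))) := by
  have hn : 0 ≤ nonlinConst χ T κ := by unfold nonlinConst; positivity
  rcases hst.eq_or_lt with e | hlt
  · have : s = t := Subtype.ext e
    subst this
    simp only [sub_self]
    exact ⟨aestronglyMeasurable_const, by positivity, by simp⟩
  -- This divisor only ensures `ε < 1`, which the energy estimate requires.
  set q : ℝ := 2 * (1 + √T) with hq
  have hq0 : 0 < q := by positivity
  set τ : ℝ := (t : ℝ) - s with hτ
  have hτ0 : 0 < τ := sub_pos.2 hlt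
  have hτT : τ ≤ T := by have := t.2.2; have := s.2.1; linarith
  set ε : ℝ := √τ / q with hε
  have hε0 : 0 < ε := div_pos (Real.sqrt_pos.2 hτ0) hq0
  have hε1 : ε < 1 := by
    rw [hε, div_lt_one hq0, hq]
    have := Real.sqrt_le_sqrt hτT
    have := Real.sqrt_nonneg T
    linarith
  have hlim := h.limit_increment hχ u hst
  have hQ := h.hasL2Bound_quad hχ hε0 (grad u) hst
  have h1 : HasL2Bound μ (fun ω => renormQuad χ ε (V ε) s t (grad u) ω - (A u t ω - A u s ω))
      √(κ * (t - s) * ε * energy u) := by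
    refine hlim.hasL2Bound_sub hQ.aesm ?_
    filter_upwards [self_mem_nhdsWithin, mem_nhdsWithin_of_mem_nhds (Iio_mem_nhds hε0)]
      with δ hδ hδε
    exact h.energy_two u s t ε δ s.2.1 hlt t.2.2 hδ hδε hε1
  have h2 := (hQ.sub h1).congr (Y := fun ω => A u t ω - A u s ω)
    (ae_of_all _ fun ω => by simp only [sub_sub_cancel])
  refine h2.mono (le_of_eq ?_)
  rw [← hτ]
  have hE : 0 ≤ energy u := sqNorm_nonneg _
  have hsq : √τ * √τ = τ := Real.mul_self_sqrt hτ0.le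
  have hp : 0 ≤ τ * √τ := by positivity
  have e1 : κ * τ * ε * energy u = κ * (1 / q) * energy u * (τ * √τ) := by
    rw [hε]
    ring
  have e2 : τ * √(4 * χ ^ 2 / ε * sqNorm (grad u)) =
      √(4 * χ ^ 2 * q * energy u * (τ * √τ)) := by
    rw [eq_comm, Real.sqrt_eq_iff_mul_self_eq (by positivity) (by positivity)]
    rw [mul_mul_mul_comm τ, Real.mul_self_sqrt
      (mul_nonneg (div_nonneg (by positivity) hε0.le) (sqNorm_nonneg _)), hε]
    have : sqNorm (grad u) = energy u := rfl
    rw [this]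
    have hs0 : √τ ≠ 0 := (Real.sqrt_pos.2 hτ0).ne'
    field_simp
    rw [show √τ ^ 2 = τ by rw [sq, hsq]]
  rw [e1, e2, Real.sqrt_mul' _ hp, Real.sqrt_mul' _ hp, Real.sqrt_mul' _ hE, Real.sqrt_mul' _ hE]
  unfold nonlinConst
  rw [← hq]
  ring

end IsBurgersFlow

end Flow

/-! ### Limits of random paths. -/

section PathLimit

variable {Ω : Type*} [MeasurableSpace Ω] {μ : Measure Ω} [IsProbabilityMeasure μ] {T : ℝ}

/-- Completeness of L¹ with values in path space provides the continuous limit. At a fixed time the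
convergence holds in measure, and the L² bounds pass to the limit by lower semicontinuity. -/
theorem exists_path_limit {X : ℕ+ → Ω → C(Icc (0 : ℝ) T, ℝ)} (hm : ∀ n, Measurable (X n))
    (hX : ∀ n, eLpNorm (X n) 1 μ ≠ ∞) {e : ℕ+ → ℝ} (he : Tendsto e atTop (𝓝 0))
    (h1 : ∀ m n, eLpNorm (X m - X n) 1 μ ≤ ENNReal.ofReal (e m + e n))
    (h2 : ∀ m n t, HasL2Bound μ (fun ω => X m ω t - X n ω t) (e m + e n)) :
    ∃ Z : Ω → C(Icc (0 : ℝ) T, ℝ), Measurable Z ∧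
      Tendsto (fun n => eLpNorm (X n - Z) 1 μ) atTop (𝓝 0) ∧
      ∀ n t, HasL2Bound μ (fun ω => X n ω t - Z ω t) (e n) := by
  have hmem : ∀ n, MemLp (X n) 1 μ := fun n =>
    ⟨(hm n).stronglyMeasurable.aestronglyMeasurable, (hX n).lt_top⟩
  obtain ⟨Z, hZm, hZ, hlim⟩ := exists_limit_of_cauchy hmem he h1
  refine ⟨Z, hZm.measurable, hlim, fun n t => ?_⟩
  have hev : ∀ {f : Ω → C(Icc (0 : ℝ) T, ℝ)}, Measurable f → Measurable fun ω => f ω t :=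
    fun hf => (continuous_eval_const t).measurable.comp hf
  have ht : Tendsto (fun m => eLpNorm ((fun ω => X m ω t) - fun ω => Z ω t) 1 μ) atTop (𝓝 0) := by
    refine tendsto_of_tendsto_of_tendsto_of_le_of_le tendsto_const_nhds hlim (fun _ => zero_le)
      fun m => eLpNorm_mono fun ω => ?_
    exact ContinuousMap.norm_coe_le_norm (X m ω - Z ω) t
  have hin := tendstoInMeasure_of_tendsto_eLpNorm one_ne_zero
    (fun m => (hev (hm m)).aestronglyMeasurable) (hev hZm.measurable).aestronglyMeasurable ht
  have hin2 : TendstoInMeasure μ (fun m ω => X n ω t - X m ω t) atTop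
      (fun ω => X n ω t - Z ω t) := by
    intro ε hε
    refine (hin ε hε).congr fun m => ?_
    congr 1
    ext ω
    simp only [mem_ofPred_eq]
    rw [edist_sub_left]
  have haesm : AEStronglyMeasurable (fun ω => X n ω t - Z ω t) μ :=
    ((hev (hm n)).sub (hev hZm.measurable)).aestronglyMeasurable
  have hbd : ∀ η > 0, HasL2Bound μ (fun ω => X n ω t - Z ω t) (e n + η) := by
    intro η hη
    have hev' : ∀ᶠ m in atTop, e m < η := he.eventually_lt_const hη
    obtain ⟨m, hmη⟩ := hev'.exists
    refine ⟨haesm, (h2 n m t).nonneg.trans (by linarith), ?_⟩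
    refine eLpNorm_le_of_tendstoInMeasure ?_ hin2 fun m => (h2 n m t).aesm
    filter_upwards [hev'] with m hm'
    exact (h2 n m t).le.trans (ENNReal.ofReal_le_ofReal (by linarith))
  refine HasL2Bound.of_tendsto (l := 𝓝[>] (0 : ℝ)) (d := fun η => e n + η) ?_ ?_
  · filter_upwards [self_mem_nhdsWithin] with η hη
    exact hbd η hη
  · have : Tendsto (fun η : ℝ => e n + η) (𝓝 0) (𝓝 (e n + 0)) := tendsto_const_nhds.add tendsto_id
    rw [add_zero] at this
    exact this.mono_left nhdsWithin_le_nhds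

end PathLimit

/-! ### Uniform-in-time bounds by the first two derivatives. -/

section FlowPaths

variable {Ω : Type*} [MeasurableSpace Ω] {μ : Measure Ω} {D χ lam T κ : ℝ}

/-- The trajectory `t ↦ W_t(u) - W_0(u)`. -/
def noisePath {W : ℝ → Ω → Distr} (T : ℝ) (hc : ∀ ω u, Continuous fun t => W t ω u)
    (u : 𝓢(ℝ, ℝ)) (ω : Ω) : C(Icc (0 : ℝ) T, ℝ) :=
  ⟨fun t => W t ω u - W 0 ω u, ((hc ω u).comp continuous_subtype_val).sub continuous_const⟩

/-- The trajectory `t ↦ ∫_0^t W_s(u) ds`. -/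
def driftPath {W : ℝ → Ω → Distr} (T : ℝ) (hc : ∀ ω u, Continuous fun t => W t ω u)
    (u : 𝓢(ℝ, ℝ)) (ω : Ω) : C(Icc (0 : ℝ) T, ℝ) :=
  ⟨fun t => ∫ s in (0 : ℝ)..t, W s ω u,
    (intervalIntegral.continuous_primitive (fun a b => (hc ω u).intervalIntegrable a b) 0).comp
      continuous_subtype_val⟩

theorem noisePath_sub {W : ℝ → Ω → Distr} (T : ℝ) (hc : ∀ ω u, Continuous fun t => W t ω u)
    (u v : 𝓢(ℝ, ℝ)) : noisePath T hc u - noisePath T hc v = noisePath T hc (u - v) := by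
  funext ω
  ext t
  change (W t ω u - W 0 ω u) - (W t ω v - W 0 ω v) = W t ω (u - v) - W 0 ω (u - v)
  simp only [map_sub]
  ring

namespace IsBurgersFlow

variable {W : ℝ → Ω → Distr} {V : ℝ → ℝ → ℝ → Ω → ℝ}
  {𝓕 : Filtration (Icc (0 : ℝ) T) ‹MeasurableSpace Ω›} {A N : 𝓢(ℝ, ℝ) → Icc (0 : ℝ) T → Ω → ℝ}
  [IsProbabilityMeasure μ]

theorem measurable_noisePath (h : IsBurgersFlow μ D χ lam T κ W V 𝓕 A N) (u : 𝓢(ℝ, ℝ)) :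
    Measurable (noisePath T h.cont u) :=
  measurable_of_eval fun t => ((h.white t).measurable u).sub ((h.white 0).measurable u)

theorem measurable_driftPath (h : IsBurgersFlow μ D χ lam T κ W V 𝓕 A N) (u : 𝓢(ℝ, ℝ)) :
    Measurable (driftPath T h.cont u) := by
  refine measurable_of_eval fun t => ?_
  have hm : Measurable fun p : Ω × ℝ => W p.2 p.1 u :=
    (measurable_white h.white h.cont u).comp measurable_swap
  change Measurable fun ω => ∫ s in (0 : ℝ)..t, W s ω u
  simp only [intervalIntegral.integral_of_le t.2.1]
  exact (hm.stronglyMeasurable.integral_prod_right (ν := volume.restrict (Ioc 0 (t : ℝ)))).measurable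

theorem measurable_martPath (h : IsBurgersFlow μ D χ lam T κ W V 𝓕 A N) (u : 𝓢(ℝ, ℝ)) :
    Measurable (contPath (N u) (h.mart u).continuous) :=
  measurable_of_eval fun t => (h.mart u).measurable t

/-- The supremum over `t` is bounded by the integral of `|W_r(u)|` over `[0, T]`, and stationarity
bounds its L² norm. -/
theorem eLpNorm_driftPath_le (h : IsBurgersFlow μ D χ lam T κ W V 𝓕 A N) (hT : 0 < T) (hχ : 0 ≤ χ)
    (u : 𝓢(ℝ, ℝ)) : eLpNorm (driftPath T h.cont u) 1 μ ≤
      ENNReal.ofReal (T * (√χ * √(sqNorm u))) := by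
  have hb : HasL2Bound μ (fun ω => ∫ r in (0 : ℝ)..T, |W r ω u|) (T * (√χ * √(sqNorm u))) := by
    have hm : Measurable fun p : ℝ × Ω => |W p.1 p.2 u| :=
      continuous_abs.measurable.comp (measurable_white h.white h.cont u)
    have hc : ∀ r, HasL2Bound μ (fun ω => |W r ω u|) (√χ * √(sqNorm u)) := fun r => by
      have hr := (h.white r).hasL2Bound hχ u
      refine ⟨continuous_abs.comp_aestronglyMeasurable hr.aesm, hr.nonneg, ?_⟩
      refine (eLpNorm_mono fun ω => ?_).trans hr.le
      rw [Real.norm_eq_abs, abs_abs, Real.norm_eq_abs]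
    have := hasL2Bound_integral (Φ := fun r ω => |W r ω u|) hT.le hm hc
    rwa [sub_zero] at this
  calc eLpNorm (driftPath T h.cont u) 1 μ
      ≤ eLpNorm (fun ω => ∫ r in (0 : ℝ)..T, |W r ω u|) 1 μ := by
        refine eLpNorm_mono fun ω => ?_
        have hpos : 0 ≤ ∫ r in (0 : ℝ)..T, |W r ω u| :=
          intervalIntegral.integral_nonneg hT.le fun r _ => abs_nonneg _
        rw [Real.norm_of_nonneg hpos, ContinuousMap.norm_le _ hpos]
        intro t
        change ‖∫ s in (0 : ℝ)..t, W s ω u‖ ≤ _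
        have hi : ∀ a b, IntervalIntegrable (fun r => |W r ω u|) volume a b :=
          fun a b => (h.cont ω u).abs.intervalIntegrable a b
        refine (intervalIntegral.norm_integral_le_integral_norm t.2.1).trans ?_
        simp only [Real.norm_eq_abs]
        rw [← intervalIntegral.integral_add_adjacent_intervals (hi 0 t) (hi t T)]
        have := intervalIntegral.integral_nonneg (μ := volume) t.2.2 fun r (_ : r ∈ Icc (t : ℝ) T) =>
          abs_nonneg (W r ω u)
        linarith
    _ ≤ eLpNorm (fun ω => ∫ r in (0 : ℝ)..T, |W r ω u|) 2 μ :=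
        eLpNorm_le_eLpNorm_of_exponent_le (by norm_num) hb.aesm
    _ ≤ _ := hb.le

/-- The trajectory of `λ` times the nonlinearity. -/
def nonlinPath (h : IsBurgersFlow μ D χ lam T κ W V 𝓕 A N) (u : 𝓢(ℝ, ℝ)) (ω : Ω) :
    C(Icc (0 : ℝ) T, ℝ) :=
  noisePath T h.cont u ω - D • driftPath T h.cont (lap u) ω - contPath (N u) (h.mart u).continuous ω

/-- The limit `A` is known only at fixed times, without path regularity. Solving the equation for it
provides a continuous version of `λ A`. -/
theorem nonlinPath_ae_eq (h : IsBurgersFlow μ D χ lam T κ W V 𝓕 A N) (u : 𝓢(ℝ, ℝ)) (t : Icc (0 : ℝ) T) :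
    (fun ω => h.nonlinPath u ω t) =ᵐ[μ] fun ω => lam * A u t ω := by
  filter_upwards [h.formula u t] with ω hω
  change (W t ω u - W 0 ω u) - D * (∫ s in (0 : ℝ)..t, W s ω (lap u)) - N u t ω = _
  rw [hω]
  ring

/-- A constant controlling all the terms of the equation. -/
def flowConst (D χ lam T κ : ℝ) : ℝ :=
  ((|lam| + 1) * (nonlinConst χ T κ + 1)) * (chainConst T + √(T * √T)) + D * (T * √χ) +
    2 * √(2 * χ * D * T)

theorem eLpNorm_nonlinPath_le (h : IsBurgersFlow μ D χ lam T κ W V 𝓕 A N) (hT : 0 < T) (hχ : 0 ≤ χ)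
    (u : 𝓢(ℝ, ℝ)) {b : ℝ} (hb : 0 < b) (hu : √(energy u) ≤ b) :
    eLpNorm (h.nonlinPath u) 1 μ ≤
      ENNReal.ofReal (((|lam| + 1) * (nonlinConst χ T κ + 1)) * chainConst T * b) := by
  have hn : 0 ≤ nonlinConst χ T κ := by unfold nonlinConst; positivity
  rw [eLpNorm_one_path]
  have hk : 0 < ((|lam| + 1) * (nonlinConst χ T κ + 1)) := by positivity
  refine (lintegral_norm_le_of_increments hT
    (a := ((|lam| + 1) * (nonlinConst χ T κ + 1)) * b) (by positivity) (h.nonlinPath u) ?_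
    fun s t hst => ?_).trans (ENNReal.ofReal_le_ofReal (by apply le_of_eq; ring))
  · filter_upwards [h.nonlinPath_ae_eq u ⟨0, left_mem_Icc.2 hT.le⟩, h.nonlin_zero hT.le u]
      with ω h1 h2
    rw [h1, h2]
    simp
  · have h1 := ((h.hasL2Bound_nonlin hχ u hst).const_mul lam).congr
      (Y := fun ω => h.nonlinPath u ω t - h.nonlinPath u ω s) ?_
    · refine h1.mono ?_
      have h2 : nonlinConst χ T κ * √(energy u) ≤ (nonlinConst χ T κ + 1) * b :=
        mul_le_mul (by linarith) hu (Real.sqrt_nonneg _) (by positivity)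
      have h3 : |lam| * (nonlinConst χ T κ * √(energy u)) ≤
          (|lam| + 1) * ((nonlinConst χ T κ + 1) * b) :=
        mul_le_mul (by linarith) h2 (by positivity) (by positivity)
      calc _ = |lam| * (nonlinConst χ T κ * √(energy u)) *
            √((t - s) * √((t : ℝ) - s)) := by ring
        _ ≤ (|lam| + 1) * ((nonlinConst χ T κ + 1) * b) *
            √((t - s) * √((t : ℝ) - s)) := by gcongr
        _ = _ := by ring
    · filter_upwards [h.nonlinPath_ae_eq u t, h.nonlinPath_ae_eq u s] with ω h1 h2
      rw [h1, h2]
      ring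

/-- The central estimate: increments of the solution and the martingale depend on `u` only through
`‖u'‖` and `‖u''‖`. The bound `b` is a free positive number because the chaining and maximal
estimates need a nonzero scale. -/
theorem path_bounds (h : IsBurgersFlow μ D χ lam T κ W V 𝓕 A N) (hT : 0 < T) (hχ : 0 < χ) (hD : 0 < D)
    (u : 𝓢(ℝ, ℝ)) {b : ℝ} (hb : 0 < b) (hu : √(energy u) ≤ b) (hu2 : √(sqNorm (lap u)) ≤ b) :
    eLpNorm (noisePath T h.cont u) 1 μ ≤ ENNReal.ofReal (flowConst D χ lam T κ * b) ∧
    eLpNorm (contPath (N u) (h.mart u).continuous) 1 μ ≤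
      ENNReal.ofReal (flowConst D χ lam T κ * b) ∧
    ∀ t, HasL2Bound μ (fun ω => noisePath T h.cont u ω t) (flowConst D χ lam T κ * b) ∧
      HasL2Bound μ (N u t) (flowConst D χ lam T κ * b) := by
  have hn : 0 ≤ nonlinConst χ T κ := by unfold nonlinConst; positivity
  have hch := chainConst_nonneg hT.le
  set K := (|lam| + 1) * (nonlinConst χ T κ + 1) with hK
  have hK0 : 0 ≤ K := by positivity
  set q := √(2 * χ * D * T) with hq
  have hq0 : 0 < q := Real.sqrt_pos.2 (by positivity)
  have hTχ : 0 ≤ D * (T * √χ) := by positivity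
  have hTT : 0 ≤ √(T * √T) := Real.sqrt_nonneg _
  have hE : 0 ≤ energy u := sqNorm_nonneg _
  have hEb : energy u ≤ b ^ 2 := by
    rw [← Real.sq_sqrt hE]
    exact pow_le_pow_left₀ (Real.sqrt_nonneg _) hu 2
  have hfc : flowConst D χ lam T κ =
      K * chainConst T + K * √(T * √T) + D * (T * √χ) + 2 * q := by
    unfold flowConst
    rw [← hK, ← hq]
    ring
  have hq2 : 2 * χ * D * energy u * T ≤ (q * b) ^ 2 := by
    rw [mul_pow, hq, Real.sq_sqrt (by positivity)]
    have : 0 ≤ 2 * χ * D * T := by positivity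
    nlinarith [mul_le_mul_of_nonneg_left hEb this]
  have hR := h.eLpNorm_nonlinPath_le hT hχ.le u hb hu
  have hJ : eLpNorm (driftPath T h.cont (lap u)) 1 μ ≤ ENNReal.ofReal (T * √χ * b) := by
    refine (h.eLpNorm_driftPath_le hT hχ.le (lap u)).trans (ENNReal.ofReal_le_ofReal ?_)
    rw [← mul_assoc]
    gcongr
  have hNp := (h.mart u).eLpNorm_path_le hT (by positivity) (h.mart_zero hT.le u)
    (a := q * b) (by positivity) hq2
  have hNt : ∀ t, HasL2Bound μ (N u t) (q * b) := fun t => by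
    refine ((h.mart u).hasL2Bound hT.le (h.mart_zero hT.le u) t).mono ?_
    rw [Real.sqrt_le_left (by positivity)]
    refine le_trans ?_ hq2
    exact mul_le_mul_of_nonneg_left t.2.2 (by positivity)
  have hdec : noisePath T h.cont u = h.nonlinPath u + D • driftPath T h.cont (lap u) +
      contPath (N u) (h.mart u).continuous := by
    funext ω
    simp only [nonlinPath, Pi.add_apply, Pi.smul_apply]
    abel
  have hmN : AEStronglyMeasurable (contPath (N u) (h.mart u).continuous) μ :=
    (h.measurable_martPath u).stronglyMeasurable.aestronglyMeasurable
  have hmJ : AEStronglyMeasurable (driftPath T h.cont (lap u)) μ :=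
    (h.measurable_driftPath _).stronglyMeasurable.aestronglyMeasurable
  have hmP : AEStronglyMeasurable (noisePath T h.cont u) μ :=
    (h.measurable_noisePath u).stronglyMeasurable.aestronglyMeasurable
  have hmR : AEStronglyMeasurable (h.nonlinPath u) μ := (hmP.sub (hmJ.const_smul D)).sub hmN
  refine ⟨?_, hNp.trans (ENNReal.ofReal_le_ofReal ?_), fun t => ⟨?_, (hNt t).mono ?_⟩⟩
  · rw [hdec]
    refine (eLpNorm_add_le (hmR.add (hmJ.const_smul D)) hmN le_rfl).trans ?_
    refine (add_le_add (eLpNorm_add_le hmR (hmJ.const_smul D) le_rfl) le_rfl).trans ?_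
    have hDJ : eLpNorm (D • driftPath T h.cont (lap u)) 1 μ ≤ ENNReal.ofReal (D * (T * √χ * b)) := by
      refine (eLpNorm_const_smul D (driftPath T h.cont (lap u)) 1 μ).trans_le ?_
      rw [ENNReal.ofReal_mul hD.le, Real.enorm_eq_ofReal hD.le]
      gcongr
    refine (add_le_add (add_le_add hR hDJ) hNp).trans ?_
    rw [← ENNReal.ofReal_add (by positivity) (by positivity),
      ← ENNReal.ofReal_add (by positivity) (by positivity)]
    refine ENNReal.ofReal_le_ofReal ?_
    rw [hfc]
    nlinarith [mul_nonneg (mul_nonneg hK0 hTT) hb.le]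
  · rw [hfc]
    nlinarith [mul_nonneg (mul_nonneg hK0 hTT) hb.le, mul_nonneg (mul_nonneg hK0 hch) hb.le,
      mul_nonneg hTχ hb.le]
  · have hA := h.hasL2Bound_nonlin hχ.le u (s := ⟨0, left_mem_Icc.2 hT.le⟩) (t := t) t.2.1
    have hA' : HasL2Bound μ (fun ω => lam * A u t ω) (K * √(T * √T) * b) := by
      refine ((hA.const_mul lam).congr (Y := fun ω => lam * A u t ω) ?_).mono ?_
      · filter_upwards [h.nonlin_zero hT.le u] with ω hω
        rw [hω]
        simp
      · simp only [sub_zero]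
        have h1 : √((t : ℝ) * √t) ≤ √(T * √T) := by
          have := t.2.2
          have := t.2.1
          gcongr
        calc |lam| * (nonlinConst χ T κ * √(energy u) * √((t : ℝ) * √t))
            ≤ (|lam| + 1) * ((nonlinConst χ T κ + 1) * b * √(T * √T)) := by
              gcongr <;> linarith
          _ = _ := by rw [hK]; ring
    have hJt : HasL2Bound μ (fun ω => D * ∫ s in (0 : ℝ)..t, W s ω (lap u)) (D * (T * √χ) * b) := by
      refine ((hasL2Bound_time_integral hχ.le h.white h.cont (lap u) t.2.1).const_mul D).mono ?_
      rw [abs_of_pos hD, sub_zero]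
      have := t.2.2
      calc D * (t * (√χ * √(sqNorm (lap u)))) ≤ D * (T * (√χ * b)) := by gcongr
        _ = _ := by ring
    have hsum := (hA'.add hJt).add (hNt t)
    refine (hsum.congr ?_).mono ?_
    · filter_upwards [h.formula u t] with ω hω
      change _ = W t ω u - W 0 ω u
      rw [hω]
      ring
    · rw [hfc]
      nlinarith [mul_nonneg (mul_nonneg hK0 hch) hb.le]
  · rw [hfc]
    nlinarith [mul_nonneg (mul_nonneg hK0 hTT) hb.le, mul_nonneg (mul_nonneg hK0 hch) hb.le,
      mul_nonneg hTχ hb.le]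

/-- The processes attached to a sequence of test functions converging in the energy norm. -/
theorem exists_limits (h : IsBurgersFlow μ D χ lam T κ W V 𝓕 A N) (hT : 0 < T) (hχ : 0 < χ)
    (hD : 0 < D) {v : ℕ+ → 𝓢(ℝ, ℝ)} {g g' : 𝓢(ℝ, ℝ)} {e : ℕ+ → ℝ} (he : Tendsto e atTop (𝓝 0))
    (hv : ∀ M, 0 < e M ∧ √(sqNorm (grad (v M) - g)) ≤ e M ∧ √(sqNorm (lap (v M) - g')) ≤ e M) :
    ∃ Z S : Ω → C(Icc (0 : ℝ) T, ℝ), Measurable Z ∧ Measurable S ∧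
      Tendsto (fun n => eLpNorm (noisePath T h.cont (v n) - Z) 1 μ) atTop (𝓝 0) ∧
      (∀ n t, HasL2Bound μ (fun ω => noisePath T h.cont (v n) ω t - Z ω t)
        (flowConst D χ lam T κ * e n)) ∧
      ∀ n t, HasL2Bound μ (fun ω => N (v n) t ω - S ω t) (flowConst D χ lam T κ * e n) := by
  have hb : ∀ m n, 0 < e m + e n := fun m n => add_pos (hv m).1 (hv n).1
  have h1 : ∀ m n, √(energy (v m - v n)) ≤ e m + e n := fun m n => by
    rw [energy, grad_sub]
    exact (sqrt_sqNorm_sub_le _ _ g).trans (add_le_add (hv m).2.1 (hv n).2.1)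
  have h2 : ∀ m n, √(sqNorm (lap (v m - v n))) ≤ e m + e n := fun m n => by
    rw [lap_sub]
    exact (sqrt_sqNorm_sub_le _ _ g').trans (add_le_add (hv m).2.2 (hv n).2.2)
  have hd := fun m n => h.path_bounds hT hχ hD (v m - v n) (hb m n) (h1 m n) (h2 m n)
  -- Only finiteness is used here, so any positive bound will do.
  have hs := fun n => h.path_bounds hT hχ hD (v n)
    (b := √(energy (v n)) + √(sqNorm (lap (v n))) + 1) (by positivity)
    (by linarith [Real.sqrt_nonneg (sqNorm (lap (v n)))])
    (by linarith [Real.sqrt_nonneg (energy (v n))])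
  have he' : Tendsto (fun n => flowConst D χ lam T κ * e n) atTop (𝓝 0) := by
    simpa using he.const_mul (flowConst D χ lam T κ)
  obtain ⟨Z, hZ, hZ1, hZ2⟩ := exists_path_limit (X := fun n => noisePath T h.cont (v n))
    (fun n => h.measurable_noisePath (v n)) (fun n => ((hs n).1.trans_lt ENNReal.ofReal_lt_top).ne)
    he' (fun m n => by rw [noisePath_sub, ← mul_add]; exact (hd m n).1)
    (fun m n t => by
      rw [← mul_add]
      refine ((hd m n).2.2 t).1.congr (ae_of_all _ fun ω => ?_)
      rw [← noisePath_sub]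
      rfl)
  obtain ⟨S, hS, -, hS2⟩ := exists_path_limit
    (X := fun n => contPath (N (v n)) (h.mart (v n)).continuous)
    (fun n => h.measurable_martPath (v n))
    (fun n => ((hs n).2.1.trans_lt ENNReal.ofReal_lt_top).ne)
    he' (fun m n => by
      rw [← mul_add]
      refine (eLpNorm_congr_ae (ae_eq_path fun t => ?_)).trans_le (hd m n).2.1
      filter_upwards [h.mart_sub_ae_eq hχ.le (v m) (v n) t] with ω hω
      exact hω.symm)
    (fun m n t => by
      rw [← mul_add]
      exact ((hd m n).2.2 t).2.congr (h.mart_sub_ae_eq hχ.le (v m) (v n) t))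
  exact ⟨Z, S, hZ, hS, hZ1, hZ2, hS2⟩

end IsBurgersFlow

end FlowPaths

/-! ### Fubini for processes of linear growth in space. -/

section MixedIntegral

variable {Ω : Type*} [MeasurableSpace Ω] {μ : Measure Ω} [SFinite μ] {Φ : ℝ → Ω → ℝ} {C : ℝ}

theorem integrable_one_add_sq_mul (u : 𝓢(ℝ, ℝ)) : Integrable fun x => (1 + x ^ 2) * |u x| := by
  refine (u.integrable.norm.add (u.integrable_pow_mul volume 2)).congr (ae_of_all _ fun x => ?_)
  simp only [Real.norm_eq_abs, Pi.add_apply, sq_abs]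
  ring

theorem one_add_abs_sq_le (x : ℝ) : (1 + |x|) ^ 2 ≤ 2 * (1 + x ^ 2) := by
  rw [← sq_abs x]
  nlinarith [sq_nonneg (1 - |x|)]

theorem integrable_mixed (hm : Measurable (Function.uncurry Φ))
    (hc : ∀ x, HasL2Bound μ (Φ x) (C * (1 + |x|))) (u : 𝓢(ℝ, ℝ)) {η : Ω → ℝ} (hη : MemLp η 2 μ) :
    Integrable (fun p : ℝ × Ω => Φ p.1 p.2 * u p.1 * η p.2) (volume.prod μ) := by
  have hsm : AEStronglyMeasurable (fun p : ℝ × Ω => Φ p.1 p.2 * u p.1 * η p.2) (volume.prod μ) :=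
    (hm.aestronglyMeasurable.mul (u.continuous.measurable.comp measurable_fst).aestronglyMeasurable).mul
      hη.1.comp_snd
  have hi : ∀ x, Integrable (fun ω => Φ x ω * η ω) μ := fun x => (hc x).memLp.integrable_mul hη
  have hi' : ∀ x, Integrable (fun ω => Φ x ω * u x * η ω) μ := fun x =>
    ((hi x).const_mul (u x)).congr (ae_of_all _ fun ω => by ring)
  refine (integrable_prod_iff hsm).2 ⟨ae_of_all _ hi', ?_⟩
  have hdom : Integrable fun x => (C ^ 2 + ∫ ω, η ω ^ 2 ∂μ) * ((1 + x ^ 2) * |u x|) :=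
    (integrable_one_add_sq_mul u).const_mul _
  refine hdom.mono' hsm.norm.integral_prod_right' (ae_of_all _ fun x => ?_)
  rw [Real.norm_of_nonneg (integral_nonneg fun _ => norm_nonneg _)]
  have h1 : ∫ ω, ‖Φ x ω * u x * η ω‖ ∂μ ≤
      ∫ ω, |u x| * (1 / 2 * Φ x ω ^ 2 + 1 / 2 * η ω ^ 2) ∂μ := by
    refine integral_mono (hi' x).norm
      ((((hc x).memLp.integrable_sq.const_mul _).add (hη.integrable_sq.const_mul _)).const_mul _)
      fun ω => ?_
    simp only [Real.norm_eq_abs, abs_mul]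
    have h2 : |Φ x ω| * |η ω| ≤ 1 / 2 * Φ x ω ^ 2 + 1 / 2 * η ω ^ 2 := by
      rw [← sq_abs (Φ x ω), ← sq_abs (η ω)]
      nlinarith [sq_nonneg (|Φ x ω| - |η ω|)]
    calc |Φ x ω| * |u x| * |η ω| = |u x| * (|Φ x ω| * |η ω|) := by ring
      _ ≤ _ := mul_le_mul_of_nonneg_left h2 (abs_nonneg _)
  refine h1.trans ?_
  rw [integral_const_mul, integral_add ((hc x).memLp.integrable_sq.const_mul _)
    (hη.integrable_sq.const_mul _), integral_const_mul, integral_const_mul]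
  have h3 := (hc x).integral_sq_le
  have h4 : 0 ≤ ∫ ω, η ω ^ 2 ∂μ := integral_nonneg fun _ => sq_nonneg _
  have h5 : 1 / 2 * (∫ ω, Φ x ω ^ 2 ∂μ) + 1 / 2 * (∫ ω, η ω ^ 2 ∂μ) ≤
      (C ^ 2 + ∫ ω, η ω ^ 2 ∂μ) * (1 + x ^ 2) := by
    have h6 := one_add_abs_sq_le x
    have h7 : (C * (1 + |x|)) ^ 2 ≤ C ^ 2 * (2 * (1 + x ^ 2)) := by
      rw [mul_pow]
      exact mul_le_mul_of_nonneg_left h6 (sq_nonneg C)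
    nlinarith [mul_nonneg h4 (sq_nonneg x)]
  calc _ ≤ |u x| * ((C ^ 2 + ∫ ω, η ω ^ 2 ∂μ) * (1 + x ^ 2)) :=
        mul_le_mul_of_nonneg_left h5 (abs_nonneg _)
    _ = _ := by ring

/-- An s-finite measure is allowed because this is used for a Brownian motion on `Ω` and also for
the kernel `orientedIndicator` on the line. -/
theorem integral_mixed (hm : Measurable (Function.uncurry Φ))
    (hc : ∀ x, HasL2Bound μ (Φ x) (C * (1 + |x|))) (u : 𝓢(ℝ, ℝ)) {η : Ω → ℝ} (hη : MemLp η 2 μ) :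
    ∫ ω, (∫ x, Φ x ω * u x) * η ω ∂μ = ∫ x, (∫ ω, Φ x ω * η ω ∂μ) * u x := by
  have h := integral_integral_swap (f := fun x ω => Φ x ω * u x * η ω)
    (integrable_mixed hm hc u hη)
  calc ∫ ω, (∫ x, Φ x ω * u x) * η ω ∂μ = ∫ ω, (∫ x, Φ x ω * u x * η ω) ∂μ := by
        refine integral_congr_ae (ae_of_all _ fun ω => ?_)
        exact (integral_mul_const _ _).symm
    _ = ∫ x, (∫ ω, Φ x ω * u x * η ω ∂μ) := h.symm
    _ = _ := by
        refine integral_congr_ae (ae_of_all _ fun x => ?_)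
        simp only
        rw [← integral_mul_const]
        refine integral_congr_ae (ae_of_all _ fun ω => ?_)
        simp only
        ring

theorem memLp_one_add_sq_mul (u : 𝓢(ℝ, ℝ)) : MemLp (fun x => (1 + x ^ 2) * u x) 2 volume := by
  let xu : 𝓢(ℝ, ℝ) := u + SchwartzMap.smulLeftCLM ℝ (fun x : ℝ => x)
    (SchwartzMap.smulLeftCLM ℝ (fun x : ℝ => x) u)
  have hx : (fun x => (1 + x ^ 2) * u x) = xu := by
    funext x
    simp only [xu, add_apply]
    rw [SchwartzMap.smulLeftCLM_apply_apply (Function.HasTemperateGrowth.id' (E := ℝ)),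
      SchwartzMap.smulLeftCLM_apply_apply (Function.HasTemperateGrowth.id' (E := ℝ)),
      smul_eq_mul, smul_eq_mul]
    ring
  rw [hx]
  exact xu.memLp 2 volume

/-- Cauchy–Schwarz in `x` after multiplying and dividing by `1 + x²`: the weight is absorbed by `u`,
and the second moment of `Φ x / (1 + x²)` is at most `2C²/(1 + x²)`, which is integrable. -/
theorem memLp_integral_mul (hm : Measurable (Function.uncurry Φ))
    (hc : ∀ x, HasL2Bound μ (Φ x) (C * (1 + |x|))) (u : 𝓢(ℝ, ℝ)) :
    MemLp (fun ω => ∫ x, Φ x ω * u x) 2 μ := by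
  have hm2 : Measurable fun p : Ω × ℝ => Φ p.2 p.1 := hm.comp measurable_swap
  have hsm : AEStronglyMeasurable (fun ω => ∫ x, Φ x ω * u x) μ :=
    ((hm2.mul (u.continuous.measurable.comp measurable_snd)).stronglyMeasurable.integral_prod_right
      (ν := volume)).aestronglyMeasurable
  refine ⟨hsm, ?_⟩
  set g : ℝ → ℝ := fun x => (1 + x ^ 2) * u x with hg
  have hgL := memLp_one_add_sq_mul u
  let k : ℝ → ℝ := fun x => (1 + x ^ 2)⁻¹
  have hk : Measurable k := by fun_prop
  have hpt : ∀ ω, ENNReal.ofReal ((∫ x, Φ x ω * u x) ^ 2) ≤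
      eLpNorm g 2 volume ^ 2 * ∫⁻ x, ENNReal.ofReal ((k x * Φ x ω) ^ 2) := by
    intro ω
    have hmω : Measurable fun x => k x * Φ x ω := hk.mul (hm.comp measurable_prodMk_right)
    have e : (fun x => Φ x ω * u x) = g • fun x => k x * Φ x ω := by
      funext x
      have : (1 + x ^ 2) ≠ 0 := by positivity
      simp only [hg, k, Pi.smul_apply', smul_eq_mul]
      field_simp
    have h1 : ENNReal.ofReal ((∫ x, Φ x ω * u x) ^ 2) ≤
        (eLpNorm (fun x => Φ x ω * u x) 1 volume) ^ 2 := by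
      rw [← sq_abs, ENNReal.ofReal_pow (abs_nonneg _), ← Real.enorm_eq_ofReal_abs,
        eLpNorm_one_eq_lintegral_enorm]
      gcongr
      exact enorm_integral_le_lintegral_enorm _
    refine h1.trans ?_
    rw [← eLpNorm_two_sq, ← mul_pow, e]
    exact pow_le_pow_left' (eLpNorm_smul_le_mul_eLpNorm (p := 2) (q := 2) (r := 1)
      hmω.aestronglyMeasurable hgL.1) 2
  suffices hsq : eLpNorm (fun ω => ∫ x, Φ x ω * u x) 2 μ ^ 2 < ∞ from
    (ENNReal.pow_lt_top_iff.1 hsq).resolve_right two_ne_zero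
  rw [eLpNorm_two_sq]
  refine (lintegral_mono hpt).trans_lt ?_
  rw [lintegral_const_mul' _ _ (ENNReal.pow_ne_top hgL.eLpNorm_ne_top)]
  refine ENNReal.mul_lt_top (ENNReal.pow_lt_top hgL.eLpNorm_lt_top) ?_
  have hmk : Measurable fun p : Ω × ℝ => ENNReal.ofReal ((k p.2 * Φ p.2 p.1) ^ 2) :=
    (((hk.comp measurable_snd).mul hm2).pow_const 2).ennreal_ofReal
  rw [lintegral_lintegral_swap hmk.aemeasurable]
  calc ∫⁻ x, ∫⁻ ω, ENNReal.ofReal ((k x * Φ x ω) ^ 2) ∂μ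
      ≤ ∫⁻ x, ENNReal.ofReal (C ^ 2 * 2 * (1 + x ^ 2)⁻¹) := by
        refine lintegral_mono fun x => ?_
        have h1 := ((hc x).const_mul (k x)).lintegral_le
        refine h1.trans (ENNReal.ofReal_le_ofReal ?_)
        have h6 := one_add_abs_sq_le x
        have h0 : 0 < 1 + x ^ 2 := by positivity
        rw [mul_pow, sq_abs, mul_pow]
        calc k x ^ 2 * (C ^ 2 * (1 + |x|) ^ 2) ≤ k x ^ 2 * (C ^ 2 * (2 * (1 + x ^ 2))) := by gcongr
          _ = _ := by
            simp only [k]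
            field_simp
    _ < ∞ := by
        have hi : Integrable fun x : ℝ => C ^ 2 * 2 * (1 + x ^ 2)⁻¹ :=
          integrable_inv_one_add_sq.const_mul _
        rw [← ofReal_integral_eq_lintegral_ofReal hi (ae_of_all _ fun x => by positivity)]
        exact ENNReal.ofReal_lt_top

theorem ae_integrable_mul [IsFiniteMeasure μ] (hm : Measurable (Function.uncurry Φ))
    (hc : ∀ x, HasL2Bound μ (Φ x) (C * (1 + |x|))) (u : 𝓢(ℝ, ℝ)) :
    ∀ᵐ ω ∂μ, Integrable fun x => Φ x ω * u x := by
  have h := (integrable_mixed hm hc u (memLp_const (1 : ℝ))).prod_left_ae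
  simpa using h

end MixedIntegral

/-! ### Exchange of the white noise with the space integral. -/

section Fubini

theorem measurable_orientedIndicator : Measurable (Function.uncurry orientedIndicator) := by
  have h1 : MeasurableSet {p : ℝ × ℝ | 0 < p.2 ∧ p.2 ≤ p.1} :=
    (measurableSet_lt measurable_const measurable_snd).inter
      (measurableSet_le measurable_snd measurable_fst)
  have h2 : MeasurableSet {p : ℝ × ℝ | p.1 < p.2 ∧ p.2 ≤ 0} :=
    (measurableSet_lt measurable_fst measurable_snd).inter
      (measurableSet_le measurable_snd measurable_const)
  exact ((measurable_const (a := (1 : ℝ))).indicator h1).sub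
    ((measurable_const (a := (1 : ℝ))).indicator h2)

theorem integral_orientedIndicator_sq (x : ℝ) : ∫ z, orientedIndicator x z ^ 2 = |x| := by
  rcases le_total 0 x with h | h
  · have := integral_orientedIndicator_sub_sq h
    simpa [orientedIndicator_zero, abs_of_nonneg h] using this
  · have := integral_orientedIndicator_sub_sq h
    simpa [orientedIndicator_zero, abs_of_nonpos h] using this

theorem hasL2Bound_orientedIndicator (x : ℝ) :
    HasL2Bound volume (orientedIndicator x) (1 * (1 + |x|)) := by
  refine (HasL2Bound.of_integral_le (memLp_orientedIndicator x 2)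
    (integral_orientedIndicator_sq x).le).mono ?_
  rw [one_mul, Real.sqrt_le_left (by positivity)]
  nlinarith [abs_nonneg x]

/-- The integral is `ū - U(y)` for `y > 0` and `-U(y)` for `y ≤ 0`. Neither `U` nor the step need be
square integrable; adding and subtracting `ū F` writes it with two functions that are. -/
theorem integral_orientedIndicator_mul (u : 𝓢(ℝ, ℝ)) (y : ℝ) :
    ∫ x, orientedIndicator x y * u x = mean u * stepDefect y - correctedPrimitive u y := by
  have hsplit := intervalIntegral.integral_Iic_add_Ioi (b := y)
    (u.integrable (μ := volume)).integrableOn u.integrable.integrableOn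
  rw [correctedPrimitive_apply, stepDefect]
  by_cases hy : 0 < y
  · have e : (fun x => orientedIndicator x y * u x) = (Ici y).indicator u := by
      funext x
      by_cases hx : y ≤ x
      · rw [indicator_of_mem (mem_Ici.2 hx)]
        simp [orientedIndicator, hy, hx, not_le.2 hy]
      · rw [indicator_of_notMem (by simpa using hx)]
        simp [orientedIndicator, hx, not_le.2 hy]
    rw [e, integral_indicator measurableSet_Ici, integral_Ici_eq_integral_Ioi,
      indicator_of_mem (mem_Ioi.2 hy)]
    have : mean u = (∫ x in Iic y, u x) + ∫ x in Ioi y, u x := hsplit.symm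
    linarith
  · have e : (fun x => orientedIndicator x y * u x) = (Iio y).indicator fun x => -u x := by
      funext x
      by_cases hx : x < y
      · rw [indicator_of_mem (mem_Iio.2 hx)]
        simp [orientedIndicator, hy, hx, not_lt.1 hy]
      · rw [indicator_of_notMem (by simpa using hx)]
        simp [orientedIndicator, hx, hy]
    rw [e, integral_indicator measurableSet_Iio, ← integral_Iic_eq_integral_Iio, integral_neg,
      indicator_of_notMem (by simpa using hy)]
    ring

variable {Ω : Type*} [MeasurableSpace Ω] {μ : Measure Ω} [IsProbabilityMeasure μ] {χ : ℝ}
  {W : Ω → Distr} {B : ℝ → Ω → ℝ} {G : Ω → ℝ}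

theorem hasL2Bound_brownian (hW : IsWhiteNoise μ χ W) (hχ : 0 ≤ χ)
    (hB : ∀ x, Pairs μ W (orientedIndicator x) (B x)) (x : ℝ) :
    HasL2Bound μ (B x) (√χ * (1 + |x|)) := by
  have := (hB x).hasL2Bound' hW hχ (hasL2Bound_orientedIndicator x)
  rwa [one_mul] at this

/-- Call the two sides `S` and `Q`. They have the same covariance with every pairing, so `S - Q` is
orthogonal to each `B x` and to `Q`. As `S` is an integral of the `B x`, Fubini makes `S - Q`
orthogonal to `S` too, hence to itself. -/
theorem integral_brownian_ae_eq (hW : IsWhiteNoise μ χ W) (hχ : 0 ≤ χ)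
    (hm : Measurable (Function.uncurry B)) (hB : ∀ x, Pairs μ W (orientedIndicator x) (B x))
    (hG : Pairs μ W stepDefect G) (u : 𝓢(ℝ, ℝ)) :
    ∀ᵐ ω ∂μ, ∫ x, B x ω * u x = mean u * G ω - W ω (correctedPrimitive u) := by
  have hQ := (hG.const_mul (mean u)).sub (Pairs.of_schwartz hW (correctedPrimitive u))
  have hc := hasL2Bound_brownian hW hχ hB
  set S : Ω → ℝ := fun ω => ∫ x, B x ω * u x with hS
  set Q : Ω → ℝ := fun ω => mean u * G ω - W ω (correctedPrimitive u) with hQdef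
  have hSL : MemLp S 2 μ := memLp_integral_mul hm hc u
  have hQL : MemLp Q 2 μ := hQ.memLp_prob hW (by norm_num)
  have key : ∀ {g : ℝ → ℝ} {ξ : Ω → ℝ}, Pairs μ W g ξ →
      ∫ ω, S ω * ξ ω ∂μ = ∫ ω, Q ω * ξ ω ∂μ := by
    intro g ξ hξ
    rw [hQ.integral_mul hW hχ hξ, hS, integral_mixed hm hc u (hξ.memLp_prob hW (by norm_num))]
    have h1 : ∀ x, ∫ ω, B x ω * ξ ω ∂μ = χ * ∫ y, orientedIndicator x y * g y :=
      fun x => (hB x).integral_mul hW hχ hξ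
    have h2 := integral_mixed measurable_orientedIndicator hasL2Bound_orientedIndicator u hξ.memLp
    simp only [integral_orientedIndicator_mul] at h2
    rw [h2, ← integral_const_mul]
    refine integral_congr_ae (ae_of_all _ fun x => ?_)
    simp only [h1]
    ring
  have hi : ∀ {ξ : Ω → ℝ}, MemLp ξ 2 μ → Integrable (fun ω => S ω * ξ ω) μ ∧
      Integrable (fun ω => Q ω * ξ ω) μ := fun hξ => ⟨hSL.integrable_mul hξ, hQL.integrable_mul hξ⟩
  have hη : MemLp (fun ω => S ω - Q ω) 2 μ := hSL.sub hQL
  have h1 : ∫ ω, S ω * (S ω - Q ω) ∂μ = 0 := by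
    rw [hS, integral_mixed hm hc u hη]
    refine integral_eq_zero_of_ae (ae_of_all _ fun x => ?_)
    have hx := (hB x).memLp_prob hW (p := 2) (by norm_num)
    have : ∫ ω, B x ω * (S ω - Q ω) ∂μ = 0 := by
      have h3 := key (hB x)
      rw [← sub_eq_zero, ← integral_sub (hi hx).1 (hi hx).2] at h3
      rw [← h3]
      refine integral_congr_ae (ae_of_all _ fun ω => ?_)
      simp only
      ring
    simp only [this, zero_mul, Pi.zero_apply]
  have h2 : ∫ ω, Q ω * (S ω - Q ω) ∂μ = 0 := by
    have h3 := key hQ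
    rw [← sub_eq_zero, ← integral_sub (hi hQL).1 (hi hQL).2] at h3
    rw [← h3]
    refine integral_congr_ae (ae_of_all _ fun ω => ?_)
    simp only
    ring
  have h4 : ∫ ω, (S ω - Q ω) ^ 2 ∂μ = 0 := by
    have h5 : ∫ ω, (S ω * (S ω - Q ω) - Q ω * (S ω - Q ω)) ∂μ = 0 := by
      rw [integral_sub (hi hη).1 (hi hη).2, h1, h2, sub_zero]
    rw [← h5]
    refine integral_congr_ae (ae_of_all _ fun ω => ?_)
    simp only
    ring
  have h6 := HasL2Bound.of_integral_le hη h4.le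
  rw [Real.sqrt_zero] at h6
  exact h6.ae_eq_of_sub

end Fubini

/-! ### Joint Gaussianity and independence of pairings. -/

section Independence

variable {Ω : Type*} [MeasurableSpace Ω] {μ : Measure Ω} [IsProbabilityMeasure μ] {χ : ℝ}
  {W : Ω → Distr}

theorem Pairs.integral_eq_zero (hW : IsWhiteNoise μ χ W) {f : ℝ → ℝ} {X : Ω → ℝ}
    (h : Pairs μ W f X) : ∫ ω, X ω ∂μ = 0 := by
  have h1 := integral_map (μ := μ) (φ := X) (f := fun x : ℝ => x) h.aesm.aemeasurable
    (by fun_prop)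
  rw [← h1, h.law hW]
  exact integral_id_gaussianReal

/-- Every linear functional of the vector is a pairing with a linear combination of the `f i`, hence
Gaussian. -/
theorem Pairs.hasGaussianLaw (hW : IsWhiteNoise μ χ W) {ι : Type*} [Fintype ι] {f : ι → ℝ → ℝ}
    {X : ι → Ω → ℝ} (h : ∀ i, Pairs μ W (f i) (X i)) : HasGaussianLaw (fun ω i => X i ω) μ := by
  classical
  refine ⟨isGaussian_of_map_eq_gaussianReal fun L => ?_⟩
  have hm : AEMeasurable (fun ω i => X i ω) μ := aemeasurable_pi_lambda _ fun i =>
    (h i).aesm.aemeasurable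
  have hL : Measurable L := L.continuous.measurable
  rw [AEMeasurable.map_map_of_aemeasurable hL.aemeasurable hm]
  have e : (L ∘ fun ω i => X i ω) = fun ω => ∑ i, L (Pi.single i 1) * X i ω := by
    funext ω
    have := LinearMap.pi_apply_eq_sum_univ (L : (ι → ℝ) →ₗ[ℝ] ℝ) fun i => X i ω
    simp only [ContinuousLinearMap.coe_coe] at this
    rw [Function.comp_apply, this]
    refine Finset.sum_congr rfl fun i _ => ?_
    rw [smul_eq_mul, mul_comm]
    congr 2
    funext j
    simp [Pi.single_apply, eq_comm]
  rw [e]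
  exact ⟨0, _, (Pairs.finsetSum hW Finset.univ
    fun i => (h i).const_mul (L (Pi.single i 1))).law hW⟩

theorem Pairs.iIndepFun (hW : IsWhiteNoise μ χ W) (hχ : 0 ≤ χ) {ι : Type*} [Fintype ι]
    {f : ι → ℝ → ℝ} {X : ι → Ω → ℝ} (h : ∀ i, Pairs μ W (f i) (X i))
    (hf : ∀ i j, i ≠ j → ∫ x, f i x * f j x = 0) : iIndepFun X μ := by
  refine (Pairs.hasGaussianLaw hW h).iIndepFun_of_covariance_eq_zero fun i j hij => ?_
  rw [covariance_eq_sub ((h i).memLp_prob hW (by norm_num)) ((h j).memLp_prob hW (by norm_num)),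
    (h i).integral_eq_zero hW, zero_mul, sub_zero]
  simp only [Pi.mul_apply]
  rw [(h i).integral_mul hW hχ (h j), hf i j hij, mul_zero]

end Independence

/-! ### Construction of the height function. -/

section Height

variable {Ω : Type*} [MeasurableSpace Ω] {μ : Measure Ω} {χ : ℝ} {W : ℝ → Ω → Distr}

/-- `H` is a primitive in space of the white noises `W`, normalised by the process `z`. -/
structure IsHeight (μ : Measure Ω) (W : ℝ → Ω → Distr) (z G : ℝ → Ω → ℝ) (H : ℝ → ℝ → Ω → ℝ) :
    Prop where
  measurable : Measurable fun p : ℝ × ℝ × Ω => H p.1 p.2.1 p.2.2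
  cont : ∀ t, ∀ᵐ ω ∂μ, Continuous fun x => H t x ω
  defect : ∀ t, Pairs μ (W t) stepDefect (G t)
  increments : ∀ t x, Pairs μ (W t) (fun y => -orientedIndicator x y)
    fun ω => H t x ω - (z t ω + G t ω - G 0 ω)
  integral : ∀ t (u : 𝓢(ℝ, ℝ)), ∀ᵐ ω ∂μ, Integrable (fun x => H t x ω * u x) ∧
    ∫ x, H t x ω * u x = W t ω (correctedPrimitive u) + mean u * (z t ω - G 0 ω)

/-- The height is `-B_t(x) + z_t + G_t - G_0`. The term `G_t` cancels the step defect produced by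
integrating `B_t` against `u`, and `-G_0` restores `-B_0(x)` at time zero whenever `z_0 = 0`. -/
theorem exists_isHeight [IsProbabilityMeasure μ] (hW : ∀ t, IsWhiteNoise μ χ (W t)) (hχ : 0 ≤ χ)
    (hc : ∀ ω u, Continuous fun t => W t ω u) {z : ℝ → Ω → ℝ}
    (hz : Measurable (Function.uncurry z)) : ∃ G H, IsHeight μ W z G H := by
  have hm := measurable_white hW hc
  obtain ⟨B, hBm, hBp, hBc⟩ := exists_brownian_version hW hχ hm
  obtain ⟨G, hGm, hGp⟩ := exists_pairs_version hW hχ hm (memLp_stepDefect 2)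
  refine ⟨G, fun t x ω => -B t x ω + (z t ω + G t ω - G 0 ω), ⟨?_, fun t => ?_, hGp,
    fun t x => ?_, fun t u => ?_⟩⟩
  · have h1 : Measurable fun p : ℝ × ℝ × Ω => (p.1, p.2.2) :=
      measurable_fst.prodMk measurable_snd.snd
    have h2 : Measurable fun p : ℝ × ℝ × Ω => ((0 : ℝ), p.2.2) :=
      measurable_const.prodMk measurable_snd.snd
    exact hBm.neg.add (((hz.comp h1).add (hGm.comp h1)).sub (hGm.comp h2))
  · filter_upwards [hBc t] with ω hω
    exact hω.neg.add continuous_const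
  · refine ((hBp t x).neg).congr ae_eq_rfl (ae_of_all _ fun ω => ?_)
    simp only [add_sub_cancel_right]
  · have hBt : Measurable (Function.uncurry (B t)) := hBm.comp measurable_prodMk_left
    filter_upwards [ae_integrable_mul hBt (hasL2Bound_brownian (hW t) hχ (hBp t)) u,
      integral_brownian_ae_eq (hW t) hχ hBt (hBp t) (hGp t) u] with ω h1 h2
    have e : (fun x => (-B t x ω + (z t ω + G t ω - G 0 ω)) * u x) =
        fun x => (z t ω + G t ω - G 0 ω) * u x - B t x ω * u x := by
      funext x
      ring
    rw [e]
    have hu : Integrable fun x => (z t ω + G t ω - G 0 ω) * u x := u.integrable.const_mul _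
    refine ⟨hu.sub h1, ?_⟩
    rw [integral_sub hu h1, h2, integral_const_mul]
    change _ * mean u - _ = _
    ring

namespace IsHeight

variable {z G : ℝ → Ω → ℝ} {H : ℝ → ℝ → Ω → ℝ}

theorem pairs_sub (h : IsHeight μ W z G H) (t x y : ℝ) :
    Pairs μ (W t) (fun s => -(orientedIndicator y s - orientedIndicator x s))
      fun ω => H t y ω - H t x ω := by
  refine ((h.increments t y).sub (h.increments t x)).congr (ae_of_all _ fun s => ?_)
    (ae_of_all _ fun ω => ?_)
  · ring
  · ring

theorem isTwoSidedBM [IsProbabilityMeasure μ] (h : IsHeight μ W z G H)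
    (hW : ∀ t, IsWhiteNoise μ χ (W t)) (hχ : 0 ≤ χ) (t : ℝ) : IsTwoSidedBM μ χ (H t) := by
  refine ⟨h.cont t, fun n τ hτ => ?_, fun x y hxy => ?_⟩
  · refine Pairs.iIndepFun (hW t) hχ (fun i => h.pairs_sub t (τ i.castSucc) (τ i.succ))
      fun i j hij => ?_
    refine integral_eq_zero_of_ae (ae_of_all _ fun s => ?_)
    simp only [orientedIndicator_sub (hτ (Fin.castSucc_le_succ _)), neg_mul_neg, Pi.zero_apply]
    have key : ∀ i j : Fin n, i < j → (Ioc (τ i.castSucc) (τ i.succ)).indicator (fun _ => (1 : ℝ)) s *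
        (Ioc (τ j.castSucc) (τ j.succ)).indicator (fun _ => (1 : ℝ)) s = 0 := by
      intro i j hij
      by_cases hs : s ∈ Ioc (τ i.castSucc) (τ i.succ)
      · have h1 : τ i.succ ≤ τ j.castSucc := hτ (Fin.succ_le_castSucc_iff.2 hij)
        rw [indicator_of_notMem (s := Ioc (τ j.castSucc) (τ j.succ))
          fun h2 => not_lt.2 (hs.2.trans h1) h2.1, mul_zero]
      · rw [indicator_of_notMem hs, zero_mul]
    rcases lt_or_gt_of_ne hij with h1 | h1
    · exact key i j h1
    · rw [mul_comm]
      exact key j i h1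
  · rw [(h.pairs_sub t x y).law (hW t)]
    congr 3
    rw [← integral_orientedIndicator_sub_sq hxy]
    refine integral_congr_ae (ae_of_all _ fun s => ?_)
    simp only [neg_sq]

/-- The spatial increments of `H` are minus those of the noise. The sign disappears in the
nonlinearity, where only squares occur. -/
theorem quotient_pairs (h : IsHeight μ W z G H) {ε : ℝ} (hε : 0 < ε) (t x : ℝ) :
    Pairs μ (W t) (iEps ε x) fun ω => -((H t (x + ε) ω - H t x ω) / ε) := by
  refine ((h.pairs_sub t x (x + ε)).const_mul (-ε⁻¹)).congr (ae_of_all _ fun s => ?_)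
    (ae_of_all _ fun ω => ?_)
  · simp only
    rw [orientedIndicator_sub (by linarith), iEps]
    by_cases hs : s ∈ Ioc x (x + ε) <;> simp [hs]
  · field_simp

theorem isField (h : IsHeight μ W z G H) {ε : ℝ} (hε : 0 < ε) :
    IsField μ ε W fun t x ω => -((H t (x + ε) ω - H t x ω) / ε) := by
  refine ⟨?_, fun t x => h.quotient_pairs hε t x⟩
  have h1 : Measurable fun p : ℝ × ℝ × Ω => (p.1, p.2.1 + ε, p.2.2) :=
    measurable_fst.prodMk ((measurable_snd.fst.add_const ε).prodMk measurable_snd.snd)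
  exact (((h.measurable.comp h1).sub h.measurable).div_const ε).neg

theorem quad_ae_eq [IsProbabilityMeasure μ] (h : IsHeight μ W z G H)
    (hW : ∀ t, IsWhiteNoise μ χ (W t)) (hχ : 0 ≤ χ) {ε : ℝ} (hε : 0 < ε) {V : ℝ → ℝ → Ω → ℝ}
    (hV : IsField μ ε W V) (g : 𝓢(ℝ, ℝ)) (s t : ℝ) :
    kpzNonlin χ H ε s t g =ᵐ[μ] renormQuad χ ε V s t g := by
  have h1 : kpzNonlin χ H ε s t g =
      renormQuad χ ε (fun t x ω => -((H t (x + ε) ω - H t x ω) / ε)) s t g := by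
    rw [kpzNonlin_eq_renormQuad]
    funext ω
    simp only [renormQuad, renormSlice, neg_sq]
  rw [h1]
  refine (h.isField hε).quad_congr hV.measurable (fun r x => ?_) g s t
  filter_upwards [(h.quotient_pairs hε r x).ae_eq (hW r) hχ (hV.pairs r x)] with ω hω
  rw [hω]

theorem integral_lap (h : IsHeight μ W z G H) (t : ℝ) (u : 𝓢(ℝ, ℝ)) :
    ∀ᵐ ω ∂μ, ∫ x, H t x ω * lap u x = W t ω (grad u) := by
  filter_upwards [h.integral t (lap u)] with ω hω
  rw [hω.2]
  have h1 : correctedPrimitive (lap u) = grad u := correctedPrimitive_grad (grad u)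
  have h2 : mean (lap u) = 0 := mean_grad (grad u)
  rw [h1, h2, zero_mul, add_zero]

theorem integral_lap_time [IsProbabilityMeasure μ] (h : IsHeight μ W z G H)
    (hW : ∀ t, IsWhiteNoise μ χ (W t)) (hc : ∀ ω u, Continuous fun t => W t ω u) (u : 𝓢(ℝ, ℝ))
    (s t : ℝ) : (fun ω => ∫ r in s..t, ∫ x, H r x ω * lap u x) =ᵐ[μ]
      fun ω => ∫ r in s..t, W r ω (grad u) := by
  have h1 : Measurable fun p : (ℝ × Ω) × ℝ => H p.1.1 p.2 p.1.2 :=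
    h.measurable.comp (by fun_prop : Measurable fun p : (ℝ × Ω) × ℝ => (p.1.1, p.2, p.1.2))
  have h2 : Measurable fun p : (ℝ × Ω) × ℝ => lap u p.2 :=
    (lap u).continuous.measurable.comp measurable_snd
  have hm : Measurable (Function.uncurry fun r ω => ∫ x, H r x ω * lap u x) :=
    ((h1.mul h2).stronglyMeasurable.integral_prod_right (ν := volume)).measurable
  exact intervalIntegral_ae_congr (Φ := fun r ω => ∫ x, H r x ω * lap u x)
    (Ψ := fun r ω => W r ω (grad u)) hm (measurable_white hW hc (grad u))
    (fun r => h.integral_lap r u) s t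

end IsHeight

end Height

/-! ### Energy estimates for general test functions. -/

section EnergyBounds

theorem sqrt_sqNorm_le_add (u v : 𝓢(ℝ, ℝ)) : √(sqNorm u) ≤ √(sqNorm v) + √(sqNorm (u - v)) := by
  refine sqrt_sqNorm_le (((SchwartzMap.hasL2Bound v).add (SchwartzMap.hasL2Bound (u - v))).congr
    (ae_of_all _ fun x => ?_))
  simp

theorem sqrt_sqNorm_sub_comm (u v : 𝓢(ℝ, ℝ)) : √(sqNorm (u - v)) = √(sqNorm (v - u)) := by
  congr 1
  refine integral_congr_ae (ae_of_all _ fun x => ?_)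
  simp only [sub_apply]
  ring

theorem abs_sqrt_sqNorm_sub_le (u v : 𝓢(ℝ, ℝ)) :
    |√(sqNorm u) - √(sqNorm v)| ≤ √(sqNorm (u - v)) := by
  rw [abs_le]
  have h1 := sqrt_sqNorm_le_add u v
  have h2 := sqrt_sqNorm_le_add v u
  rw [sqrt_sqNorm_sub_comm] at h2
  constructor <;> linarith

theorem tendsto_sqrt_energy {v : ℕ+ → 𝓢(ℝ, ℝ)} {g : 𝓢(ℝ, ℝ)} {e : ℕ+ → ℝ}
    (he : Tendsto e atTop (𝓝 0)) (hv : ∀ M, √(sqNorm (grad (v M) - g)) ≤ e M) :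
    Tendsto (fun M => √(energy (v M))) atTop (𝓝 √(sqNorm g)) := by
  rw [tendsto_iff_dist_tendsto_zero]
  refine squeeze_zero (fun _ => dist_nonneg) (fun M => ?_) he
  exact (abs_sqrt_sqNorm_sub_le _ _).trans (hv M)

variable {Ω : Type*} [MeasurableSpace Ω] {μ : Measure Ω} [IsProbabilityMeasure μ]
  {D χ lam T κ : ℝ} {W : ℝ → Ω → Distr} {V : ℝ → ℝ → ℝ → Ω → ℝ}
  {𝓕 : Filtration (Icc (0 : ℝ) T) ‹MeasurableSpace Ω›} {A N : 𝓢(ℝ, ℝ) → Icc (0 : ℝ) T → Ω → ℝ}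

namespace IsBurgersFlow

theorem hasL2Bound_time_integral_sub (h : IsBurgersFlow μ D χ lam T κ W V 𝓕 A N) (hχ : 0 ≤ χ)
    (u v : 𝓢(ℝ, ℝ)) {s t : ℝ} (hst : s ≤ t) :
    HasL2Bound μ (fun ω => (∫ r in s..t, W r ω u) - ∫ r in s..t, W r ω v)
      ((t - s) * (√χ * √(sqNorm (u - v)))) := by
  refine (hasL2Bound_time_integral hχ h.white h.cont (u - v) hst).congr (ae_of_all _ fun ω => ?_)
  simp only [map_sub]
  exact intervalIntegral.integral_sub ((h.cont ω _).intervalIntegrable _ _)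
    ((h.cont ω _).intervalIntegrable _ _)

/-- The Burgers estimate is applied to `cutPrimitive M u`, whose Laplacian tends to `grad u` and
whose energy tends to `sqNorm u`. Stationarity controls the replacement of the Laplacian. -/
theorem hasL2Bound_drift (h : IsBurgersFlow μ D χ lam T κ W V 𝓕 A N) (hχ : 0 ≤ χ) (hκ : 0 ≤ κ)
    (u : 𝓢(ℝ, ℝ)) {s t : ℝ} (hs : 0 ≤ s) (hst : s < t) (ht : t ≤ T) :
    HasL2Bound μ (fun ω => ∫ r in s..t, W r ω (grad u)) √(κ * sqNorm u * (t - s)) := by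
  obtain ⟨e, he, hv⟩ := exists_cutPrimitive_rate u
  have hlim : Tendsto (fun M => √(κ * (t - s)) * √(energy (cutPrimitive M u)) +
      (t - s) * (√χ * e M)) atTop (𝓝 (√(κ * (t - s)) * √(sqNorm u) + (t - s) * (√χ * 0))) :=
    ((tendsto_sqrt_energy he fun M => (hv M).2.1).const_mul _).add
      ((he.const_mul _).const_mul _)
  have hts : 0 < t - s := sub_pos.2 hst
  have hfin : √(κ * (t - s)) * √(sqNorm u) + (t - s) * (√χ * 0) = √(κ * sqNorm u * (t - s)) := by
    rw [mul_zero, mul_zero, add_zero, ← Real.sqrt_mul (by positivity)]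
    congr 1
    ring
  rw [hfin] at hlim
  refine HasL2Bound.of_tendsto (l := atTop) (Eventually.of_forall fun M => ?_) hlim
  have h1 := h.energy_one (cutPrimitive M u) s t hs hst ht
  have h2 := h.hasL2Bound_time_integral_sub hχ (grad u) (lap (cutPrimitive M u)) hst.le
  refine ((h1.add h2).congr (ae_of_all _ fun ω => ?_)).mono ?_
  · simp only
    ring
  · rw [Real.sqrt_mul (by positivity)]
    gcongr
    rw [sqrt_sqNorm_sub_comm]
    exact (hv M).2.2

theorem hasL2Bound_quad_sub_grad (h : IsBurgersFlow μ D χ lam T κ W V 𝓕 A N) (hχ : 0 ≤ χ)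
    {ε : ℝ} (hε : 0 < ε) (u v : 𝓢(ℝ, ℝ)) {s t : ℝ} (hst : s ≤ t) {c : ℝ}
    (hc : √(sqNorm (grad v - u)) ≤ c) :
    HasL2Bound μ (fun ω => renormQuad χ ε (V ε) s t u ω - renormQuad χ ε (V ε) s t (grad v) ω)
      ((t - s) * (√(4 * χ ^ 2 / ε) * c)) := by
  refine ((h.hasL2Bound_quad hχ hε (u - grad v) hst).congr
    ((h.field ε hε).quad_sub_ae_eq h.white hχ hε u (grad v) hst)).mono ?_
  have : 0 ≤ t - s := sub_nonneg.2 hst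
  rw [Real.sqrt_mul (by positivity)]
  gcongr
  rwa [sqrt_sqNorm_sub_comm]

/-- For fixed `ε` and `δ` the functionals are continuous in the test function, so `u` can be
replaced by the gradients of its cut primitives. The constants of that continuity blow up as the
scales shrink, but they multiply a vanishing error; the surviving constant is the uniform one of the
energy estimate. -/
theorem hasL2Bound_quad_diff (h : IsBurgersFlow μ D χ lam T κ W V 𝓕 A N) (hχ : 0 ≤ χ) (hκ : 0 ≤ κ)
    (u : 𝓢(ℝ, ℝ)) {s t ε δ : ℝ} (hs : 0 ≤ s) (hst : s < t) (ht : t ≤ T) (hδ : 0 < δ) (hδε : δ < ε)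
    (hε : ε < 1) :
    HasL2Bound μ (fun ω => renormQuad χ ε (V ε) s t u ω - renormQuad χ δ (V δ) s t u ω)
      (√κ * √((t - s) * ε * sqNorm u)) := by
  obtain ⟨e, he, hv⟩ := exists_cutPrimitive_rate u
  have hε0 := hδ.trans hδε
  have hts : 0 < t - s := sub_pos.2 hst
  have hlim : Tendsto (fun M => (t - s) * (√(4 * χ ^ 2 / ε) * e M) +
      √(κ * (t - s) * ε) * √(energy (cutPrimitive M u)) + (t - s) * (√(4 * χ ^ 2 / δ) * e M)) atTop
      (𝓝 ((t - s) * (√(4 * χ ^ 2 / ε) * 0) + √(κ * (t - s) * ε) * √(sqNorm u) +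
        (t - s) * (√(4 * χ ^ 2 / δ) * 0))) :=
    (((he.const_mul _).const_mul _).add ((tendsto_sqrt_energy he fun M => (hv M).2.1).const_mul _)).add
      ((he.const_mul _).const_mul _)
  have hfin : (t - s) * (√(4 * χ ^ 2 / ε) * 0) + √(κ * (t - s) * ε) * √(sqNorm u) +
      (t - s) * (√(4 * χ ^ 2 / δ) * 0) = √κ * √((t - s) * ε * sqNorm u) := by
    simp only [mul_zero, add_zero, zero_add]
    rw [← Real.sqrt_mul (by positivity),
      ← Real.sqrt_mul hκ]
    congr 1
    ring
  rw [hfin] at hlim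
  refine HasL2Bound.of_tendsto (l := atTop) (Eventually.of_forall fun M => ?_) hlim
  have h1 := h.hasL2Bound_quad_sub_grad hχ hε0 u (cutPrimitive M u) hst.le (hv M).2.1
  have h2 := h.energy_two (cutPrimitive M u) s t ε δ hs hst ht hδ hδε hε
  have h3 := h.hasL2Bound_quad_sub_grad hχ hδ u (cutPrimitive M u) hst.le (hv M).2.1
  rw [Real.sqrt_mul (by positivity)] at h2
  refine ((h1.add h2).sub h3).congr (ae_of_all _ fun ω => ?_)
  simp only
  ring

/-- A constant in the energy estimate for the KPZ equation, valid for all `ε > δ > 0`. -/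
def kpzConst (χ T κ : ℝ) : ℝ := 5 * χ * √T + √κ

/-- At scales bounded below no cancellation between the two terms is needed: each satisfies the
fourth-moment bound, and `(t - s)² ≤ T (t - s) ε` since `ε ≥ 1`. -/
theorem hasL2Bound_quad_diff_of_one_le (h : IsBurgersFlow μ D χ lam T κ W V 𝓕 A N) (hχ : 0 ≤ χ)
    (u : 𝓢(ℝ, ℝ)) {s t ε δ : ℝ} (hs : 0 ≤ s) (hst : s < t) (ht : t ≤ T) (hδ : 1 / 2 ≤ δ)
    (hε : 1 ≤ ε) :
    HasL2Bound μ (fun ω => renormQuad χ ε (V ε) s t u ω - renormQuad χ δ (V δ) s t u ω)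
      (5 * χ * √T * √((t - s) * ε * sqNorm u)) := by
  have hts : 0 < t - s := sub_pos.2 hst
  have hu := sqNorm_nonneg u
  have hT : 0 ≤ T := by linarith
  have hp : ∀ {c ρ : ℝ}, 0 ≤ c → 0 < ρ → 4 / ρ ≤ c ^ 2 →
      (t - s) * √(4 * χ ^ 2 / ρ * sqNorm u) ≤ c * χ * √T * √((t - s) * ε * sqNorm u) := by
    intro c ρ hc hρ hcρ
    have e1 : (t - s) * √(4 * χ ^ 2 / ρ * sqNorm u) =
        √((t - s) ^ 2 * (4 * χ ^ 2 / ρ * sqNorm u)) := by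
      rw [Real.sqrt_mul (sq_nonneg _), Real.sqrt_sq hts.le]
    have e2 : c * χ * √T * √((t - s) * ε * sqNorm u) =
        √((c * χ) ^ 2 * (T * ((t - s) * ε * sqNorm u))) := by
      rw [Real.sqrt_mul (sq_nonneg _), Real.sqrt_sq (by positivity), Real.sqrt_mul hT]
      ring
    rw [e1, e2]
    refine Real.sqrt_le_sqrt ?_
    have h1 : (t - s) ^ 2 ≤ T * (t - s) * ε := by
      have h2 : t - s ≤ T := by linarith
      nlinarith [mul_le_mul_of_nonneg_right h2 hts.le,
        mul_nonneg (mul_nonneg hT hts.le) (sub_nonneg.2 hε)]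
    calc (t - s) ^ 2 * (4 * χ ^ 2 / ρ * sqNorm u)
        = (t - s) ^ 2 * (4 / ρ * (χ ^ 2 * sqNorm u)) := by ring
      _ ≤ (T * (t - s) * ε) * (c ^ 2 * (χ ^ 2 * sqNorm u)) := by gcongr
      _ = _ := by ring
  have hε0 : 0 < ε := by linarith
  have hδ0 : 0 < δ := by linarith
  -- The constants satisfy `4/ε ≤ 2²` here and `4/δ ≤ 8 ≤ 3²` below; they add up to `5`.
  have h1 := (h.hasL2Bound_quad hχ hε0 u hst.le).mono (hp (c := 2) (by norm_num) hε0
    (by rw [div_le_iff₀ hε0]; linarith))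
  have h2 := (h.hasL2Bound_quad hχ hδ0 u hst.le).mono (hp (c := 3) (by norm_num) hδ0
    (by rw [div_le_iff₀ hδ0]; linarith))
  exact (h1.sub h2).mono (by apply le_of_eq; ring)

/-- The Burgers estimate is limited to `ε < 1`. For `ε ≥ 1` and small `δ` the intermediate scale
`1/2` links the two regimes. -/
theorem hasL2Bound_quad_diff_all (h : IsBurgersFlow μ D χ lam T κ W V 𝓕 A N) (hχ : 0 ≤ χ)
    (hκ : 0 ≤ κ) (u : 𝓢(ℝ, ℝ)) {s t ε δ : ℝ} (hs : 0 ≤ s) (hst : s < t) (ht : t ≤ T) (hδ : 0 < δ)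
    (hδε : δ < ε) :
    HasL2Bound μ (fun ω => renormQuad χ ε (V ε) s t u ω - renormQuad χ δ (V δ) s t u ω)
      (kpzConst χ T κ * √((t - s) * ε * sqNorm u)) := by
  have hts : 0 < t - s := sub_pos.2 hst
  have hu := sqNorm_nonneg u
  have hk : 0 ≤ 5 * χ * √T := by positivity
  have hr : 0 ≤ √((t - s) * ε * sqNorm u) := Real.sqrt_nonneg _
  rw [kpzConst, add_mul]
  by_cases hε : ε < 1
  · exact (h.hasL2Bound_quad_diff hχ hκ u hs hst ht hδ hδε hε).mono
      (le_add_of_nonneg_left (by positivity))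
  · have hε1 : 1 ≤ ε := not_lt.1 hε
    by_cases hδ2 : 1 / 2 ≤ δ
    · exact (h.hasL2Bound_quad_diff_of_one_le hχ u hs hst ht hδ2 hε1).mono
        (le_add_of_nonneg_right (by positivity))
    · have h1 := h.hasL2Bound_quad_diff_of_one_le hχ u hs hst ht (δ := 1 / 2) le_rfl hε1
      have h2 := h.hasL2Bound_quad_diff hχ hκ u hs hst ht hδ (not_le.1 hδ2) (by norm_num)
      refine ((h1.add h2).congr (ae_of_all _ fun ω => ?_)).mono ?_
      · simp only
        ring
      · gcongr
        linarith

/-- Let `δ → 0` in the energy estimate. Time zero is separate because that estimate assumes `s < t`.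
-/
theorem hasL2Bound_quad_sub_nonlin (h : IsBurgersFlow μ D χ lam T κ W V 𝓕 A N)
    (hχ : 0 ≤ χ) (u : 𝓢(ℝ, ℝ)) (t : Icc (0 : ℝ) T) {ε : ℝ} (hε : 0 < ε) (hε1 : ε < 1) :
    HasL2Bound μ (fun ω => renormQuad χ ε (V ε) 0 t (grad u) ω - A u t ω)
      √(κ * t * ε * energy u) := by
  have hQ := h.hasL2Bound_quad hχ hε (grad u) t.2.1
  refine (h.limit u t).hasL2Bound_sub hQ.aesm ?_
  rcases t.2.1.eq_or_lt with e | hlt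
  · refine Eventually.of_forall fun δ => ?_
    have h0 : ∀ ε, renormQuad χ ε (V ε) 0 t (grad u) = fun _ => 0 := fun ε => by
      funext ω
      simp [renormQuad, ← e]
    simp only [h0, sub_zero]
    exact ⟨aestronglyMeasurable_const, Real.sqrt_nonneg _, by simp⟩
  · filter_upwards [self_mem_nhdsWithin, mem_nhdsWithin_of_mem_nhds (Iio_mem_nhds hε)] with δ hδ hδε
    have := h.energy_two u 0 t ε δ le_rfl hlt t.2.2 hδ hδε hε1
    rwa [sub_zero] at this

/-- An exchange of the limits `M → ∞` and `ε → 0`. The increment bound makes `A (cutPrimitive M u)`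
Cauchy; at fixed `ε` the distance to the regularisation, of order `√ε` uniformly in `M`, passes to
the limit, and `ε → 0` comes last. -/
theorem exists_nonlin_limit (h : IsBurgersFlow μ D χ lam T κ W V 𝓕 A N) (hT : 0 < T)
    (hχ : 0 ≤ χ) (hκ : 0 ≤ κ) (u : 𝓢(ℝ, ℝ)) (t : Icc (0 : ℝ) T) :
    ∃ X : Ω → ℝ, IsL2Limit μ (fun ε => renormQuad χ ε (V ε) 0 t u) X ∧
      ∃ d : ℕ+ → ℝ, Tendsto d atTop (𝓝 0) ∧
        ∀ M, HasL2Bound μ (fun ω => A (cutPrimitive M u) t ω - X ω) (d M) := by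
  obtain ⟨e, he, hv⟩ := exists_cutPrimitive_rate u
  set v : ℕ+ → 𝓢(ℝ, ℝ) := fun M => cutPrimitive M u with hvdef
  set K := nonlinConst χ T κ * √((t : ℝ) * √t) with hK
  have hn : 0 ≤ nonlinConst χ T κ := by unfold nonlinConst; positivity
  have hK0 : 0 ≤ K := by positivity
  have hdiff : ∀ m n, HasL2Bound μ (fun ω => A (v m) t ω - A (v n) t ω) (K * e m + K * e n) := by
    intro m n
    have h1 := h.hasL2Bound_nonlin hχ (v m - v n) (s := ⟨0, left_mem_Icc.2 hT.le⟩) (t := t) t.2.1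
    refine (h1.congr ?_).mono ?_
    · filter_upwards [h.nonlin_zero hT.le (v m - v n), h.nonlin_sub_ae_eq hχ (v m) (v n) t]
        with ω h2 h3
      rw [h2, h3]
      simp
    · simp only [sub_zero]
      rw [← mul_add]
      have h4 : √(energy (v m - v n)) ≤ e m + e n := by
        rw [energy, grad_sub]
        exact (sqrt_sqNorm_sub_le _ _ u).trans (add_le_add (hv m).2.1 (hv n).2.1)
      calc nonlinConst χ T κ * √(energy (v m - v n)) * √((t : ℝ) * √t)
          = K * √(energy (v m - v n)) := by rw [hK]; ring
        _ ≤ _ := by gcongr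
  have hKe : Tendsto (fun n => K * e n) atTop (𝓝 0) := by simpa using he.const_mul K
  obtain ⟨X, hXm, hXL, hX⟩ := exists_limit_of_cauchy (p := 2) (X := fun n => A (v n) t)
    (fun n => (h.limit (v n) t).1) hKe fun m n => (hdiff m n).le
  obtain ⟨d, hd, hd0⟩ := exists_hasL2Bound_of_tendsto
    (Z := fun n ω => A (v n) t ω - X ω) (fun n => (h.limit (v n) t).1.sub hXL) hX
  refine ⟨X, ⟨hXL, ?_⟩, d, hd0, hd⟩
  have hbd : ∀ ε, 0 < ε → ε < 1 → HasL2Bound μ (fun ω => renormQuad χ ε (V ε) 0 t u ω - X ω)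
      √(κ * t * ε * sqNorm u) := by
    intro ε hε hε1
    have ht0 : 0 ≤ (t : ℝ) := t.2.1
    have hlim : Tendsto (fun M => (t - 0) * (√(4 * χ ^ 2 / ε) * e M) +
        √(κ * t * ε) * √(energy (v M)) + d M) atTop
        (𝓝 ((t - 0) * (√(4 * χ ^ 2 / ε) * 0) + √(κ * t * ε) * √(sqNorm u) + 0)) :=
      (((he.const_mul _).const_mul _).add
        ((tendsto_sqrt_energy he fun M => (hv M).2.1).const_mul _)).add hd0
    have hfin : ((t : ℝ) - 0) * (√(4 * χ ^ 2 / ε) * 0) + √(κ * t * ε) * √(sqNorm u) + 0 =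
        √(κ * t * ε * sqNorm u) := by
      rw [Real.sqrt_mul (x := κ * t * ε) (by positivity)]
      ring
    rw [hfin] at hlim
    refine HasL2Bound.of_tendsto (l := atTop) (Eventually.of_forall fun M => ?_) hlim
    have h1 := h.hasL2Bound_quad_sub_grad hχ hε u (v M) ht0 (hv M).2.1
    have h2 := h.hasL2Bound_quad_sub_nonlin hχ (v M) t hε hε1
    rw [Real.sqrt_mul (by positivity)] at h2
    refine ((h1.add h2).add (hd M)).congr (ae_of_all _ fun ω => ?_)
    simp only
    ring
  have hz : Tendsto (fun ε : ℝ => ENNReal.ofReal √(κ * t * ε * sqNorm u)) (𝓝[>] 0) (𝓝 0) := by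
    have hcont : Continuous fun ε : ℝ => ENNReal.ofReal √(κ * t * ε * sqNorm u) :=
      ENNReal.continuous_ofReal.comp (by fun_prop)
    have := hcont.tendsto 0
    simp only [mul_zero, zero_mul, Real.sqrt_zero, ENNReal.ofReal_zero] at this
    exact this.mono_left nhdsWithin_le_nhds
  refine tendsto_of_tendsto_of_tendsto_of_le_of_le' tendsto_const_nhds hz
    (Eventually.of_forall fun _ => zero_le) ?_
  filter_upwards [self_mem_nhdsWithin, mem_nhdsWithin_of_mem_nhds (Iio_mem_nhds one_pos)] with ε h1 h2
  exact (hbd ε h1 h2).le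

end IsBurgersFlow

end EnergyBounds

/-! ### Completed filtrations and limits of martingales. -/

section Completion

variable {Ω ι : Type*} [Preorder ι] {m₀ : MeasurableSpace Ω}

/-- The filtration obtained by adding the measurable null sets. -/
def completedFiltration (μ : Measure Ω) (𝓕 : Filtration ι m₀) : Filtration ι m₀ where
  seq i := eventuallyMeasurableSpace (𝓕 i) (ae μ) ⊓ m₀
  mono' _ _ hij := inf_le_inf_right _ fun _ ⟨t, ht, hst⟩ => ⟨t, 𝓕.mono hij t ht, hst⟩
  le' _ := inf_le_right

variable {μ : Measure Ω} {𝓕 : Filtration ι m₀}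

theorem le_completedFiltration (i : ι) : 𝓕 i ≤ completedFiltration μ 𝓕 i :=
  le_inf (le_eventuallyMeasurableSpace) (𝓕.le i)

theorem measurable_completedFiltration {i : ι} {f : Ω → ℝ} (hf : Measurable f)
    (h : AEStronglyMeasurable[𝓕 i] f μ) : Measurable[completedFiltration μ 𝓕 i] f := by
  intro s hs
  refine MeasurableSpace.measurableSet_inf.2 ⟨?_, hf hs⟩
  exact h.stronglyMeasurable_mk.measurable.eventuallyMeasurable_of_eventuallyEq h.ae_eq_mk hs

/-- An event of the completed σ-algebra agrees up to a null set with one of the original, so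
integrals over it are unchanged. -/
theorem martingale_completedFiltration [IsProbabilityMeasure μ] {f : ι → Ω → ℝ}
    (hf : Martingale f 𝓕 μ) : Martingale f (completedFiltration μ 𝓕) μ := by
  have had : StronglyAdapted (completedFiltration μ 𝓕) f := fun i =>
    (hf.1 i).mono (le_completedFiltration i)
  refine ⟨had, fun i j hij => Filter.EventuallyEq.symm ?_⟩
  refine ae_eq_condExp_of_forall_setIntegral_eq ((completedFiltration μ 𝓕).le i) (hf.integrable j)
    (fun s _ _ => (hf.integrable i).integrableOn) (fun s hs _ => ?_)
    (had i).aestronglyMeasurable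
  obtain ⟨⟨t, ht, hst⟩, -⟩ := MeasurableSpace.measurableSet_inf.1 hs
  rw [setIntegral_congr_set hst, setIntegral_congr_set hst]
  exact hf.setIntegral_eq hij ht

/-- Conditional expectation is a contraction of L¹, so the martingale identity survives L¹ limits.
-/
theorem martingale_of_tendsto [IsProbabilityMeasure μ] {κ : Type*} {l : Filter κ} [l.NeBot]
    {X : κ → ι → Ω → ℝ} {Y : ι → Ω → ℝ} (hX : ∀ n, Martingale (X n) 𝓕 μ)
    (hY : StronglyAdapted 𝓕 Y) (hi : ∀ t, Integrable (Y t) μ)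
    (h : ∀ t, Tendsto (fun n => eLpNorm (X n t - Y t) 1 μ) l (𝓝 0)) : Martingale Y 𝓕 μ := by
  refine ⟨hY, fun i j hij => ?_⟩
  have hlim := (h j).add (h i)
  rw [add_zero] at hlim
  have hle : ∀ n, eLpNorm (μ[Y j|𝓕 i] - Y i) 1 μ ≤
      eLpNorm (X n j - Y j) 1 μ + eLpNorm (X n i - Y i) 1 μ := by
    intro n
    have h1 : μ[Y j|𝓕 i] - Y i =ᵐ[μ] μ[Y j - X n j|𝓕 i] + (X n i - Y i) := by
      filter_upwards [(hX n).2 i j hij, condExp_sub (hi j) ((hX n).integrable j) (𝓕 i)] with ω h2 h3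
      simp only [Pi.sub_apply, Pi.add_apply] at h3 ⊢
      rw [h3, h2]
      ring
    rw [eLpNorm_congr_ae h1]
    refine (eLpNorm_add_le integrable_condExp.1 (((hX n).integrable i).sub (hi i)).1 le_rfl).trans ?_
    gcongr
    refine (eLpNorm_condExp_le_eLpNorm _ le_rfl).trans_eq ?_
    rw [← eLpNorm_neg, neg_sub]
  have h0 : eLpNorm (μ[Y j|𝓕 i] - Y i) 1 μ = 0 :=
    le_antisymm (ge_of_tendsto' hlim hle) zero_le
  rw [eLpNorm_eq_zero_iff (integrable_condExp.sub (hi i)).1 one_ne_zero] at h0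
  filter_upwards [h0] with ω hω
  exact sub_eq_zero.1 hω

theorem aestronglyMeasurable_of_hasL2Bound {m m₀ : MeasurableSpace Ω} {μ : Measure[m₀] Ω}
    {X : ℕ+ → Ω → ℝ} {Y : Ω → ℝ} {d : ℕ+ → ℝ} (hm : m ≤ m₀) (hX : ∀ n, Measurable[m] (X n))
    (hY : AEStronglyMeasurable Y μ)
    (h : ∀ n, HasL2Bound μ (fun ω => X n ω - Y ω) (d n)) (hd : Tendsto d atTop (𝓝 0)) :
    AEStronglyMeasurable[m] Y μ := by
  have h3 := tendstoInMeasure_of_tendsto_eLpNorm (p := 2) (by norm_num)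
    (fun n => ((hX n).mono hm le_rfl).aestronglyMeasurable) hY (HasL2Bound.tendsto_eLpNorm h hd)
  obtain ⟨ns, -, hns⟩ := h3.exists_seq_tendsto_ae'
  refine ⟨fun ω => limsup (fun i => X (ns i) ω) atTop,
    (Measurable.limsup fun i => hX (ns i)).stronglyMeasurable, ?_⟩
  filter_upwards [hns] with ω hω
  exact hω.limsup_eq.symm

end Completion

/-! ### Stability of the quadratic variation. -/

section SquareLimit

variable {Ω : Type*} [MeasurableSpace Ω] {μ : Measure Ω} [IsProbabilityMeasure μ]

theorem eLpNorm_sq_sub_sq_le {X S : Ω → ℝ} {d c : ℝ} (h : HasL2Bound μ (fun ω => X ω - S ω) d)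
    (hS : HasL2Bound μ S c) :
    eLpNorm (fun ω => X ω ^ 2 - S ω ^ 2) 1 μ ≤ ENNReal.ofReal (d * (d + 2 * c)) := by
  have h1 : HasL2Bound μ (fun ω => X ω + S ω) (d + 2 * c) := by
    refine (h.add (hS.const_mul 2)).congr (ae_of_all _ fun ω => ?_) |>.mono ?_
    · ring
    · rw [abs_of_pos two_pos]
  have e : (fun ω => X ω ^ 2 - S ω ^ 2) = (fun ω => X ω - S ω) • fun ω => X ω + S ω := by
    funext ω
    simp only [Pi.smul_apply', smul_eq_mul]
    ring
  rw [e, ENNReal.ofReal_mul h.nonneg]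
  refine (eLpNorm_smul_le_mul_eLpNorm (p := 2) (q := 2) (r := 1) h1.aesm h.aesm).trans ?_
  gcongr
  · exact h.le
  · exact h1.le

theorem HasL2Bound.eLpNorm_one_le {X : Ω → ℝ} {c : ℝ} (h : HasL2Bound μ X c) :
    eLpNorm X 1 μ ≤ ENNReal.ofReal c :=
  (eLpNorm_le_eLpNorm_of_exponent_le (by norm_num) h.aesm).trans h.le

theorem tendsto_ofReal_zero {ι : Type*} {l : Filter ι} {f : ι → ℝ} (h : Tendsto f l (𝓝 0)) :
    Tendsto (fun i => ENNReal.ofReal (f i)) l (𝓝 0) := by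
  simpa using ENNReal.tendsto_ofReal h

/-- L² convergence at each time gives L¹ convergence of both `N` and `N² - ct`. The limit is
measurable for the original filtration only up to null sets, which explains the completion. -/
theorem isMartingaleWithQV_of_tendsto {T : ℝ}
    {𝓕 : Filtration (Icc (0 : ℝ) T) ‹MeasurableSpace Ω›} {N : ℕ+ → Icc (0 : ℝ) T → Ω → ℝ}
    {S : Ω → C(Icc (0 : ℝ) T, ℝ)} {c : ℕ+ → ℝ} {c' : ℝ} {d : ℕ+ → ℝ}
    (hN : ∀ n, IsMartingaleWithQV μ 𝓕 (c n) (N n)) (hS : Measurable S)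
    (hd : Tendsto d atTop (𝓝 0)) (hc : Tendsto c atTop (𝓝 c'))
    (h : ∀ n t, HasL2Bound μ (fun ω => N n t ω - S ω t) (d n)) :
    IsMartingaleWithQV μ (completedFiltration μ 𝓕) c' fun t ω => S ω t := by
  have hSt : ∀ t, Measurable fun ω => S ω t := fun t =>
    (continuous_eval_const t).measurable.comp hS
  have had : ∀ t, Measurable[completedFiltration μ 𝓕 t] fun ω => S ω t := fun t =>
    measurable_completedFiltration (hSt t) (aestronglyMeasurable_of_hasL2Bound (𝓕.le t)
      (fun n => ((hN n).martingale.1 t).measurable) (hSt t).aestronglyMeasurable (fun n => h n t) hd)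
  have hL2 : ∀ t, MemLp (fun ω => S ω t) 2 μ := fun t => by
    have h1 : MemLp (N 1 t) 2 μ :=
      (memLp_two_iff_integrable_sq ((hN 1).measurable t).aestronglyMeasurable).2
        ((hN 1).integrable_sq t)
    exact (h1.sub (h 1 t).memLp).ae_eq (ae_of_all _ fun ω => by simp)
  refine ⟨fun ω => (S ω).continuous, ?_, ?_⟩
  · refine martingale_of_tendsto (l := atTop)
      (fun n => martingale_completedFiltration (hN n).martingale)
      (fun t => (had t).stronglyMeasurable) (fun t => (hL2 t).integrable (by norm_num)) fun t => ?_
    exact tendsto_of_tendsto_of_tendsto_of_le_of_le tendsto_const_nhds (tendsto_ofReal_zero hd)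
      (fun _ => zero_le) fun n => (h n t).eLpNorm_one_le
  · refine martingale_of_tendsto (l := atTop)
      (fun n => martingale_completedFiltration (hN n).quadraticVariation)
      (fun t => (((had t).pow_const 2).sub_const _).stronglyMeasurable)
      (fun t => (hL2 t).integrable_sq.sub (integrable_const _)) fun t => ?_
    have hSb := hasL2Bound_toReal (hL2 t)
    set b := (eLpNorm (fun ω => S ω t) 2 μ).toReal
    have hlim : Tendsto (fun n => d n * (d n + 2 * b) + |(c n - c') * t|) atTop (𝓝 0) := by
      have h1 := (hd.mul (hd.add_const (2 * b))).add ((hc.sub_const c').mul_const (t : ℝ)).abs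
      simpa using h1
    refine tendsto_of_tendsto_of_tendsto_of_le_of_le tendsto_const_nhds
      (tendsto_ofReal_zero hlim) (fun _ => zero_le) fun n => ?_
    have e : ((fun ω => N n t ω ^ 2 - c n * t) - fun ω => S ω t ^ 2 - c' * t) =
        (fun ω => N n t ω ^ 2 - S ω t ^ 2) - fun _ => (c n - c') * (t : ℝ) := by
      funext ω
      simp only [Pi.sub_apply]
      ring
    change eLpNorm ((fun ω => N n t ω ^ 2 - c n * t) - fun ω => S ω t ^ 2 - c' * t) 1 μ ≤ _
    rw [e]
    have hnn : 0 ≤ d n * (d n + 2 * b) :=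
      mul_nonneg (h n t).nonneg (add_nonneg (h n t).nonneg (mul_nonneg two_pos.le hSb.nonneg))
    refine (eLpNorm_sub_le ?_ aestronglyMeasurable_const le_rfl).trans ?_
    · exact ((((hN n).measurable t).pow_const 2).sub ((hSt t).pow_const 2)).aestronglyMeasurable
    · rw [ENNReal.ofReal_add hnn (abs_nonneg _)]
      refine add_le_add (eLpNorm_sq_sub_sq_le (h n t) hSb) ?_
      rw [eLpNorm_const _ one_ne_zero (NeZero.ne μ), measure_univ, ENNReal.one_rpow, mul_one,
        Real.enorm_eq_ofReal_abs]

end SquareLimit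

/-! ### The KPZ equation and its energy conditions. -/

section Solution

variable {Ω : Type*} [MeasurableSpace Ω] {μ : Measure Ω} [IsProbabilityMeasure μ]
  {D χ lam T κ : ℝ} {W : ℝ → Ω → Distr} {V : ℝ → ℝ → ℝ → Ω → ℝ}
  {𝓕 : Filtration (Icc (0 : ℝ) T) ‹MeasurableSpace Ω›} {A N : 𝓢(ℝ, ℝ) → Icc (0 : ℝ) T → Ω → ℝ}

namespace IsBurgersFlow

/-- The Burgers equation for `cutPrimitive n u` holds exactly. Each of its terms is close in L² to
its limit, so the two sides of the limiting identity are at distance zero. -/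
theorem limit_formula (h : IsBurgersFlow μ D χ lam T κ W V 𝓕 A N) (hχ : 0 ≤ χ) (u : 𝓢(ℝ, ℝ))
    (t : Icc (0 : ℝ) T) {S Z X : Ω → ℝ} {d₁ d₂ d₃ e : ℕ+ → ℝ}
    (hd₁ : Tendsto d₁ atTop (𝓝 0)) (hd₂ : Tendsto d₂ atTop (𝓝 0)) (hd₃ : Tendsto d₃ atTop (𝓝 0))
    (he : Tendsto e atTop (𝓝 0))
    (hS : ∀ n, HasL2Bound μ (fun ω => N (cutPrimitive n u) t ω - S ω) (d₁ n))
    (hZ : ∀ n, HasL2Bound μ (fun ω => noisePath T h.cont (logisticCutoff n) ω t - Z ω) (d₂ n))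
    (hX : ∀ n, HasL2Bound μ (fun ω => A (cutPrimitive n u) t ω - X ω) (d₃ n))
    (hu : ∀ n, √(sqNorm (lap (cutPrimitive n u) - grad u)) ≤ e n) :
    ∀ᵐ ω ∂μ, S ω = W t ω (correctedPrimitive u) - W 0 ω (correctedPrimitive u) + mean u * Z ω -
      D * (∫ s in (0 : ℝ)..t, W s ω (grad u)) - lam * X ω := by
  refine HasL2Bound.ae_eq_of_sub (HasL2Bound.of_tendsto (l := atTop)
    (d := fun n => |mean u| * d₂ n + |D| * (t * (√χ * e n)) + |lam| * d₃ n + d₁ n)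
    (Eventually.of_forall fun n => ?_) ?_)
  · have hdr := h.hasL2Bound_time_integral_sub hχ (lap (cutPrimitive n u)) (grad u) t.2.1
    rw [sub_zero] at hdr
    have ht0 : 0 ≤ (t : ℝ) := t.2.1
    have hdr' := hdr.mono (b := t * (√χ * e n)) (by have := hu n; gcongr)
    refine ((((hZ n).const_mul (mean u)).sub (hdr'.const_mul D)).sub
      ((hX n).const_mul lam)).sub (hS n) |>.congr ?_
    filter_upwards [h.formula (cutPrimitive n u) t] with ω hω
    rw [hω]
    have h1 : ∀ r, W r ω (cutPrimitive n u) =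
        W r ω (correctedPrimitive u) + mean u * W r ω (logisticCutoff n) := fun r => by
      rw [cutPrimitive, map_add, map_smul, smul_eq_mul]
    change mean u * ((W t ω (logisticCutoff n) - W 0 ω (logisticCutoff n)) - Z ω) - _ - _ - _ = _
    rw [h1, h1]
    ring
  · have := (((hd₂.const_mul |mean u|).add (((he.const_mul √χ).const_mul (t : ℝ)).const_mul |D|)).add
      (hd₃.const_mul |lam|)).add hd₁
    simpa using this

theorem energy_condition (h : IsBurgersFlow μ D χ lam T κ W V 𝓕 A N) (hχ : 0 ≤ χ)
    (hκ : 0 < κ) {z G : ℝ → Ω → ℝ} {H : ℝ → ℝ → Ω → ℝ} (hH : IsHeight μ W z G H) :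
    ∃ κ > 0,
    (∀ (u : 𝓢(ℝ, ℝ)) s t, 0 ≤ s → s < t → t ≤ T →
      secondMoment μ (fun ω => ∫ r in s..t, ∫ x, H r x ω * lap u x) ≤
        ENNReal.ofReal (κ * sqNorm u * (t - s))) ∧
    (∀ (u : 𝓢(ℝ, ℝ)) s t ε δ, mean u = 0 → 0 ≤ s → s < t → t ≤ T → 0 < δ → δ < ε →
      secondMoment μ (fun ω => kpzNonlin χ H ε s t u ω - kpzNonlin χ H δ s t u ω) ≤
        ENNReal.ofReal (κ * ε * sqNorm u * (t - s))) := by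
  have hk : 0 < kpzConst χ T κ := by
    unfold kpzConst
    have := Real.sqrt_pos.2 hκ
    positivity
  have hκk : κ ≤ kpzConst χ T κ ^ 2 := by
    have h1 : √κ ≤ kpzConst χ T κ := le_add_of_nonneg_left (by positivity)
    calc κ = √κ ^ 2 := (Real.sq_sqrt hκ.le).symm
      _ ≤ _ := pow_le_pow_left₀ (Real.sqrt_nonneg _) h1 2
  -- The nonlinear estimate dictates this constant; for the drift `κ ≤ kpzConst²` is enough.
  refine ⟨kpzConst χ T κ ^ 2, by positivity, fun u s t hs hst ht => ?_,
    fun u s t ε δ _ hs hst ht hδ hδε => ?_⟩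
  · have h1 := (h.hasL2Bound_drift hχ hκ.le u hs hst ht).congr
      (hH.integral_lap_time h.white h.cont u s t).symm
    have hts : 0 ≤ t - s := sub_nonneg.2 hst.le
    have hu := sqNorm_nonneg u
    refine h1.lintegral_le.trans (ENNReal.ofReal_le_ofReal ?_)
    rw [Real.sq_sqrt (by positivity)]
    gcongr
  · have hε := hδ.trans hδε
    have h1 := (h.hasL2Bound_quad_diff_all hχ hκ.le u hs hst ht hδ hδε).congr
      ((hH.quad_ae_eq h.white hχ hε (h.field ε hε) u s t).symm.sub
        (hH.quad_ae_eq h.white hχ hδ (h.field δ hδ) u s t).symm)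
    have hts : 0 ≤ t - s := sub_nonneg.2 hst.le
    have hu := sqNorm_nonneg u
    refine h1.lintegral_le.trans (ENNReal.ofReal_le_ofReal ?_)
    rw [mul_pow, Real.sq_sqrt (by positivity)]
    apply le_of_eq
    ring

end IsBurgersFlow

end Solution

/-! ### The height is an almost stationary energy solution. -/

section Construction

variable {Ω : Type*} [MeasurableSpace Ω] {μ : Measure Ω} [IsProbabilityMeasure μ]
  {D χ lam T κ : ℝ} {W : ℝ → Ω → Distr} {V : ℝ → ℝ → ℝ → Ω → ℝ}
  {𝓕 : Filtration (Icc (0 : ℝ) T) ‹MeasurableSpace Ω›} {A N : 𝓢(ℝ, ℝ) → Icc (0 : ℝ) T → Ω → ℝ}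
  {d : ℕ+ → ℝ} {Z : Ω → C(Icc (0 : ℝ) T, ℝ)} {G : ℝ → Ω → ℝ} {H : ℝ → ℝ → Ω → ℝ}

namespace IsBurgersFlow

theorem limitPath_zero (h : IsBurgersFlow μ D χ lam T κ W V 𝓕 A N) (hT : 0 < T)
    (hd : Tendsto d atTop (𝓝 0))
    (hZ : ∀ n t, HasL2Bound μ (fun ω => noisePath T h.cont (logisticCutoff n) ω t - Z ω t) (d n)) :
    ∀ᵐ ω ∂μ, Z ω ⟨0, left_mem_Icc.2 hT.le⟩ = 0 := by
  have h1 : HasL2Bound μ (fun ω => 0 - Z ω ⟨0, left_mem_Icc.2 hT.le⟩) 0 := by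
    refine HasL2Bound.of_tendsto (l := atTop) (d := d) (Eventually.of_forall fun n => ?_) hd
    refine (hZ n ⟨0, left_mem_Icc.2 hT.le⟩).congr (ae_of_all _ fun ω => ?_)
    change W 0 ω (logisticCutoff n) - W 0 ω (logisticCutoff n) - _ = _
    rw [sub_self]
  filter_upwards [h1.ae_eq_of_sub] with ω hω
  exact hω.symm

/-- The height at time `t` is a sum of a pairing with `W t`, the path limit at `t`, and the defects
at times `t` and `0`; each is a limit of variables measurable at time `t`. -/
theorem adapted_height (h : IsBurgersFlow μ D χ lam T κ W V 𝓕 A N) (hT : 0 < T)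
    (hZm : Measurable Z) (hd : Tendsto d atTop (𝓝 0))
    (hZ : ∀ n t, HasL2Bound μ (fun ω => noisePath T h.cont (logisticCutoff n) ω t - Z ω t) (d n))
    (hH : IsHeight μ W (fun t ω => Z ω (projIcc 0 T hT.le t)) G H) (t : Icc (0 : ℝ) T) (x : ℝ) :
    Measurable[completedFiltration μ 𝓕 t] (H t x) := by
  have h0 : (⟨0, left_mem_Icc.2 hT.le⟩ : Icc (0 : ℝ) T) ≤ t := t.2.1
  have had0 : ∀ u, Measurable[𝓕 t] fun ω => W 0 ω u := fun u =>
    (h.adapted ⟨0, left_mem_Icc.2 hT.le⟩ u).mono (𝓕.mono h0) le_rfl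
  have hZt : AEStronglyMeasurable[𝓕 t] (fun ω => Z ω t) μ :=
    aestronglyMeasurable_of_hasL2Bound (𝓕.le t)
      (X := fun n ω => noisePath T h.cont (logisticCutoff n) ω t)
      (fun n => (h.adapted t _).sub (had0 _))
      ((continuous_eval_const t).measurable.comp hZm).aestronglyMeasurable (fun n => hZ n t) hd
  have hi := (hH.increments t x).aestronglyMeasurable_of_le (h.white t) (h.adapted t)
  have hG := (hH.defect t).aestronglyMeasurable_of_le (h.white t) (h.adapted t)
  have hG0 := (hH.defect 0).aestronglyMeasurable_of_le (h.white 0) had0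
  refine measurable_completedFiltration
    (hH.measurable.comp (measurable_const.prodMk (measurable_const.prodMk measurable_id)) :) ?_
  refine (hi.add ((hZt.add hG).sub hG0)).congr (ae_of_all _ fun ω => ?_)
  simp only [Pi.add_apply, Pi.sub_apply, projIcc_val]
  ring

/-- Subtracting the identities at times `t` and `0` eliminates `G_0`, and `Z` vanishes at time zero.
-/
theorem integral_height (hT : 0 < T) (hZ0 : ∀ᵐ ω ∂μ, Z ω ⟨0, left_mem_Icc.2 hT.le⟩ = 0)
    (hH : IsHeight μ W (fun t ω => Z ω (projIcc 0 T hT.le t)) G H) (t : Icc (0 : ℝ) T)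
    (u : 𝓢(ℝ, ℝ)) : ∀ᵐ ω ∂μ, Integrable (fun x => H t x ω * u x) ∧
      ∫ x, H t x ω * u x = W t ω (correctedPrimitive u) - W 0 ω (correctedPrimitive u) +
        mean u * Z ω t + ∫ x, H 0 x ω * u x := by
  filter_upwards [hH.integral t u, hH.integral 0 u, hZ0] with ω h1 h2 h3
  refine ⟨h1.1, ?_⟩
  rw [h1.2, h2.2, projIcc_val, projIcc_left, h3]
  ring

theorem isAlmostStationaryKPZSolution (h : IsBurgersFlow μ D χ lam T κ W V 𝓕 A N) (hT : 0 < T)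
    (hχ : 0 < χ) (hD : 0 < D) (hκ : 0 < κ) (hZm : Measurable Z) (hd : Tendsto d atTop (𝓝 0))
    (hZ : ∀ n t, HasL2Bound μ (fun ω => noisePath T h.cont (logisticCutoff n) ω t - Z ω t) (d n))
    (hH : IsHeight μ W (fun t ω => Z ω (projIcc 0 T hT.le t)) G H) :
    IsAlmostStationaryKPZSolution D χ lam T μ H := by
  refine ⟨hH.measurable.comp (by fun_prop : Measurable fun p : Icc (0 : ℝ) T × ℝ × Ω =>
      ((p.1 : ℝ), p.2.1, p.2.2)), fun t _ => hH.isTwoSidedBM h.white hχ.le t,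
    h.energy_condition hχ.le hκ hH, completedFiltration μ 𝓕,
    fun t x => h.adapted_height hT hZm hd hZ hH t x, fun u => ?_⟩
  obtain ⟨e, he, hv⟩ := exists_cutPrimitive_rate u
  obtain ⟨-, S, -, hS, -, -, hNS⟩ := h.exists_limits hT hχ hD he hv
  choose X hX dX hdX hXd using h.exists_nonlin_limit hT hχ.le hκ.le u
  have hde : Tendsto (fun n => flowConst D χ lam T κ * e n) atTop (𝓝 0) := by
    simpa using he.const_mul (flowConst D χ lam T κ)
  have hc : Tendsto (fun n => 2 * χ * D * energy (cutPrimitive n u)) atTop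
      (𝓝 (2 * χ * D * sqNorm u)) := by
    have h1 := ((tendsto_sqrt_energy he fun M => (hv M).2.1).pow 2).const_mul (2 * χ * D)
    rw [Real.sq_sqrt (sqNorm_nonneg u)] at h1
    exact h1.congr fun n => by rw [energy, Real.sq_sqrt (sqNorm_nonneg _)]
  refine ⟨X, fun t ω => S ω t, fun t => (hX t).congr ?_,
    isMartingaleWithQV_of_tendsto (fun n => h.mart (cutPrimitive n u)) hS hde hc hNS, fun t => ?_⟩
  · filter_upwards [self_mem_nhdsWithin] with ε hε
    exact (hH.quad_ae_eq h.white hχ.le hε (h.field ε hε) u 0 t).symm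
  · filter_upwards [h.limit_formula hχ.le u t hde hd (hdX t) he (fun n => hNS n t)
      (fun n => hZ n t) (hXd t) fun n => (hv n).2.2,
      integral_height hT (h.limitPath_zero hT hd hZ) hH t u,
      hH.integral_lap_time h.white h.cont u 0 t] with ω h1 h2 h3
    rw [h1, h2.2, h3]
    ring

end IsBurgersFlow

end Construction

end KPZEnergy

end

open KPZEnergy in
theorem theorem2 {Ω : Type*} [MeasurableSpace Ω] (μ : Measure Ω) [IsProbabilityMeasure μ]
    (D χ lam T : ℝ) (hD : 0 < D) (hχ : 0 < χ) (hT : 0 < T) (Y : ℝ → Ω → Distr)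
    (hY : IsStationaryEnergySolution D χ lam T μ Y) :
    ∃ Z : Ω → C(Icc (0 : ℝ) T, ℝ),
      TendstoInDistribution
        (fun M : ℕ+ => incrementPath hY.continuous_paths (logisticCutoff M)) atTop Z
        (fun _ => μ) μ ∧
      (∀ t : Icc (0 : ℝ) T, Tendsto (fun M : ℕ+ => eLpNorm (fun ω =>
        Y t ω (logisticCutoff M) - Y 0 ω (logisticCutoff M) - Z ω t) 2 μ) atTop (𝓝 0)) ∧
      ∃ h : ℝ → ℝ → Ω → ℝ,
        (∀ x, IsPairing μ (Y 0) (fun y => -orientedIndicator x y) (h 0 x)) ∧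
        (∀ (t : Icc (0 : ℝ) T) (u : 𝓢(ℝ, ℝ)), ∀ᵐ ω ∂μ,
          Integrable (fun x => h t x ω * u x) ∧
          ∫ x, h t x ω * u x =
            Y t ω (correctedPrimitive u) - Y 0 ω (correctedPrimitive u)
              + mean u * Z ω t + ∫ x, h 0 x ω * u x) ∧
        IsAlmostStationaryKPZSolution D χ lam T μ h := by
  obtain ⟨κ, W, V, 𝓕, A, N, hκ, h, hWY⟩ := exists_isBurgersFlow hχ hT hY
  -- The choice `u = F'` turns the cut primitives into the `F_M` themselves.
  obtain ⟨e, he, hv⟩ := exists_cutPrimitive_rate dlogistic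
  simp only [cutPrimitive_dlogistic] at hv
  obtain ⟨Z, -, hZm, -, hZ1, hZ2, -⟩ := h.exists_limits hT hχ hD he hv
  have hd : Tendsto (fun n => IsBurgersFlow.flowConst D χ lam T κ * e n) atTop (𝓝 0) := by
    simpa using he.const_mul (IsBurgersFlow.flowConst D χ lam T κ)
  have hW0 : W 0 = Y 0 := hWY 0 (left_mem_Icc.2 hT.le)
  have hWt : ∀ t : Icc (0 : ℝ) T, W t = Y t := fun t => hWY t t.2
  have hpath : ∀ f, incrementPath hY.continuous_paths f = noisePath T h.cont f := fun f => by
    funext ω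
    ext t
    change Y t ω f - Y 0 ω f = W t ω f - W 0 ω f
    rw [hW0, hWt]
  have hZ0 := h.limitPath_zero hT hd hZ2
  have hz : Measurable (Function.uncurry fun t ω => Z ω (projIcc 0 T hT.le t)) :=
    measurable_uncurry_of_continuous_of_measurable
      (fun ω => (Z ω).continuous.comp continuous_projIcc)
      fun t => (continuous_eval_const (projIcc 0 T hT.le t)).measurable.comp hZm
  obtain ⟨G, H, hH⟩ := exists_isHeight h.white hχ.le h.cont hz
  refine ⟨Z, ?_, fun t => ?_, H, fun x => ?_, fun t u => ?_,
    h.isAlmostStationaryKPZSolution hT hχ hD hκ hZm hd hZ2 hH⟩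
  · simp only [hpath]
    -- All paths live on the same space, so L¹ convergence in the uniform norm yields convergence in
    -- distribution through convergence in measure.
    exact (tendstoInMeasure_of_tendsto_eLpNorm one_ne_zero
      (fun n => (h.measurable_noisePath _).aestronglyMeasurable) hZm.aestronglyMeasurable
      hZ1).tendstoInDistribution fun n => (h.measurable_noisePath _).aemeasurable
  · rw [← hW0, ← hWt]
    exact HasL2Bound.tendsto_eLpNorm (fun n => hZ2 n t) hd
  · rw [← hW0]
    refine ((hH.increments 0 x).congr ae_eq_rfl ?_).isPairing
    filter_upwards [hZ0] with ω hω
    rw [projIcc_left, hω]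
    ring
  · rw [← hW0, ← hWt]
    exact IsBurgersFlow.integral_height hT hZ0 hH t u
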